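/- **Conventions.** For integers $b,n\ge 1$ let $b^{<n}$ (resp. $b^{\le n}$, $b^n$) be the set of sequences in $\{0,\dots,b-1\}$ of length $<n$ (resp. $\le n$, $=n$); $|s|$ is the length of $s$, $\sqsubseteq$ the initial segment order and $\sqsubset$ its strict part. Write $s\le_{\mathrm{lex}}t$ if $s\sqsubseteq t$, or if $s,t$ are $\sqsubseteq$-incomparable and $s(i)<t(i)$ at the first place $i$ where they differ. Write $s\preccurlyeq t$ if $|s|<|t|$, or $|s|=|t|$ and $s\le_{\mathrm{lex}}t$. A subtree is a subset $S$ of $b^{<n}$; for $s\in S$ let $h_S(s)=|\{t\in S:t\sqsubset s\}|$, let $\mathrm{ImSucc}_S(s)$ be the set of $\sqsubseteq$-minimal elements of $\{t\in S:s\sqsubset t\}$, and let $S(m)=\{s\in S:h_S(s)=m\}$. *Skew subtrees.* $S$ is a skew subtree if it is a singleton or satisfies: (i) $S$ has a $\sqsubseteq$-minimum; (ii) if $s,s'\in S$, $h_S(s)=h_S(s')$ and $s\le_{\mathrm{lex}}s'$ then $|s|\le|s'|$; (iii) if $s,s'\in S$ and $h_S(s)<h_S(s')$ then $|s|<|s'|$;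 (iv) there are $i_S\in\{0,\dots,b-1\}$ and $s_S\in S$ such that for every $s\in S$ with $s\preccurlyeq s_S$, $s\ne s_S$, and every $i<b$ there is a unique $t\in\mathrm{ImSucc}_S(s)$ with $s^\smallfrown(i)\sqsubseteq t$; $\mathrm{ImSucc}_S(s)=\emptyset$ for every $s\in S$ with $s_S\preccurlyeq s$, $s\ne s_S$; and $|\mathrm{ImSucc}_S(s_S)|=i_S+1$ and for every $i\le i_S$ there is a unique $t\in\mathrm{ImSucc}_S(s_S)$ with $s_S{}^\smallfrown(i)\sqsubseteq t$. A skew subtree is $k$-complete if all its $\sqsubseteq$-maximal chains have $k$ elements and every non-maximal node has exactly $b$ immediate successors in it. For $d\ge 0$, a $d$-tuple $(S_1,\dots,S_d)$ of $k$-complete skew subtrees of $b^{<n}$ is vector $k$-complete if $|s|\le|s'|$ whenever $i<j$, $m<k$, $s\in S_i(m)$, $s'\in S_j(m)$, and $|s|<|s'|$ whenever $m<k-1$, $s\in\bigcup_iS_i(m)$, $s'\in\bigcup_iS_i(m+1)$. Let $\mathcal{CT}_k(b,n,d)$ be the set of these tuples and, for a $d$-tuple $\mathbf S$ of subtrees,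 $\mathcal{CT}_k(\mathbf S)$ the set of those with components contained in the corresponding components of $\mathbf S$. *The number $\mathrm{CT}$.* For $d\ge 1$, $\mathrm{CT}(k,m,b,d,r)$ is the least positive integer $n_0$ such that for every $n\ge n_0$ and every $r$-coloring of $\mathcal{CT}_k(b,n,d)$ there is $\mathbf S\in\mathcal{CT}_m(b,n,d)$ with $\mathcal{CT}_k(\mathbf S)$ monochromatic. Put $\mathrm{CT}(k,m,b,0,r)=m$. *Variable words.* Let $\Lambda$ be a finite alphabet, $W(b,n,\Lambda)=\Lambda^{b^{<n}}$, and let $v_t$ $(t\in b^{<n})$ be distinct symbols outside $\Lambda$. For a $k$-complete skew subtree $T$ of $b^{<n}$, a $T$-variable word is a map $f:b^{<n}\to\Lambda\cup\{v_t:t\in T\}$ such that for every $t\in T$ the set $f^{-1}(v_t)$ is non-empty and has $\sqsubseteq$-minimum $t$; put $\mathrm{ws}(f)=T$, and let $[f]_\Lambda\subseteq W(b,n,\Lambda)$ be the set of words obtained by substituting, for each $t\in T$, one letter for all occurrences of $v_t$. *Mixed products.* Let $\mathbf D=(D_0,D_1,D_2)$ be a partition of $[d]=\{1,\dots,d\}$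 (parts may be empty). $W^{\mathbf D}(b,n,\Lambda)$ is the set of triples $((w_i)_{i\in[d]},(x_i)_{i\in D_1},(t_i)_{i\in D_2})$ with $w_i\in W(b,n,\Lambda)$, $x_i\in b^n$, $t_i\in b^{<n}$. A $k$-dimensional variable word of it is a pair $((f_i)_{i\in[d]},(X_i)_{i\in D_1})$ where each $f_i$ is a variable word with $\mathrm{ws}(f_i)$ $k$-complete, $(\mathrm{ws}(f_i))_{i\in[d]}$ is vector $k$-complete, and for $i\in D_1$, $X_i\subseteq b^n$, $|X_i|=b^k$ and $\mathrm{ws}(f_i)\cup X_i$ is a skew subtree of $b^{\le n}$. It generates the $k$-dimensional combinatorial subspace of all triples with $w_i\in[f_i]_\Lambda$ $(i\in[d])$, $x_i\in X_i$ $(i\in D_1)$, $t_i\in\mathrm{ws}(f_i)$ $(i\in D_2)$. This subspace is $c$-good, for a coloring $c$, if any two of its elements with $t_i=t_i'$ and $w_i(t_i)=w'_i(t'_i)$ for all $i\in D_2$ have the same color. $W^{\mathbf D}_*(b,n,\Lambda)$ is the set of triples for which the tuple of singletons $(\{t_i\})_{i\in D_2}$, in increasing order of $i$, is vector $1$-complete.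 *The number $\mathrm{MTHJ}$.* $\mathrm{MTHJ}(d_0,d_1,d_2,b,\ell,k,r)$ is the least positive integer $n_0$ such that for every alphabet $\Lambda$ with $\ell$ elements, every $n\ge n_0$, every partition $\mathbf D$ of $[d_0+d_1+d_2]$ with $|D_i|=d_i$ and every $r$-coloring $c$ of $W^{\mathbf D}(b,n,\Lambda)$ there is a $k$-dimensional $c$-good combinatorial subspace. *Smooth colorings.* A coloring $c$ of $W^{\mathbf D}(b,n,\Lambda)$ is smooth if $D_2$ is a disjoint union of (possibly empty) sets $\Gamma_1,\Gamma_2$ such that two elements get the same color whenever $w_i=w'_i$ for all $i\in D_0\cup D_1\cup\Gamma_1$, $x_i=x'_i$ for all $i\in D_1$, and, for all $i\in\Gamma_2$, $t_i=t'_i$ and $w_i(t)=w'_i(t)$ for all $t\in b^{<n}$ with $t_i\not\sqsubseteq t$. **Statement.** Let $d_0,d_1,d_2\ge 0$ with $d_0+d_1+d_2\ge 1$, let $b,\ell,k,r\ge 1$, and put $K=\mathrm{CT}(1,k,b,d_2,r)$, except that $K=2$ if $k=1$ and $d_2\ge 1$. The numbers $\mathrm{CT}(1,k,b,d_2,r)$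 and $\mathrm{MTHJ}(d_0,d_1,d_2,b,\ell,K,r)$ exist, and for every alphabet $\Lambda$ with $\ell$ elements, every integer $$n\ge\mathrm{MTHJ}(d_0,d_1,d_2,b,\ell,K,r),$$ every partition $\mathbf D=(D_0,D_1,D_2)$ of $[d_0+d_1+d_2]$ with $|D_i|=d_i$ for $i=0,1,2$, and every smooth $r$-coloring $c$ of $W^{\mathbf D}(b,n,\Lambda)$, there is a $k$-dimensional combinatorial subspace of $W^{\mathbf D}(b,n,\Lambda)$ whose intersection with $W^{\mathbf D}_*(b,n,\Lambda)$ is monochromatic for $c$. -/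

import Mathlib

namespace TreeHJ

/-! ### Trees of finite sequences

A node is a finite sequence in `{0, …, b-1}`, i.e. a `List (Fin b)` (the first entry is the head of the
list); `s <+: t` says that `s` is an initial segment of `t`. A subtree is a set of nodes. -/

/-- The tree `b^{<n}`. -/
def treeLT (b n : ℕ) : Set (List (Fin b)) := {s | s.length < n}

/-- The set `b^n` of the sequences of length exactly `n`. -/
def leaves (b n : ℕ) : Set (List (Fin b)) := {s | s.length = n}

/-- Strict initial segment. -/
def StrictPrefix {b : ℕ} (s t : List (Fin b)) : Prop := s <+: t ∧ s ≠ t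

/-- The lexicographical order: `s` is an initial segment of `t`, or at the first place where they differ
the entry of `s` is smaller than that of `t`. -/
def LexLE {b : ℕ} (s t : List (Fin b)) : Prop :=
  s <+: t ∨ ∃ (p : List (Fin b)) (x y : Fin b), x < y ∧ p ++ [x] <+: s ∧ p ++ [y] <+: t

/-- Nodes ordered first by length, then lexicographically. -/
def ShortLE {b : ℕ} (s t : List (Fin b)) : Prop :=
  s.length < t.length ∨ (s.length = t.length ∧ LexLE s t)

/-- The immediate successors of `s` in the subtree `S`. -/
def imSucc {b : ℕ} (S : Set (List (Fin b))) (s : List (Fin b)) : Set (List (Fin b)) :=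
  {t | t ∈ S ∧ StrictPrefix s t ∧ ¬ ∃ t' ∈ S, StrictPrefix s t' ∧ StrictPrefix t' t}

/-- The height of `s` in the subtree `S`: the number of its predecessors in `S`. -/
noncomputable def height {b : ℕ} (S : Set (List (Fin b))) (s : List (Fin b)) : ℕ :=
  {t | t ∈ S ∧ StrictPrefix t s}.ncard

/-- The `m`-th level of the subtree `S`. -/
def level {b : ℕ} (S : Set (List (Fin b))) (m : ℕ) : Set (List (Fin b)) :=
  {t | t ∈ S ∧ height S t = m}

/-- The conditions that define a skew subtree with at least two nodes. -/
structure IsProperSkew {b : ℕ} (S : Set (List (Fin b))) : Prop where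
  root : ∃ ρ ∈ S, ∀ s ∈ S, ρ <+: s
  same_height : ∀ s ∈ S, ∀ s' ∈ S, height S s = height S s' → LexLE s s' → s.length ≤ s'.length
  lt_height : ∀ s ∈ S, ∀ s' ∈ S, height S s < height S s' → s.length < s'.length
  branching : ∃ i₀ : Fin b, ∃ s₀ ∈ S,
    (∀ s ∈ S, ShortLE s s₀ → s ≠ s₀ → ∀ i : Fin b, ∃! t, t ∈ imSucc S s ∧ s ++ [i] <+: t) ∧
    (∀ s ∈ S, ShortLE s₀ s → s ≠ s₀ → imSucc S s = ∅) ∧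
    (imSucc S s₀).ncard = (i₀ : ℕ) + 1 ∧
    (∀ i : Fin b, i ≤ i₀ → ∃! t, t ∈ imSucc S s₀ ∧ s₀ ++ [i] <+: t)

/-- Skew subtrees; singletons count as skew subtrees. -/
def IsSkew {b : ℕ} (S : Set (List (Fin b))) : Prop :=
  (∃ s, S = {s}) ∨ IsProperSkew S

/-- `k`-complete skew subtrees: every maximal chain has `k` elements and every node that is not maximal
has exactly `b` immediate successors in the subtree. -/
structure IsCompleteSkew {b : ℕ} (k : ℕ) (S : Set (List (Fin b))) : Prop where
  skew : IsSkew S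
  chain : ∀ C : Set (List (Fin b)),
    Maximal (fun C' : Set (List (Fin b)) => C' ⊆ S ∧ IsChain (· <+: ·) C') C → C.ncard = k
  succ : ∀ s ∈ S, (∃ t ∈ S, StrictPrefix s t) → (imSucc S s).ncard = b

/-- Vector `k`-complete skew subtrees `(S_1, …, S_d)`. -/
structure IsVectorComplete {b d : ℕ} (k : ℕ) (S : Fin d → Set (List (Fin b))) : Prop where
  complete : ∀ i, IsCompleteSkew k (S i)
  same_level : ∀ i j : Fin d, i < j → ∀ m, m < k →
    ∀ s ∈ level (S i) m, ∀ s' ∈ level (S j) m, s.length ≤ s'.length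
  next_level : ∀ m, m + 1 < k → ∀ i j : Fin d,
    ∀ s ∈ level (S i) m, ∀ s' ∈ level (S j) (m + 1), s.length < s'.length

/-- The set `𝒞𝒯_k(T)` of the vector `k`-complete skew subtrees of a vector subtree `T`. -/
def CTSet {b d : ℕ} (k : ℕ) (T : Fin d → Set (List (Fin b))) : Set (Fin d → Set (List (Fin b))) :=
  {S | (∀ i, S i ⊆ T i) ∧ IsVectorComplete k S}

/-- The vector tree `T^d_{b,n}`, with all components equal to `b^{<n}`. -/
def vectorTree (b n d : ℕ) : Fin d → Set (List (Fin b)) := fun _ => treeLT b n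

/-- The positive integers `N` such that for all `n ≥ N` and every `r`-coloring of `𝒞𝒯_k(T^d_{b,n})` some
`S` in `𝒞𝒯_m(T^d_{b,n})` has `𝒞𝒯_k(S)` monochromatic. -/
def ctBounds (k m b d r : ℕ) : Set ℕ :=
  {N | 0 < N ∧ ∀ n, N ≤ n → ∀ c : CTSet k (vectorTree b n d) → Fin r,
    ∃ S ∈ CTSet m (vectorTree b n d), ∃ a : Fin r,
      ∀ R : CTSet k (vectorTree b n d), R.1 ∈ CTSet k S → c R = a}

/-- The number `CT(k, m, b, d, r)`: the least element of `ctBounds` for `d ≥ 1`, with the convention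
`CT(k, m, b, 0, r) = m`. -/
noncomputable def CT (k m b d r : ℕ) : ℕ :=
  if d = 0 then m else sInf (ctBounds k m b d r)

/-! ### Words and variable words -/

/-- The space `W(b, n, Λ)` of all maps from `b^{<n}` to `Λ`. -/
abbrev Word (b n : ℕ) (Λ : Type*) : Type _ := treeLT b n → Λ

/-- Maps from `b^{<n}` to `Λ ∪ {v_t : t ∈ b^{<n}}`; the symbol `v_t` is `Sum.inr t`. -/
abbrev VWord (b n : ℕ) (Λ : Type*) : Type _ := treeLT b n → Λ ⊕ treeLT b n

section
variable {b n : ℕ} {Λ : Type*}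

/-- The nodes `t` such that the variable `v_t` occurs in `f`. -/
def ws (f : VWord b n Λ) : Set (List (Fin b)) :=
  {t | ∃ (s t' : treeLT b n), f s = Sum.inr t' ∧ (t' : List (Fin b)) = t}

/-- `f` is a `T`-variable word: only variables `v_t` with `t ∈ T` occur, and for every `t ∈ T` the set
`f⁻¹(v_t)` contains `t`, as its minimum with respect to initial segments. -/
structure IsTVariableWord (T : Set (List (Fin b))) (f : VWord b n Λ) : Prop where
  mem : ∀ s t : treeLT b n, f s = Sum.inr t → (t : List (Fin b)) ∈ T
  min : ∀ t : treeLT b n, (t : List (Fin b)) ∈ T →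
    f t = Sum.inr t ∧ ∀ s : treeLT b n, f s = Sum.inr t → (t : List (Fin b)) <+: s

/-- `f` belongs to `W_{v,k}(b, n, Λ)`. -/
def IsVariableWord (k : ℕ) (f : VWord b n Λ) : Prop :=
  ∃ T : Set (List (Fin b)), T ⊆ treeLT b n ∧ IsCompleteSkew k T ∧ IsTVariableWord T f

/-- `ws f` is the subtree whose nodes index the variables of `f`. -/
theorem IsTVariableWord.ws_eq {T : Set (List (Fin b))} (hT : T ⊆ treeLT b n) {f : VWord b n Λ}
    (h : IsTVariableWord T f) : ws f = T := by
  ext t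
  constructor
  · rintro ⟨s, t', hs, rfl⟩
    exact h.mem s t' hs
  · intro ht
    exact ⟨⟨t, hT ht⟩, ⟨t, hT ht⟩, (h.min ⟨t, hT ht⟩ ht).1, rfl⟩

/-- Substitution of `α t` for every occurrence of `v_t` in `f` (only the values of `α` on `ws f`
matter). -/
def subst (f : VWord b n Λ) (α : treeLT b n → Λ) : Word b n Λ :=
  fun s => Sum.elim id α (f s)

/-- The span `[f]_Λ`. -/
def span (f : VWord b n Λ) : Set (Word b n Λ) := Set.range (subst f)

end

/-! ### Mixed products -/

/-- An ordered partition `(D₀, D₁, D₂)` of `[d]` (parts may be empty). -/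
structure TriPartition (d : ℕ) where
  D₀ : Finset (Fin d)
  D₁ : Finset (Fin d)
  D₂ : Finset (Fin d)
  disjoint₀₁ : Disjoint D₀ D₁
  disjoint₀₂ : Disjoint D₀ D₂
  disjoint₁₂ : Disjoint D₁ D₂
  cover : ∀ i : Fin d, i ∈ D₀ ∨ i ∈ D₁ ∨ i ∈ D₂

/-- The elements `((w_i)_{i ∈ [d]}, (x_i)_{i ∈ D₁}, (t_i)_{i ∈ D₂})` of `W^D(b, n, Λ)`. -/
structure MixedWord (b n : ℕ) (Λ : Type*) {d : ℕ} (D : TriPartition d) where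
  word : Fin d → Word b n Λ
  leaf : D.D₁ → leaves b n
  node : D.D₂ → treeLT b n

section
variable {b n d : ℕ} {Λ : Type*} {D : TriPartition d}

/-- `((f_i)_{i ∈ [d]}, (X_i)_{i ∈ D₁})` is a variable word of `W^D(b, n, Λ)` of dimension `k`. -/
structure IsMixedVariableWord (k : ℕ) (f : Fin d → VWord b n Λ)
    (X : D.D₁ → Set (List (Fin b))) : Prop where
  variableWord : ∀ i, IsVariableWord k (f i)
  vector : IsVectorComplete k (fun i => ws (f i))
  leaf_subset : ∀ i, X i ⊆ leaves b n
  leaf_card : ∀ i, (X i).ncard = b ^ k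
  leaf_skew : ∀ i : D.D₁, IsSkew (ws (f i) ∪ X i)

/-- The combinatorial subspace of `W^D(b, n, Λ)` generated by `((f_i)_i, (X_i)_{i ∈ D₁})`. -/
def mixedSpan (f : Fin d → VWord b n Λ) (X : D.D₁ → Set (List (Fin b))) :
    Set (MixedWord b n Λ D) :=
  {p | (∀ i, p.word i ∈ span (f i)) ∧ (∀ i, (p.leaf i : List (Fin b)) ∈ X i) ∧
    ∀ i : D.D₂, (p.node i : List (Fin b)) ∈ ws (f i)}

/-- The subspace generated by `((f_i)_i, (X_i)_{i ∈ D₁})` is `c`-good. -/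
def IsGood {r : ℕ} (c : MixedWord b n Λ D → Fin r) (f : Fin d → VWord b n Λ)
    (X : D.D₁ → Set (List (Fin b))) : Prop :=
  ∀ p ∈ mixedSpan f X, ∀ q ∈ mixedSpan f X,
    (∀ i : D.D₂, p.node i = q.node i ∧ p.word i (p.node i) = q.word i (q.node i)) → c p = c q

/-- The set `W^D_*(b, n, Λ)`: the nodes `t_i`, `i ∈ D₂`, listed in increasing order of `i` and viewed as
singletons, form a vector `1`-complete skew subtree. -/
def starSet (b n : ℕ) (Λ : Type*) {d : ℕ} (D : TriPartition d) : Set (MixedWord b n Λ D) :=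
  {p | (fun j : Fin D.D₂.card => ({(p.node (D.D₂.orderIsoOfFin rfl j) : List (Fin b))} :
    Set (List (Fin b)))) ∈ CTSet 1 (vectorTree b n D.D₂.card)}

/-- Smooth colorings of `W^D(b, n, Λ)`. -/
def IsSmooth {r : ℕ} (c : MixedWord b n Λ D → Fin r) : Prop :=
  ∃ Γ₁ Γ₂ : Set D.D₂, Disjoint Γ₁ Γ₂ ∧ Γ₁ ∪ Γ₂ = Set.univ ∧
    ∀ p q : MixedWord b n Λ D,
      (∀ i ∈ D.D₀, p.word i = q.word i) →
      (∀ i ∈ D.D₁, p.word i = q.word i) →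
      (∀ i ∈ Γ₁, p.word i = q.word i) →
      (∀ i, p.leaf i = q.leaf i) →
      (∀ i ∈ Γ₂, p.node i = q.node i ∧
        ∀ s : treeLT b n, ¬ (p.node i : List (Fin b)) <+: s → p.word i s = q.word i s) →
      c p = c q

end

/-- The positive integers `N` witnessing the Hales--Jewett property of mixed products with parameters
`d₀, d₁, d₂, b, ℓ, k, r`. -/
def mthjBounds (d₀ d₁ d₂ b ℓ k r : ℕ) : Set ℕ :=
  {N | 0 < N ∧ ∀ (Λ : Type) [Finite Λ], Nat.card Λ = ℓ → ∀ n, N ≤ n →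
    ∀ D : TriPartition (d₀ + d₁ + d₂), D.D₀.card = d₀ → D.D₁.card = d₁ → D.D₂.card = d₂ →
    ∀ c : MixedWord b n Λ D → Fin r,
      ∃ (f : Fin (d₀ + d₁ + d₂) → VWord b n Λ) (X : D.D₁ → Set (List (Fin b))),
        IsMixedVariableWord k f X ∧ IsGood c f X}

/-- The number `MTHJ(d₀, d₁, d₂, b, ℓ, k, r)`. -/
noncomputable def MTHJ (d₀ d₁ d₂ b ℓ k r : ℕ) : ℕ := sInf (mthjBounds d₀ d₁ d₂ b ℓ k r)

end TreeHJ

open TreeHJ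

/-! A `k`-complete skew subtree is the image of `b^{<k}` under a map that sends the successor of `s`
in direction `a` above the image of `s` in direction `a`, has lengths weakly increasing along each
level in lexicographical order, and puts every level strictly below the next one (`IsSkewEmb`).
Subtrees are built as such images, and conversely every finite complete skew subtree is one
(`IsCompleteSkew.exists_emb`), so passing to a smaller subtree is composition of maps.

The number `MTHJ` exists because of `exists_level_reduction`: a coloring of `d` words and `d`
positions can be restricted to `K` levels so that the color depends only on the lengths of the
positions and the letters at them. The restriction has two stages. The first,
`exists_canonical_reduction`, adds one level at a time. Above each node of length `N` there is a
chain on which a Hales–Jewett line is chosen, with all lines mutually independent; then letters at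
nodes not on the branches to the positions become irrelevant. What remains is a coloring of `d`
labelled branches, that is, of a single sequence whose letters carry one label and one direction per
tree. In the second stage independent lines on consecutive blocks of this sequence remove the
dependence on everything except the letters in the blocks where the positions end. Placing leaves at
the coordinates in `D₀ ∪ D₁` gives a good subspace.

With a one-letter alphabet the same reduction makes a coloring of tuples of nodes depend only on
their lengths; Ramsey's theorem on the set of levels then gives the number `CT`.

For the final statement, take a good `K`-dimensional subspace. Goodness still allows the color to
depend on the letters at the nodes, and smoothness removes this (`IsGood.eq_of_node_eq`): in a
coordinate of `Γ₂` the letter at the node can be changed directly, and in a coordinate of `Γ₁` the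
node can be moved away while that letter is changed. Moving away needs a second node, which explains
the value `K = 2` when `k = 1` and `d₂ ≥ 1`. The color is now a function of the nodes, and the
choice of `K` gives homogeneous subtrees in the coordinates of `D₂`. `exists_monochromatic_subspace`
extends them to all coordinates and replaces the remaining variables by a fixed letter. -/

namespace TreeHJ

/-! ### Initial segments and orders on finite sequences -/

section Prefix

theorem prefix_trichotomy {α : Type*} (s t : List α) :
    s <+: t ∨ t <+: s ∨ ∃ (p : List α) (x y : α), x ≠ y ∧ p ++ [x] <+: s ∧ p ++ [y] <+: t := by
  induction s generalizing t with
  | nil => exact Or.inl (List.nil_prefix)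
  | cons a s ih =>
    cases t with
    | nil => exact Or.inr (Or.inl List.nil_prefix)
    | cons c t =>
      by_cases hac : a = c
      · subst hac
        rcases ih t with h | h | ⟨p, x, y, hxy, hs, ht⟩
        · exact Or.inl (by simpa using h)
        · exact Or.inr (Or.inl (by simpa using h))
        · exact Or.inr (Or.inr ⟨a :: p, x, y, hxy, by simpa using hs, by simpa using ht⟩)
      · exact Or.inr (Or.inr ⟨[], a, c, hac, by simp, by simp⟩)

theorem eq_of_concat_prefix {α : Type*} {p t : List α} {x y : α}
    (hx : p ++ [x] <+: t) (hy : p ++ [y] <+: t) : x = y := by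
  have h := List.prefix_of_prefix_length_le hx hy (by simp)
  have := h.eq_of_length (by simp)
  simpa using this

theorem prefix_of_concat_prefix {α : Type*} {p t : List α} {x : α} (h : p ++ [x] <+: t) : p <+: t :=
  (List.prefix_append p [x]).trans h

theorem exists_concat_prefix {α : Type*} {s t : List α} (h : s <+: t) (hne : s ≠ t) :
    ∃ a, s ++ [a] <+: t := by
  obtain ⟨u, rfl⟩ := h
  cases u with
  | nil => simp at hne
  | cons a u => exact ⟨a, u, by simp⟩

theorem StrictPrefix.length_lt {b : ℕ} {s t : List (Fin b)} (h : StrictPrefix s t) :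
    s.length < t.length := by
  rcases h.1.length_le.lt_or_eq with h' | h'
  · exact h'
  · exact absurd (h.1.eq_of_length h') h.2

theorem StrictPrefix.trans_prefix {b : ℕ} {s t u : List (Fin b)} (h : StrictPrefix s t) (h' : t <+: u) :
    StrictPrefix s u := by
  refine ⟨h.1.trans h', fun he => ?_⟩
  have := h.length_lt
  have := h'.length_le
  subst he; omega

theorem strictPrefix_of_concat {b : ℕ} {s t : List (Fin b)} {a : Fin b} (h : s ++ [a] <+: t) :
    StrictPrefix s t := by
  refine ⟨prefix_of_concat_prefix h, fun he => ?_⟩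
  have := h.length_le
  subst he; simp at this

end Prefix

section Orders
variable {b : ℕ}

theorem lexLE_total {s t : List (Fin b)} : LexLE s t ∨ LexLE t s := by
  rcases prefix_trichotomy s t with h | h | ⟨p, x, y, hxy, hs, ht⟩
  · exact Or.inl (Or.inl h)
  · exact Or.inr (Or.inl h)
  · rcases lt_or_gt_of_ne hxy with h | h
    · exact Or.inl (Or.inr ⟨p, x, y, h, hs, ht⟩)
    · exact Or.inr (Or.inr ⟨p, y, x, h, ht, hs⟩)

theorem lexLE_antisymm {s t : List (Fin b)} (hl : s.length = t.length) (h : LexLE s t)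
    (h' : LexLE t s) : s = t := by
  rcases h with h | ⟨p, x, y, hxy, hs, ht⟩
  · exact h.eq_of_length hl
  rcases h' with h' | ⟨q, z, w, hzw, ht', hs'⟩
  · exact (h'.eq_of_length hl.symm).symm
  exfalso
  rcases lt_trichotomy p.length q.length with hpq | hpq | hpq
  · have h1 : p ++ [x] <+: q :=
      List.prefix_of_prefix_length_le hs (prefix_of_concat_prefix hs') (by simpa using hpq)
    have h2 : p ++ [y] <+: q :=
      List.prefix_of_prefix_length_le ht (prefix_of_concat_prefix ht') (by simpa using hpq)
    exact hxy.ne (eq_of_concat_prefix h1 h2)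
  · have h1 : p = q := (List.prefix_of_prefix_length_le (prefix_of_concat_prefix hs)
      (prefix_of_concat_prefix hs') hpq.le).eq_of_length hpq
    subst h1
    have := eq_of_concat_prefix hs hs'
    have := eq_of_concat_prefix ht ht'
    subst_vars
    exact lt_asymm hxy hzw
  · have h1 : q ++ [z] <+: p :=
      List.prefix_of_prefix_length_le ht' (prefix_of_concat_prefix ht) (by simpa using hpq)
    have h2 : q ++ [w] <+: p :=
      List.prefix_of_prefix_length_le hs' (prefix_of_concat_prefix hs) (by simpa using hpq)
    exact hzw.ne (eq_of_concat_prefix h1 h2)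

theorem shortLE_total (s t : List (Fin b)) : ShortLE s t ∨ ShortLE t s := by
  rcases lt_trichotomy s.length t.length with h | h | h
  · exact Or.inl (Or.inl h)
  · rcases lexLE_total (s := s) (t := t) with h' | h'
    · exact Or.inl (Or.inr ⟨h, h'⟩)
    · exact Or.inr (Or.inr ⟨h.symm, h'⟩)
  · exact Or.inr (Or.inl h)

theorem shortLE_antisymm {s t : List (Fin b)} (h : ShortLE s t) (h' : ShortLE t s) : s = t := by
  rcases h with h | ⟨h, hl⟩ <;> rcases h' with h' | ⟨h', hl'⟩
  · omega
  · omega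
  · omega
  · exact lexLE_antisymm h hl hl'

theorem lexLE_replicate_last {s : List (Fin b)} {a : Fin b} (ha : ∀ x : Fin b, x ≤ a) :
    LexLE s (List.replicate s.length a) := by
  induction s with
  | nil => exact Or.inl (by simp)
  | cons x s ih =>
    rcases (ha x).lt_or_eq with h | h
    · exact Or.inr ⟨[], x, a, h, by simp, by simp [List.replicate_succ]⟩
    · subst h
      rcases ih with h | ⟨p, y, z, h, h1, h2⟩
      · exact Or.inl (by simpa [List.replicate_succ] using h)
      · exact Or.inr ⟨x :: p, y, z, h, by simpa using h1, by simpa [List.replicate_succ] using h2⟩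

theorem lexLE_replicate_first {s : List (Fin b)} {a : Fin b} (ha : ∀ x : Fin b, a ≤ x) :
    LexLE (List.replicate s.length a) s := by
  induction s with
  | nil => exact Or.inl (by simp)
  | cons x s ih =>
    rcases (ha x).lt_or_eq with h | h
    · exact Or.inr ⟨[], a, x, h, by simp [List.replicate_succ], by simp⟩
    · subst h
      rcases ih with h | ⟨p, y, z, h, h1, h2⟩
      · exact Or.inl (by simpa [List.replicate_succ] using h)
      · exact Or.inr ⟨a :: p, y, z, h, by simpa [List.replicate_succ] using h1, by simpa using h2⟩

end Orders

/-- `φ` restricted to `b^{<K}` is a level preserving embedding whose image is a skew subtree. -/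
structure IsSkewEmb {b : ℕ} (K : ℕ) (φ : List (Fin b) → List (Fin b)) : Prop where
  ext : ∀ s a, s.length + 1 < K → φ s ++ [a] <+: φ (s ++ [a])
  lex : ∀ s s', s.length = s'.length → s.length < K → LexLE s s' → (φ s).length ≤ (φ s').length
  lt : ∀ s s', s.length < s'.length → s'.length < K → (φ s).length < (φ s').length

/-! ### Embeddings of `b^{<K}` and complete skew subtrees -/

namespace IsSkewEmb
variable {b K : ℕ} {φ : List (Fin b) → List (Fin b)}

theorem concat_prefix (h : IsSkewEmb K φ) {p s : List (Fin b)} {x : Fin b} (hps : p ++ [x] <+: s)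
    (hs : s.length < K) : φ p ++ [x] <+: φ s := by
  obtain ⟨u, rfl⟩ := hps
  induction u using List.reverseRecOn with
  | nil => exact (by simpa using h.ext p x (by simpa using hs))
  | append_singleton u a ih =>
    simp only [List.length_append, List.length_cons, List.length_nil] at hs ih
    have h1 := ih (by omega)
    have h2 := h.ext (p ++ [x] ++ u) a (by simp; omega)
    rw [← List.append_assoc]
    exact h1.trans (prefix_of_concat_prefix h2)

theorem mono (h : IsSkewEmb K φ) {p s : List (Fin b)} (hps : p <+: s) (hs : s.length < K) :
    φ p <+: φ s := by
  by_cases he : p = s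
  · subst he; exact List.prefix_rfl
  · obtain ⟨a, ha⟩ := exists_concat_prefix hps he
    exact prefix_of_concat_prefix (h.concat_prefix ha hs)

theorem prefix_iff (h : IsSkewEmb K φ) {s t : List (Fin b)} (hs : s.length < K) (ht : t.length < K) :
    φ s <+: φ t ↔ s <+: t := by
  refine ⟨fun hst => ?_, fun hst => h.mono hst ht⟩
  rcases prefix_trichotomy s t with h1 | h1 | ⟨p, x, y, hxy, h1, h2⟩
  · exact h1
  · by_cases he : t = s
    · subst he; exact List.prefix_rfl
    · obtain ⟨a, ha⟩ := exists_concat_prefix h1 he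
      have := (h.concat_prefix ha hs).length_le
      have := hst.length_le
      simp at *; omega
  · exact absurd (eq_of_concat_prefix ((h.concat_prefix h1 hs).trans hst) (h.concat_prefix h2 ht)) hxy

theorem inj (h : IsSkewEmb K φ) {s t : List (Fin b)} (hs : s.length < K) (ht : t.length < K)
    (he : φ s = φ t) : s = t := by
  have h1 := (h.prefix_iff hs ht).1 (he ▸ List.prefix_rfl)
  have h2 := (h.prefix_iff ht hs).1 (he ▸ List.prefix_rfl)
  exact h1.eq_of_length (le_antisymm h1.length_le h2.length_le)

theorem strictPrefix_iff (h : IsSkewEmb K φ) {s t : List (Fin b)} (hs : s.length < K)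
    (ht : t.length < K) : StrictPrefix (φ s) (φ t) ↔ StrictPrefix s t := by
  unfold StrictPrefix
  rw [h.prefix_iff hs ht]
  exact and_congr_right fun _ => not_congr ⟨h.inj hs ht, fun he => he ▸ rfl⟩

theorem lexLE (h : IsSkewEmb K φ) {s t : List (Fin b)} (hs : s.length < K)
    (ht : t.length < K) (hst : LexLE s t) : LexLE (φ s) (φ t) := by
  rcases hst with hst | ⟨p, x, y, hxy, h1, h2⟩
  · exact Or.inl (h.mono hst ht)
  · exact Or.inr ⟨φ p, x, y, hxy, h.concat_prefix h1 hs, h.concat_prefix h2 ht⟩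

/-- If the inner map makes two lengths equal, the lexicographical condition of the outer map
applies; if it makes them different, its level condition does. The same dichotomy proves
`IsVectorEmb.comp`. -/
theorem comp (h : IsSkewEmb K φ) {k : ℕ} {ψ : List (Fin b) → List (Fin b)} (h' : IsSkewEmb k ψ)
    (hψ : ∀ s, s.length < k → (ψ s).length < K) : IsSkewEmb k (φ ∘ ψ) where
  ext s a hs := h.concat_prefix (h'.ext s a hs) (hψ _ (by simpa using hs))
  lex s s' hl hs hss := by
    rcases (h'.lex s s' hl hs hss).lt_or_eq with h1 | h1
    · exact (h.lt _ _ h1 (hψ _ (hl ▸ hs))).le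
    · exact h.lex _ _ h1 (hψ _ hs) (h'.lexLE hs (hl ▸ hs) hss)
  lt s s' hl hs := h.lt _ _ (h'.lt s s' hl hs) (hψ _ hs)

theorem height_eq (h : IsSkewEmb K φ) {s : List (Fin b)} (hs : s.length < K) :
    height (φ '' treeLT b K) (φ s) = s.length := by
  have : {t | t ∈ φ '' treeLT b K ∧ StrictPrefix t (φ s)} =
      (fun i => φ (s.take i)) '' (Set.Iio s.length) := by
    ext t
    constructor
    · rintro ⟨⟨u, hu, rfl⟩, hus⟩
      rw [h.strictPrefix_iff hu hs] at hus
      exact ⟨u.length, hus.length_lt, by simp only; rw [← List.prefix_iff_eq_take.1 hus.1]⟩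
    · rintro ⟨i, hi, rfl⟩
      have hi' : i < s.length := hi
      have hl : (s.take i).length < K := by simp; omega
      refine ⟨⟨_, hl, rfl⟩, (h.strictPrefix_iff hl hs).2 ⟨List.take_prefix i s, fun he => ?_⟩⟩
      have := congrArg List.length he
      simp at this; omega
  unfold height
  rw [this, Set.InjOn.ncard_image]
  · simp
  · intro i hi j hj hij
    have hi' : i < s.length := hi
    have hj' : j < s.length := hj
    have := h.inj (s := s.take i) (t := s.take j) (by simp; omega) (by simp; omega) hij
    have := congrArg List.length this
    simp at this; omega

theorem imSucc_eq (h : IsSkewEmb K φ) {s : List (Fin b)} (hs : s.length < K) :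
    imSucc (φ '' treeLT b K) (φ s) = {t | s.length + 1 < K ∧ ∃ a, t = φ (s ++ [a])} := by
  ext t
  constructor
  · rintro ⟨⟨u, hu, rfl⟩, hsu, hmin⟩
    rw [h.strictPrefix_iff hs hu] at hsu
    have hl := hsu.length_lt
    have hu' : u.length < K := hu
    obtain ⟨a, ha⟩ := exists_concat_prefix hsu.1 hsu.2
    refine ⟨by omega, a, ?_⟩
    by_contra hne
    have hal : (s ++ [a]).length < K := by simp; omega
    refine hmin ⟨_, ⟨s ++ [a], hal, rfl⟩, ?_, ?_⟩
    · rw [h.strictPrefix_iff hs hal]; exact strictPrefix_of_concat List.prefix_rfl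
    · exact ⟨h.mono ha hu, fun he => hne he.symm⟩
  · rintro ⟨hK, a, rfl⟩
    have hal : (s ++ [a]).length < K := by simpa using hK
    refine ⟨⟨_, hal, rfl⟩, (h.strictPrefix_iff hs hal).2 (strictPrefix_of_concat List.prefix_rfl), ?_⟩
    rintro ⟨_, ⟨u, hu, rfl⟩, h1, h2⟩
    have h1 := ((h.strictPrefix_iff hs hu).1 h1).length_lt
    have h2 := ((h.strictPrefix_iff hu hal).1 h2).length_lt
    simp at h2; omega

theorem existsUnique_imSucc (h : IsSkewEmb K φ) {s : List (Fin b)} (hs : s.length + 1 < K) (i : Fin b) :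
    ∃! t, t ∈ imSucc (φ '' treeLT b K) (φ s) ∧ φ s ++ [i] <+: t := by
  rw [h.imSucc_eq (by omega)]
  refine ⟨φ (s ++ [i]), ⟨⟨hs, i, rfl⟩, h.ext s i hs⟩, ?_⟩
  rintro _ ⟨⟨-, a, rfl⟩, ha⟩
  rw [eq_of_concat_prefix ha (h.ext s a hs)]

theorem ncard_imSucc (h : IsSkewEmb K φ) {s : List (Fin b)} (hs : s.length + 1 < K) :
    (imSucc (φ '' treeLT b K) (φ s)).ncard = b := by
  have : imSucc (φ '' treeLT b K) (φ s) = (fun a => φ (s ++ [a])) '' Set.univ := by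
    rw [h.imSucc_eq (by omega)]
    ext t
    constructor
    · rintro ⟨-, a, rfl⟩; exact ⟨a, trivial, rfl⟩
    · rintro ⟨a, -, rfl⟩; exact ⟨hs, a, rfl⟩
  rw [this, Set.ncard_image_of_injective, Set.ncard_univ, Nat.card_fin]
  intro a c hac
  have := h.inj (by simpa using hs) (by simpa using hs) hac
  simpa using this

/-- The last branching node is the image of the lexicographically last sequence of length `K - 2`,
and it branches in all directions, so `i₀ = b - 1`. -/
theorem isProperSkew [NeZero b] (h : IsSkewEmb K φ) (hK : 2 ≤ K) : IsProperSkew (φ '' treeLT b K) where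
  root := ⟨φ [], ⟨[], by simp [treeLT]; omega, rfl⟩, by
    rintro _ ⟨s, hs, rfl⟩; exact h.mono List.nil_prefix hs⟩
  same_height := by
    rintro _ ⟨s, hs, rfl⟩ _ ⟨s', hs', rfl⟩ he hl
    rw [h.height_eq hs, h.height_eq hs'] at he
    rcases lexLE_total (s := s) (t := s') with h' | h'
    · exact h.lex _ _ he hs h'
    · have := h.lexLE hs' hs h'
      rcases prefix_trichotomy s s' with h1 | h1 | ⟨p, x, y, hxy, h1, h2⟩
      · rw [h1.eq_of_length he]
      · rw [h1.eq_of_length he.symm]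
      · rcases lt_or_gt_of_ne hxy with h3 | h3
        · exact h.lex _ _ he hs (Or.inr ⟨p, x, y, h3, h1, h2⟩)
        -- The images diverge at `φ p` in the same directions as `s` and `s'`, so they cannot be in
        -- the opposite lexicographical order.
        · exfalso
          have e1 := h.concat_prefix h1 hs
          have e2 := h.concat_prefix h2 hs'
          rcases hl with hl | ⟨q, z, w, hzw, e3, e4⟩
          · exact hxy (eq_of_concat_prefix (e1.trans hl) e2)
          · rcases lt_trichotomy (φ p).length q.length with hpq | hpq | hpq
            · exact hxy (eq_of_concat_prefix (List.prefix_of_prefix_length_le e1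
                (prefix_of_concat_prefix e3) (by simpa using hpq))
                (List.prefix_of_prefix_length_le e2 (prefix_of_concat_prefix e4) (by simpa using hpq)))
            · have h5 : φ p = q := (List.prefix_of_prefix_length_le (prefix_of_concat_prefix e1)
                (prefix_of_concat_prefix e3) hpq.le).eq_of_length hpq
              subst h5
              have h6 := eq_of_concat_prefix e1 e3
              have h7 := eq_of_concat_prefix e2 e4
              subst h6; subst h7
              exact lt_asymm hzw h3
            · exact hzw.ne (eq_of_concat_prefix (List.prefix_of_prefix_length_le e3
                (prefix_of_concat_prefix e1) (by simpa using hpq))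
                (List.prefix_of_prefix_length_le e4 (prefix_of_concat_prefix e2) (by simpa using hpq)))
  lt_height := by
    rintro _ ⟨s, hs, rfl⟩ _ ⟨s', hs', rfl⟩ he
    rw [h.height_eq hs, h.height_eq hs'] at he
    exact h.lt _ _ he hs'
  branching := by
    have hb : b ≠ 0 := NeZero.ne b
    let a : Fin b := ⟨b - 1, by omega⟩
    have ha : ∀ x : Fin b, x ≤ a := fun x => by rw [Fin.le_def]; simp [a]; omega
    let z : List (Fin b) := List.replicate (K - 2) a
    have hz : z.length + 1 < K := by simp [z]; omega
    refine ⟨a, φ z, ⟨z, by simp [treeLT, z]; omega, rfl⟩, ?_, ?_, ?_, ?_⟩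
    · rintro _ ⟨s, hs, rfl⟩ hsz - i
      refine h.existsUnique_imSucc ?_ i
      by_contra hlt
      have hs' : s.length < K := hs
      have : z.length < s.length := by omega
      have := h.lt _ _ this hs
      rcases hsz with h1 | ⟨h1, -⟩ <;> omega
    · rintro _ ⟨s, hs, rfl⟩ hzs hne
      rw [h.imSucc_eq hs]
      ext t
      simp only [Set.mem_ofPred_eq, Set.mem_empty_iff_false, iff_false, not_and]
      intro hsK
      exfalso
      apply hne
      refine shortLE_antisymm ?_ hzs
      have hsz : s.length ≤ z.length := by simp [z]; omega
      rcases hsz.lt_or_eq with h1 | h1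
      · exact Or.inl (h.lt _ _ h1 (by omega))
      · have h2 : LexLE s z := by
          have := lexLE_replicate_last (s := s) ha
          rwa [h1, show List.replicate z.length a = z by simp [z]] at this
        have h3 := h.lex _ _ h1 hs h2
        rcases h3.lt_or_eq with h4 | h4
        · exact Or.inl h4
        · exact Or.inr ⟨h4, h.lexLE hs (by omega) h2⟩
    · rw [h.ncard_imSucc hz]; simp [a]; omega
    · intro i _
      exact h.existsUnique_imSucc hz i

theorem isSkew [NeZero b] (h : IsSkewEmb K φ) (hK : 1 ≤ K) : IsSkew (φ '' treeLT b K) := by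
  by_cases h2 : 2 ≤ K
  · exact Or.inr (h.isProperSkew h2)
  · left
    refine ⟨φ [], ?_⟩
    have : treeLT b K = {[]} := by
      ext s
      simp only [treeLT, Set.mem_ofPred_eq, Set.mem_singleton_iff]
      rw [← List.length_eq_zero_iff]; omega
    rw [this, Set.image_singleton]

/-- A chain in the image lies below the image of one sequence. After padding that sequence to length
`K - 1`, the images of its `K` initial segments form a chain containing the given one; by maximality
the two coincide. -/
theorem isCompleteSkew [NeZero b] (h : IsSkewEmb K φ) (hK : 1 ≤ K) :
    IsCompleteSkew K (φ '' treeLT b K) where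
  skew := h.isSkew hK
  chain C hC := by
    obtain ⟨⟨hCS, hchain⟩, hmax⟩ := hC
    have key : ∃ s, s.length < K ∧ ∀ t ∈ C, t <+: φ s := by
      by_cases hne : C.Nonempty
      · have hbd : ∃ s, s.length < K ∧ φ s ∈ C ∧ ∀ t, t.length < K → φ t ∈ C → t.length ≤ s.length := by
          let P : ℕ → Prop := fun m => ∃ s : List (Fin b), s.length = m ∧ s.length < K ∧ φ s ∈ C
          obtain ⟨c, hc⟩ := hne
          obtain ⟨s₀, hs₀, rfl⟩ := hCS hc
          classical
          have hP : P s₀.length := ⟨s₀, rfl, hs₀, hc⟩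
          have hs₀' : s₀.length < K := hs₀
          have := Nat.findGreatest_spec (P := P) hs₀'.le hP
          obtain ⟨s, hs, hsK, hsC⟩ := this
          refine ⟨s, hsK, hsC, fun t ht htC => ?_⟩
          rw [hs]
          exact Nat.le_findGreatest ht.le ⟨t, rfl, ht, htC⟩
        obtain ⟨s, hsK, hsC, hs⟩ := hbd
        refine ⟨s, hsK, fun t ht => ?_⟩
        obtain ⟨u, hu, rfl⟩ := hCS ht
        by_cases he : φ u = φ s
        · rw [he]
        rcases hchain ht hsC he with h1 | h1
        · exact h1
        · have := (h.prefix_iff hsK hu).1 h1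
          rw [this.eq_of_length_le (hs u hu ht)]
      · rw [Set.not_nonempty_iff_eq_empty] at hne
        exact ⟨[], by simp; omega, by simp [hne]⟩
    obtain ⟨s, hs, hsC⟩ := key
    let u : List (Fin b) := s ++ List.replicate (K - 1 - s.length) 0
    have hu : u.length = K - 1 := by simp [u]; omega
    have hCu : C = (fun i => φ (u.take i)) '' Set.Iio K := by
      apply Set.Subset.antisymm
      · intro t ht
        obtain ⟨v, hv, rfl⟩ := hCS ht
        have hv' : v.length < K := hv
        have hvu : v <+: u := ((h.prefix_iff hv hs).1 (hsC _ ht)).trans (List.prefix_append _ _)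
        exact ⟨v.length, hv', by simp only; rw [← List.prefix_iff_eq_take.1 hvu]⟩
      · refine hmax ⟨?_, ?_⟩ ?_
        · rintro _ ⟨i, hi, rfl⟩
          have hi' : i < K := hi
          exact ⟨u.take i, by simp [treeLT]; omega, rfl⟩
        · rintro _ ⟨i, hi, rfl⟩ _ ⟨j, hj, rfl⟩ -
          have hi' : i < K := hi
          have hj' : j < K := hj
          rcases le_total i j with hij | hij
          · exact Or.inl (h.mono (List.take_prefix_take_left hij) (by simp; omega))
          · exact Or.inr (h.mono (List.take_prefix_take_left hij) (by simp; omega))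
        · intro t ht
          obtain ⟨v, hv, rfl⟩ := hCS ht
          have hv' : v.length < K := hv
          have hvu : v <+: u := ((h.prefix_iff hv hs).1 (hsC _ ht)).trans (List.prefix_append _ _)
          exact ⟨v.length, hv', by simp only; rw [← List.prefix_iff_eq_take.1 hvu]⟩
    rw [hCu, Set.InjOn.ncard_image]
    · simp
    · intro i hi j hj hij
      have hi' : i < K := hi
      have hj' : j < K := hj
      have := h.inj (s := u.take i) (t := u.take j) (by simp; omega) (by simp; omega) hij
      have := congrArg List.length this
      simp at this; omega
  succ := by
    rintro _ ⟨s, hs, rfl⟩ ⟨_, ⟨t, ht, rfl⟩, hst⟩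
    have := ((h.strictPrefix_iff hs ht).1 hst).length_lt
    have ht' : t.length < K := ht
    exact h.ncard_imSucc (by omega)

end IsSkewEmb

/-- The embeddings `φ i` are interleaved as the components of a vector complete skew subtree. -/
structure IsVectorEmb {b d : ℕ} (K : ℕ) (φ : Fin d → List (Fin b) → List (Fin b)) : Prop where
  emb : ∀ i, IsSkewEmb K (φ i)
  same : ∀ i j, i < j → ∀ s s' : List (Fin b), s.length = s'.length → s.length < K →
    (φ i s).length ≤ (φ j s').length
  next : ∀ i j, ∀ s s' : List (Fin b), s.length < s'.length → s'.length < K →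
    (φ i s).length < (φ j s').length

theorem IsVectorEmb.isVectorComplete {b d K : ℕ} [NeZero b] {φ : Fin d → List (Fin b) → List (Fin b)}
    (h : IsVectorEmb K φ) (hK : 1 ≤ K) : IsVectorComplete K (fun i => φ i '' treeLT b K) where
  complete i := (h.emb i).isCompleteSkew hK
  same_level := by
    rintro i j hij m hm _ ⟨⟨s, hs, rfl⟩, h1⟩ _ ⟨⟨s', hs', rfl⟩, h2⟩
    rw [(h.emb i).height_eq hs] at h1
    rw [(h.emb j).height_eq hs'] at h2
    exact h.same i j hij s s' (by omega) hs
  next_level := by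
    rintro m hm i j _ ⟨⟨s, hs, rfl⟩, h1⟩ _ ⟨⟨s', hs', rfl⟩, h2⟩
    rw [(h.emb i).height_eq hs] at h1
    rw [(h.emb j).height_eq hs'] at h2
    exact h.next i j s s' (by omega) hs'

/-! ### Independent Hales–Jewett lines -/

section Lines

/-- The Hales–Jewett theorem for words that are indexed by the natural numbers and constant beyond `M`. -/
theorem exists_line_bound (Λ R : Type) [Finite Λ] [Finite R] (a₀ : Λ) :
    ∃ M : ℕ, ∀ c : (ℕ → Λ) → R, ∃ l : ℕ → Option Λ,
      (∃ x < M, l x = none) ∧ (∀ x, M ≤ x → l x = some a₀) ∧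
      ∀ a a' : Λ, c (fun x => (l x).getD a) = c (fun x => (l x).getD a') := by
  obtain ⟨ι, hι, h⟩ := Combinatorics.Line.exists_mono_in_high_dimension Λ R
  let e := Fintype.equivFin ι
  refine ⟨Fintype.card ι, fun c => ?_⟩
  obtain ⟨l, r, hl⟩ := h (fun w => c (fun x => if hx : x < Fintype.card ι then w (e.symm ⟨x, hx⟩) else a₀))
  refine ⟨fun x => if hx : x < Fintype.card ι then l.idxFun (e.symm ⟨x, hx⟩) else some a₀, ?_, ?_, ?_⟩
  · obtain ⟨i, hi⟩ := l.proper
    exact ⟨e i, (e i).2, by simp [hi]⟩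
  · intro x hx
    simp [not_lt.2 hx]
  · have key : ∀ a, (fun x => (if hx : x < Fintype.card ι then l.idxFun (e.symm ⟨x, hx⟩)
        else some a₀).getD a) = (fun x => if hx : x < Fintype.card ι then l a (e.symm ⟨x, hx⟩) else a₀) := by
      intro a
      funext x
      by_cases hx : x < Fintype.card ι
      · simp [hx]
      · simp [hx]
    intro a a'
    rw [key, key]
    exact (hl a).trans (hl a').symm

/-- Finitely many lines can be chosen such that a coloring of tuples of words, together with the least
variable positions of some of them, does not depend on the letters substituted in the other ones. -/
theorem exists_independent_lines_fin (Λ : Type) [Finite Λ] (a₀ : Λ) (h : ℕ) :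
    ∀ (R : Type) [Finite R], ∃ M : ℕ, ∀ c : (Fin h → ℕ → Λ) → (Fin h → Option ℕ) → R,
      ∃ l : Fin h → ℕ → Option Λ,
        (∀ j, ∃ x < M, l j x = none) ∧ (∀ j x, M ≤ x → l j x = some a₀) ∧
        ∀ q : Fin h → Option ℕ, (∀ j x, q j = some x → IsLeast {x | l j x = none} x) →
        ∀ α β : Fin h → Λ, (∀ j, q j ≠ none → α j = β j) →
          c (fun j x => (l j x).getD (α j)) q = c (fun j x => (l j x).getD (β j)) q := by
  classical
  induction h with
  | zero =>
    intro R _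
    exact ⟨0, fun c => ⟨fun j => j.elim0, fun j => j.elim0, fun j => j.elim0, fun q _ α β _ => by
      congr 1; funext j; exact j.elim0⟩⟩
  | succ h ih =>
    intro R _
    -- The bound `M'` for the other lines is fixed first, so that a whole table of colors over words
    -- of length `M'` is a finite color. The line `l₁` is nevertheless chosen before the other
    -- lines.
    obtain ⟨M', hM'⟩ := ih (Λ × Bool → R)
    obtain ⟨M₁, hM₁⟩ := exists_line_bound Λ
      ((Fin h → Fin M' → Λ) → (Fin h → Option (Fin M')) → R) a₀
    refine ⟨max M₁ M', fun c => ?_⟩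
    let ex : (Fin h → Fin M' → Λ) → Fin h → ℕ → Λ := fun w j x => if hx : x < M' then w j ⟨x, hx⟩ else a₀
    let eq : (Fin h → Option (Fin M')) → Fin h → Option ℕ := fun q j => (q j).map (fun x => (x : ℕ))
    obtain ⟨l₁, ⟨x₀, hx₀, hl₁⟩, hl₁', hc₁⟩ := hM₁ (fun w v q => c (Fin.cons w (ex v)) (Fin.cons none (eq q)))
    have hex : ∃ x, l₁ x = none := ⟨x₀, hl₁⟩
    let x₁ := Nat.find hex
    -- The pair `p` records the letter put on `l₁` and whether the query reveals its first variable
    -- position `x₁`; the other lines are chosen to work for all these cases at once.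
    obtain ⟨l, hl, hl', hc⟩ := hM' (fun w q p =>
      c (Fin.cons (fun x => (l₁ x).getD p.1) w) (Fin.cons (if p.2 then some x₁ else none) q))
    refine ⟨Fin.cons l₁ l, ?_, ?_, ?_⟩
    · intro j
      refine Fin.cases ?_ (fun j => ?_) j
      · exact ⟨x₀, by omega, by simpa using hl₁⟩
      · obtain ⟨x, hx, hlx⟩ := hl j
        exact ⟨x, by omega, by simpa using hlx⟩
    · intro j x hx
      refine Fin.cases ?_ (fun j => ?_) j
      · simpa using hl₁' x (by omega)
      · simpa using hl' j x (by omega)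
    · intro q hq α β hαβ
      have e1 : ∀ γ : Fin (h + 1) → Λ,
          (fun j x => ((Fin.cons l₁ l : Fin (h + 1) → ℕ → Option Λ) j x).getD (γ j)) =
          (Fin.cons (fun x => (l₁ x).getD (γ 0)) (fun j x => (l j x).getD (γ j.succ)) :
            Fin (h + 1) → ℕ → Λ) := by
        intro γ
        funext j
        refine Fin.cases ?_ (fun j => ?_) j <;> simp
      have hq' : ∀ j x, q (Fin.succ j) = some x → IsLeast {x | l j x = none} x := fun j x hj => by
        simpa using hq j.succ x hj
      have hqs : q = Fin.cons (q 0) (fun j => q j.succ) := (Fin.cons_self_tail q).symm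
      have e2 : ∀ j x, Fin.tail q j = some x → x < M' := by
        intro j x hj
        by_contra hx
        have h1 := (hq' j x hj).1
        have h2 := hl' j x (by omega)
        simp only [Set.mem_ofPred_eq] at h1
        rw [h1] at h2
        simp at h2
      -- The letters on the other lines are exchanged first, with the letter `a` on `l₁` fixed. The
      -- letter on `l₁` is exchanged afterwards, and only if its position is not revealed.
      have step2 : ∀ a, c (Fin.cons (fun x => (l₁ x).getD a) (fun j x => (l j x).getD (α j.succ))) q =
          c (Fin.cons (fun x => (l₁ x).getD a) (fun j x => (l j x).getD (β j.succ))) q := by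
        intro a
        have h1 := hc (Fin.tail q) hq' (fun j => α j.succ) (fun j => β j.succ)
          (fun j hj => hαβ j.succ hj)
        have h2 := congrFun h1 (a, (q 0).isSome)
        have h3 : (if (q 0).isSome = true then some x₁ else none) = q 0 := by
          rcases h4 : q 0 with _ | x
          · simp
          · have h5 := hq 0 x h4
            have h6 : IsLeast {x | l₁ x = none} x := by simpa using h5
            have h7 : x₁ = x := le_antisymm (Nat.find_min' hex h6.1) (h6.2 (Nat.find_spec hex))
            simp [h7]
        simp only [h3] at h2
        rw [show (Fin.cons (q 0) (Fin.tail q) : Fin (h + 1) → Option ℕ) = q from Fin.cons_self_tail q] at h2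
        exact h2
      rw [e1, e1]
      rw [step2]
      by_cases h0 : q 0 = none
      · have h1 := hc₁ (α 0) (β 0)
        let v : Fin h → Fin M' → Λ := fun j x => (l j x).getD (β j.succ)
        let p : Fin h → Option (Fin M') := fun j =>
          (q j.succ).bind (fun x => if hx : x < M' then some ⟨x, hx⟩ else none)
        have h2 := congrFun (congrFun h1 v) p
        have h3 : ex v = fun j x => (l j x).getD (β j.succ) := by
          funext j x
          by_cases hx : x < M'
          · simp [ex, v, hx]
          · simp [ex, hx, hl' j x (not_lt.1 hx)]
        have h4 : eq p = Fin.tail q := by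
          funext j
          simp only [eq, p]
          rcases h5 : q j.succ with _ | x
          · simp [Fin.tail, h5]
          · simp [Fin.tail, h5, e2 j x h5]
        rw [h3, h4, ← h0, Fin.cons_self_tail] at h2
        exact h2
      · rw [hαβ 0 h0]

theorem exists_independent_lines (Λ : Type) [Finite Λ] (a₀ : Λ) (J : Type) [Finite J]
    (R : Type) [Finite R] : ∃ M : ℕ, ∀ c : (J → ℕ → Λ) → (J → Option ℕ) → R,
      ∃ l : J → ℕ → Option Λ, (∀ j, ∃ x < M, l j x = none) ∧
        ∀ q : J → Option ℕ, (∀ j x, q j = some x → IsLeast {x | l j x = none} x) →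
        ∀ α β : J → Λ, (∀ j, q j ≠ none → α j = β j) →
          c (fun j x => (l j x).getD (α j)) q = c (fun j x => (l j x).getD (β j)) q := by
  obtain ⟨h, ⟨e⟩⟩ := Finite.exists_equiv_fin J
  obtain ⟨M, hM⟩ := exists_independent_lines_fin Λ a₀ h R
  refine ⟨M, fun c => ?_⟩
  obtain ⟨l, hl, -, hc⟩ := hM (fun w q => c (fun j => w (e j)) (fun j => q (e j)))
  refine ⟨fun j => l (e j), fun j => hl (e j), fun q hq α β hαβ => ?_⟩
  have := hc (fun j => q (e.symm j)) (fun j x hj => by simpa using hq (e.symm j) x hj)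
    (fun j => α (e.symm j)) (fun j => β (e.symm j)) (fun j hj => hαβ _ hj)
  simpa using this

end Lines

/-! ### Padding, lexicographical values and reductions -/

section Fit
variable {b : ℕ} [NeZero b]

/-- Truncation of `s` to length `N`, after padding with zeros. -/
def fit (N : ℕ) (s : List (Fin b)) : List (Fin b) := (s ++ List.replicate N 0).take N

@[simp] theorem length_fit (N : ℕ) (s : List (Fin b)) : (fit N s).length = N := by
  simp [fit]

/-- `fit N s` as a leaf. -/
def fitLeaf (N : ℕ) (s : List (Fin b)) : leaves b N := ⟨fit N s, length_fit N s⟩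

theorem prefix_fit {N : ℕ} {s : List (Fin b)} (h : s.length ≤ N) : s <+: fit N s := by
  rw [List.prefix_iff_eq_take, fit, List.take_take, min_eq_left h]
  simp

theorem fit_eq_of_prefix {N : ℕ} {u y : List (Fin b)} (h : u <+: y) (hu : u.length = N) :
    fit N y = u := by
  obtain ⟨v, rfl⟩ := h
  subst hu
  simp [fit]

end Fit

section LexVal
variable {b : ℕ}

/-- The value of a sequence read as a number in base `b`. -/
def lexVal : List (Fin b) → ℕ
  | [] => 0
  | a :: s => a * b ^ s.length + lexVal s

theorem lexVal_lt (s : List (Fin b)) : lexVal s < b ^ s.length := by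
  induction s with
  | nil => simp [lexVal]
  | cons a s ih =>
    simp only [lexVal, List.length_cons, pow_succ]
    have : (a : ℕ) + 1 ≤ b := a.2
    nlinarith [Nat.mul_le_mul_right (b ^ s.length) this]

theorem lexVal_lt_of_diverge {p s t : List (Fin b)} {x y : Fin b} (hxy : x < y)
    (hs : p ++ [x] <+: s) (ht : p ++ [y] <+: t) (hl : s.length = t.length) : lexVal s < lexVal t := by
  induction p generalizing s t with
  | nil =>
    obtain ⟨u, rfl⟩ := hs
    obtain ⟨v, rfl⟩ := ht
    simp only [List.nil_append, List.cons_append, List.length_cons, Nat.add_right_cancel_iff] at hl ⊢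
    simp only [lexVal, hl]
    have h1 := lexVal_lt u
    rw [hl] at h1
    have : (x : ℕ) + 1 ≤ y := hxy
    nlinarith [Nat.mul_le_mul_right (b ^ v.length) this]
  | cons a p ih =>
    obtain ⟨u, rfl⟩ := hs
    obtain ⟨v, rfl⟩ := ht
    simp only [List.cons_append, List.length_cons, Nat.add_right_cancel_iff] at hl ⊢
    have := ih (s := p ++ [x] ++ u) (t := p ++ [y] ++ v) ⟨u, rfl⟩ ⟨v, rfl⟩ (by simpa using hl)
    simp only [lexVal, hl]
    omega

end LexVal

/-- Substitution in a variable word whose variables are indexed by nodes. -/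
def apply {b : ℕ} {Λ : Type*} (f : List (Fin b) → Λ ⊕ List (Fin b)) (w : List (Fin b) → Λ) :
    List (Fin b) → Λ := fun x => Sum.elim id w (f x)

/-- Composition with the variable word `g`. -/
def compWord {b : ℕ} {Λ : Type*} (f g : List (Fin b) → Λ ⊕ List (Fin b)) (x : List (Fin b)) : Λ ⊕ List (Fin b) :=
  Sum.elim Sum.inl g (f x)

theorem apply_compWord {b : ℕ} {Λ : Type*} (f g : List (Fin b) → Λ ⊕ List (Fin b)) (w : List (Fin b) → Λ) :
    apply (compWord f g) w = apply f (apply g w) := by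
  funext x
  unfold apply compWord
  rcases f x with a | z <;> rfl

/-- `e i` embeds `b^{≤ K}` into `b^{≤ N}`, the sequences of length `K` being leaves, and `f i` is a
variable word whose variables are indexed by the nodes of `b^{< K}` and start at their images. -/
structure IsReduction {b d : ℕ} {Λ : Type*} (K N : ℕ) (e : Fin d → List (Fin b) → List (Fin b))
    (f : Fin d → List (Fin b) → Λ ⊕ List (Fin b)) : Prop where
  ext : ∀ i s a, s.length < K → e i s ++ [a] <+: e i (s ++ [a])
  lex : ∀ i s s', s.length = s'.length → s.length < K → LexLE s s' → (e i s).length ≤ (e i s').length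
  next : ∀ i j, ∀ s s' : List (Fin b), s.length < s'.length → s'.length < K →
    (e i s).length < (e j s').length
  length_le : ∀ i s, s.length ≤ K → (e i s).length ≤ N
  var : ∀ i s, s.length < K → f i (e i s) = Sum.inr s
  min : ∀ i x s, f i x = Sum.inr s → s.length < K ∧ e i s <+: x

theorem concat_prefix_of_ext {b K : ℕ} {φ : List (Fin b) → List (Fin b)}
    (h : ∀ s a, s.length < K → φ s ++ [a] <+: φ (s ++ [a])) {p s : List (Fin b)} {x : Fin b}
    (hps : p ++ [x] <+: s) (hs : s.length ≤ K) : φ p ++ [x] <+: φ s := by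
  obtain ⟨u, rfl⟩ := hps
  induction u using List.reverseRecOn with
  | nil => exact (by simpa using h p x (by simpa using hs))
  | append_singleton u a ih =>
    simp only [List.length_append, List.length_cons, List.length_nil] at hs ih
    have h1 := ih (by omega)
    have h2 := h (p ++ [x] ++ u) a (by simp; omega)
    rw [← List.append_assoc]
    exact h1.trans (prefix_of_concat_prefix h2)

namespace IsReduction
variable {b d K N : ℕ} {Λ : Type*} {e : Fin d → List (Fin b) → List (Fin b)}
  {f : Fin d → List (Fin b) → Λ ⊕ List (Fin b)}

theorem isSkewEmb (h : IsReduction K N e f) (i : Fin d) : IsSkewEmb K (e i) where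
  ext s a hs := h.ext i s a (by omega)
  lex := h.lex i
  lt := h.next i i

theorem length_lt [NeZero b] (h : IsReduction K N e f) (i : Fin d) {s : List (Fin b)} (hs : s.length < K) :
    (e i s).length < N := by
  have h1 := (h.ext i s 0 hs).length_le
  have h2 := h.length_le i (s ++ [0]) (by simpa using hs)
  simp at h1; omega

end IsReduction

/-- Two leaves whose images lie on a common branch are equal. -/
theorem leaf_inj {b K : ℕ} {φ : List (Fin b) → List (Fin b)}
    (h : ∀ s a, s.length < K → φ s ++ [a] <+: φ (s ++ [a])) {s s' u : List (Fin b)}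
    (hs : s.length = K) (hs' : s'.length = K) (hu : φ s <+: u) (hu' : φ s' <+: u) : s = s' := by
  rcases prefix_trichotomy s s' with h1 | h1 | ⟨p, x, y, hxy, h1, h2⟩
  · exact h1.eq_of_length (hs.trans hs'.symm)
  · exact (h1.eq_of_length (hs'.trans hs.symm)).symm
  · exact absurd (eq_of_concat_prefix ((concat_prefix_of_ext h h1 hs.le).trans hu)
      ((concat_prefix_of_ext h h2 hs'.le).trans hu')) hxy

/-! ### Removing the letters off the branches -/

section Canonical
variable {b d : ℕ} [NeZero b] {Λ : Type}

/-- The node number `x` of the chain above `u`. -/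
def chainNode (M : ℕ) (u : List (Fin b)) (x : ℕ) : List (Fin b) :=
  u ++ List.replicate (M * lexVal u + x) 0

theorem chainNode_inj {M x x' : ℕ} {u : List (Fin b)} (h : chainNode M u x = chainNode M u x') :
    x = x' := by
  have := congrArg List.length h
  simp [chainNode] at this
  exact this

theorem chainNode_mono {M x x' : ℕ} {u : List (Fin b)} (h : x ≤ x') :
    chainNode M u x <+: chainNode M u x' := by
  rw [chainNode, chainNode, List.prefix_append_right_inj]
  exact ⟨List.replicate (x' - x) 0, by rw [← List.replicate_add]; congr 1; omega⟩

theorem fit_chainNode {M N x : ℕ} {u : List (Fin b)} (hu : u.length = N) :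
    fit N (chainNode M u x) = u := fit_eq_of_prefix (List.prefix_append _ _) hu

theorem fitLeaf_chainNode {M N x : ℕ} {u : List (Fin b)} (hu : u.length = N) :
    fitLeaf N (chainNode M u x) = ⟨u, hu⟩ := Subtype.ext (fit_chainNode hu)

/-- The words `w'` on `b^{< N}` and the words `w` on the chains above `b^N`, put together. -/
noncomputable def chainWord (M N : ℕ) (a₀ : Λ) (w' : Fin d → treeLT b N → Λ)
    (w : Fin d × leaves b N → ℕ → Λ) (i : Fin d) (y : List (Fin b)) : Λ :=
  open Classical in
  if h : y.length < N then w' i ⟨y, h⟩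
  else if h : ∃ x, y = chainNode M (fit N y) x then w (i, fitLeaf N y) h.choose else a₀

theorem chainWord_chain {M N : ℕ} {a₀ : Λ} (w' : Fin d → treeLT b N → Λ)
    (w : Fin d × leaves b N → ℕ → Λ) (i : Fin d) {u : List (Fin b)} (hu : u.length = N) (x : ℕ) :
    chainWord M N a₀ w' w i (chainNode M u x) = w (i, ⟨u, hu⟩) x := by
  have h1 : ¬ (chainNode M u x).length < N := by simp [chainNode, hu]
  have h2 : ∃ x', chainNode M u x = chainNode M (fit N (chainNode M u x)) x' :=
    ⟨x, by rw [fit_chainNode hu]⟩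
  have h3 : h2.choose = x := by
    have key : ∀ x', chainNode M u x = chainNode M (fit N (chainNode M u x)) x' → x' = x := by
      intro x' h
      rw [fit_chainNode hu] at h
      exact (chainNode_inj h).symm
    exact key _ h2.choose_spec
  rw [chainWord, dif_neg h1, dif_pos h2, h3, fitLeaf_chainNode hu]

/-- The query with data `low`, `kind` and positions `q` on the chains. -/
def chainQuery (M N : ℕ) (low : Fin d → List (Fin b)) (kind : Fin d → Option (Option (Fin b)))
    (q : Fin d × leaves b N → Option ℕ) (i : Fin d) : List (Fin b) :=
  match kind i with
  | none => low i
  | some o => chainNode M (fit N (low i)) ((q (i, fitLeaf N (low i))).getD 0) ++ o.toList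

/-- The extension of `e'` by one level on the chains with positions `pos`. -/
def extendEmb (M N Q : ℕ) (e' : Fin d → List (Fin b) → List (Fin b))
    (pos : Fin d × leaves b N → ℕ) (i : Fin d) (s : List (Fin b)) : List (Fin b) :=
  if s.length < Q then e' i s
  else chainNode M (fit N (e' i (s.take Q))) (pos (i, fitLeaf N (e' i (s.take Q)))) ++
    s.drop Q

/-- The extension of `f'` by the lines `l` on the chains. -/
noncomputable def extendWord (M N Q : ℕ) (a₀ : Λ) (e' : Fin d → List (Fin b) → List (Fin b))
    (f' : Fin d → List (Fin b) → Λ ⊕ List (Fin b)) (l : Fin d × leaves b N → ℕ → Option Λ)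
    (i : Fin d) (y : List (Fin b)) : Λ ⊕ List (Fin b) :=
  open Classical in
  if y.length < N then f' i y
  else if h : ∃ x, y = chainNode M (fit N y) x then
    match l (i, fitLeaf N y) h.choose with
    | some a => Sum.inl a
    | none => if h : ∃ s, s.length = Q ∧ fit N (e' i s) = fit N y then Sum.inr h.choose else Sum.inl a₀
  else Sum.inl a₀

open Classical in
theorem extendWord_chain {M N Q : ℕ} {a₀ : Λ} {e' : Fin d → List (Fin b) → List (Fin b)}
    {f' : Fin d → List (Fin b) → Λ ⊕ List (Fin b)} {l : Fin d × leaves b N → ℕ → Option Λ}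
    (i : Fin d) {u : List (Fin b)} (hu : u.length = N) (x : ℕ) :
    extendWord M N Q a₀ e' f' l i (chainNode M u x) = (
      match l (i, ⟨u, hu⟩) x with
      | some a => Sum.inl a
      | none => if h : ∃ s, s.length = Q ∧ fit N (e' i s) = u then Sum.inr h.choose else Sum.inl a₀) := by
  have h1 : ¬ (chainNode M u x).length < N := by simp [chainNode, hu]
  have h0 := fit_chainNode (M := M) (x := x) hu
  have h2 : ∃ x', chainNode M u x = chainNode M (fit N (chainNode M u x)) x' :=
    ⟨x, by rw [h0]⟩
  have h3 : h2.choose = x := by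
    have key : ∀ x', chainNode M u x = chainNode M (fit N (chainNode M u x)) x' → x' = x := by
      intro x' h
      rw [fit_chainNode hu] at h
      exact (chainNode_inj h).symm
    exact key _ h2.choose_spec
  rw [extendWord, if_neg h1, dif_pos h2, h3, fitLeaf_chainNode hu]
  simp only [h0]

/-- The summand `M * lexVal u` gives the chain above each `u` of length `N` its own interval of
levels, in lexicographical order of the `u`. As the first variable of a chain has position below
`M`, this forces the length condition on the new level `Q`. The new leaves are the immediate
extensions of the nodes of that level. -/
theorem isReduction_extend {M N Q : ℕ} {a₀ : Λ} {e' : Fin d → List (Fin b) → List (Fin b)}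
    {f' : Fin d → List (Fin b) → Λ ⊕ List (Fin b)} {l : Fin d × leaves b N → ℕ → Option Λ}
    {pos : Fin d × leaves b N → ℕ} (h : IsReduction Q N e' f')
    (hpos : ∀ j, IsLeast {x | l j x = none} (pos j)) (hM : ∀ j, pos j < M) :
    IsReduction (Q + 1) (N + M * b ^ N) (extendEmb M N Q e' pos) (extendWord M N Q a₀ e' f' l) := by
  have hlow : ∀ i s, s.length < Q → extendEmb M N Q e' pos i s = e' i s := fun i s hs => by
    simp [extendEmb, hs]
  have htop : ∀ i s, s.length = Q → extendEmb M N Q e' pos i s =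
      chainNode M (fit N (e' i s)) (pos (i, fitLeaf N (e' i s))) := fun i s hs => by
    simp [extendEmb, ← hs]
  have hlen : ∀ i s, s.length = Q → (extendEmb M N Q e' pos i s).length =
      N + (M * lexVal (fit N (e' i s)) + pos (i, fitLeaf N (e' i s))) := fun i s hs => by
    rw [htop i s hs]; simp [chainNode]
  have hleaf : ∀ i s a, s.length = Q → extendEmb M N Q e' pos i (s ++ [a]) =
      extendEmb M N Q e' pos i s ++ [a] := fun i s a hs => by
    rw [htop i s hs]; simp [extendEmb, ← hs]
  have huniq : ∀ i s s', s.length = Q → s'.length = Q → fit N (e' i s) = fit N (e' i s') → s = s' := by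
    intro i s s' hs hs' he
    exact leaf_inj (h.ext i) hs hs' (prefix_fit (h.length_le i s hs.le))
      (he ▸ prefix_fit (h.length_le i s' hs'.le))
  refine ⟨?_, ?_, ?_, ?_, ?_, ?_⟩
  · intro i s a hs
    rcases lt_trichotomy (s.length + 1) Q with h1 | h1 | h1
    · rw [hlow i s (by omega), hlow i _ (by simpa using h1)]
      exact h.ext i s a (by omega)
    · rw [hlow i s (by omega), htop i _ (by simpa using h1)]
      exact (h.ext i s a (by omega)).trans ((prefix_fit (h.length_le i _ (by simp; omega))).trans
        (List.prefix_append _ _))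
    · rw [hleaf i s a (by omega)]
  · intro i s s' hl hs hss
    rcases (Nat.lt_succ_iff.1 hs).lt_or_eq with h1 | h1
    · rw [hlow i s h1, hlow i s' (by omega)]
      exact h.lex i s s' hl h1 hss
    · rw [hlen i s h1, hlen i s' (by omega)]
      rcases hss with hss | ⟨p, x, y, hxy, h2, h3⟩
      · rw [hss.eq_of_length hl]
      · have h4 := (concat_prefix_of_ext (h.ext i) h2 h1.le).trans (prefix_fit (h.length_le i _ h1.le))
        have h5 := (concat_prefix_of_ext (h.ext i) h3 (hl ▸ h1.le)).trans
          (prefix_fit (h.length_le i _ (hl ▸ h1.le)))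
        have h6 : lexVal (fit N (e' i s)) + 1 ≤ lexVal (fit N (e' i s')) :=
          lexVal_lt_of_diverge hxy h4 h5 (by simp)
        have h7 := Nat.mul_le_mul_left M h6
        have h8 := hM (i, fitLeaf N (e' i s))
        rw [Nat.mul_add] at h7
        omega
  · intro i j s s' hl hs'
    rw [hlow i s (by omega)]
    rcases (Nat.lt_succ_iff.1 hs').lt_or_eq with h1 | h1
    · rw [hlow j s' h1]
      exact h.next i j s s' hl h1
    · rw [hlen j s' h1]
      have := h.length_lt i (s := s) (by omega)
      omega
  · have key : ∀ i s, s.length = Q → (extendEmb M N Q e' pos i s).length + 1 ≤ N + M * b ^ N := by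
      intro i s hs
      rw [hlen i s hs]
      have h6 : lexVal (fit N (e' i s)) + 1 ≤ b ^ N := by
        simpa using lexVal_lt (fit N (e' i s))
      have h7 := Nat.mul_le_mul_left M h6
      have h8 := hM (i, fitLeaf N (e' i s))
      rw [Nat.mul_add] at h7
      omega
    intro i s hs
    rcases lt_trichotomy s.length Q with h1 | h1 | h1
    · rw [hlow i s h1]
      have := h.length_le i s h1.le
      omega
    · have := key i s h1; omega
    · have h2 : s.length = Q + 1 := by omega
      rcases List.eq_nil_or_concat s with rfl | ⟨s', a, rfl⟩
      · simp at h2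
      · rw [List.concat_eq_append] at h2 ⊢
        have h3 : s'.length = Q := by simpa using h2
        rw [hleaf i s' a h3]
        simpa using key i s' h3
  · intro i s hs
    rcases (Nat.lt_succ_iff.1 hs).lt_or_eq with h1 | h1
    · rw [hlow i s h1, extendWord, if_pos (h.length_lt i h1)]
      exact h.var i s h1
    · rw [htop i s h1, extendWord_chain i (length_fit N _)]
      have h2 : l (i, ⟨fit N (e' i s), length_fit N _⟩) (pos (i, fitLeaf N (e' i s))) = none :=
        (hpos (i, fitLeaf N (e' i s))).1
      rw [h2]
      have h3 : ∃ s', s'.length = Q ∧ fit N (e' i s') = fit N (e' i s) := ⟨s, h1, rfl⟩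
      simp only
      rw [dif_pos h3]
      rw [huniq i _ s h3.choose_spec.1 h1 h3.choose_spec.2]
  · intro i y s hy
    by_cases h1 : y.length < N
    · rw [extendWord, if_pos h1] at hy
      have h2 := h.min i y s hy
      rw [hlow i s h2.1]
      exact ⟨by omega, h2.2⟩
    · by_cases h2 : ∃ x, y = chainNode M (fit N y) x
      · obtain ⟨x, hx⟩ := h2
        generalize hu : fit N y = u at hx
        have hul : u.length = N := by rw [← hu]; simp
        subst hx
        rw [extendWord_chain i hul] at hy
        rcases h3 : l (i, ⟨u, hul⟩) x with _ | a
        · rw [h3] at hy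
          simp only at hy
          by_cases h4 : ∃ s, s.length = Q ∧ fit N (e' i s) = u
          · rw [dif_pos h4] at hy
            have h5 := Sum.inr.inj hy
            have h6 := h4.choose_spec
            rw [h5] at h6
            obtain ⟨h6, rfl⟩ := h6
            refine ⟨by omega, ?_⟩
            rw [htop i s h6]
            exact chainNode_mono ((hpos _).2 h3)
          · rw [dif_neg h4] at hy; simp at hy
        · rw [h3] at hy; simp at hy
      · rw [extendWord, if_neg h1, dif_neg h2] at hy
        simp at hy

-- Induction on the number of levels. The nodes of the new level are the first variables of lines on
-- the chains above `b^N`. Letters on chains that contain no position do not matter by independence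
-- of the lines; those on the other chains become part of the color in the induction hypothesis.
open Classical in
theorem exists_canonical_reduction [Finite Λ] (a₀ : Λ) (Q : ℕ) : ∀ (R : Type) [Finite R],
    ∃ N, ∀ c : (Fin d → List (Fin b) → Λ) → (Fin d → List (Fin b)) → R,
      ∃ (e : Fin d → List (Fin b) → List (Fin b)) (f : Fin d → List (Fin b) → Λ ⊕ List (Fin b)),
        IsReduction Q N e f ∧ ∀ p : Fin d → List (Fin b), (∀ i, (p i).length ≤ Q) →
          ∀ w w' : Fin d → List (Fin b) → Λ,
            (∀ i s, s <+: p i → s.length < Q → w i s = w' i s) →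
            c (fun i => apply (f i) (w i)) (fun i => e i (p i)) =
              c (fun i => apply (f i) (w' i)) (fun i => e i (p i)) := by
  induction Q with
  | zero =>
    intro R _
    exact ⟨0, fun c => ⟨fun _ _ => [], fun _ _ => Sum.inl a₀,
      ⟨fun _ _ _ h => by simp at h, fun _ _ _ _ h => by simp at h, fun _ _ _ _ _ h => by simp at h,
        fun _ _ _ => by simp, fun _ _ h => by simp at h, fun _ _ _ h => by simp at h⟩,
      fun p _ w w' _ => rfl⟩⟩
  | succ Q ih =>
    intro R _
    -- A color is a table giving the original color for every kind of query at the top and every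
    -- choice of the `d` letters of level `Q`. Fixing `N` here makes the set of chains finite before
    -- the lines are chosen.
    obtain ⟨N, hN⟩ := ih ((Fin d → Option (Option (Fin b))) → (Fin d → Λ) → R)
    have : Finite (treeLT b N) := (List.finite_length_lt (Fin b) N).to_subtype
    have : Finite (treeLT b (N + 1)) := (List.finite_length_lt (Fin b) (N + 1)).to_subtype
    have : Finite (leaves b N) := (List.finite_length_eq (Fin b) N).to_subtype
    obtain ⟨M, hM⟩ := exists_independent_lines Λ a₀ (Fin d × leaves b N)
      ((Fin d → treeLT b N → Λ) → (Fin d → treeLT b (N + 1)) → (Fin d → Option (Option (Fin b))) → R)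
    refine ⟨N + M * b ^ N, fun c => ?_⟩
    let C : (Fin d × leaves b N → ℕ → Λ) → (Fin d × leaves b N → Option ℕ) →
        ((Fin d → treeLT b N → Λ) → (Fin d → treeLT b (N + 1)) → (Fin d → Option (Option (Fin b))) → R) :=
      fun w q w' low kind => c (chainWord M N a₀ w' w) (chainQuery M N (fun i => low i) kind q)
    obtain ⟨l, hl, hC⟩ := hM C
    have hex : ∀ j, ∃ x, l j x = none := fun j => ⟨_, (hl j).choose_spec.2⟩
    let pos : Fin d × leaves b N → ℕ := fun j => Nat.find (hex j)
    have hpos : ∀ j, IsLeast {x | l j x = none} (pos j) := fun j =>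
      ⟨Nat.find_spec (hex j), fun x hx => Nat.find_min' _ hx⟩
    have hposM : ∀ j, pos j < M := fun j =>
      lt_of_le_of_lt (Nat.find_min' _ (hl j).choose_spec.2) (hl j).choose_spec.1
    -- the trace of a position below the chains, and the chains that a query touches
    let tr : (Fin d → List (Fin b)) → Fin d → treeLT b (N + 1) := fun p i =>
      ⟨(p i).take N, by simp [treeLT]⟩
    let touch : (Fin d → Option (Option (Fin b))) → (Fin d → List (Fin b)) → Fin d × leaves b N → Prop :=
      fun kind p j => kind j.1 ≠ none ∧ fitLeaf N (p j.1) = j.2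
    let q : (Fin d → Option (Option (Fin b))) → (Fin d → List (Fin b)) → Fin d × leaves b N → Option ℕ :=
      fun kind p j => if touch kind p j then some (pos j) else none
    -- Chains that the query touches get the letter of their coordinate from the table entry `lam`,
    -- and all other chains get `a₀`.
    obtain ⟨e', f', hr, hc'⟩ := hN (fun w p kind lam => C
      (fun j x => (l j x).getD (if touch kind p j then lam j.1 else a₀)) (q kind p)
      (fun i s => w i s) (tr p) kind)
    refine ⟨extendEmb M N Q e' pos, extendWord M N Q a₀ e' f' l, isReduction_extend hr hpos hposM, ?_⟩
    intro p hp w w' hww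
    -- The kind is `none` for a position below level `Q`, `some none` on level `Q`, and `some (some
    -- a)` for the leaf in direction `a` above a node of level `Q`.
    let kind : Fin d → Option (Option (Fin b)) := fun i =>
      if (p i).length < Q then none else some ((p i).drop Q).head?
    let p₀ : Fin d → List (Fin b) := fun i => (p i).take Q
    let lam : (Fin d → List (Fin b) → Λ) → Fin d → Λ := fun w i =>
      if (p i).length < Q then a₀ else w i (p₀ i)
    have hp₀ : ∀ i, (p₀ i).length ≤ Q := fun i => by simp [p₀]
    have huniq : ∀ i s s', s.length = Q → s'.length = Q → fit N (e' i s) = fit N (e' i s') → s = s' := by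
      intro i s s' hs hs' he
      exact leaf_inj (hr.ext i) hs hs' (prefix_fit (hr.length_le i s hs.le))
        (he ▸ prefix_fit (hr.length_le i s' hs'.le))
    -- The color for `w` equals the normalized one with `a₀` on all untouched chains. Only the
    -- letters of `w` below level `Q` and those at the `p₀ i` of length `Q` remain visible, which is
    -- the form the induction hypothesis handles.
    have key : ∀ w : Fin d → List (Fin b) → Λ,
        c (fun i => apply (extendWord M N Q a₀ e' f' l i) (w i)) (fun i => extendEmb M N Q e' pos i (p i)) =
        C (fun j x => (l j x).getD (if touch kind (fun i => e' i (p₀ i)) j then lam w j.1 else a₀))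
          (q kind (fun i => e' i (p₀ i))) (fun i s => apply (f' i) (w i) s) (tr (fun i => e' i (p₀ i)))
          kind := by
      intro w
      let α : Fin d × leaves b N → Λ := fun j =>
        if h : ∃ s, s.length = Q ∧ fit N (e' j.1 s) = j.2 then w j.1 h.choose else a₀
      have h1 := hC (q kind (fun i => e' i (p₀ i))) (fun j x hj => by
        have hj' : (if touch kind (fun i => e' i (p₀ i)) j then some (pos j) else none) = some x := hj
        split_ifs at hj' with h
        · rw [← Option.some.inj hj']; exact hpos j) α
        (fun j => if touch kind (fun i => e' i (p₀ i)) j then lam w j.1 else a₀) (fun j hj => by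
        have hj' : (if touch kind (fun i => e' i (p₀ i)) j then some (pos j) else none) ≠ none := hj
        split_ifs at hj' with h
        · simp only [if_pos h, α]
          have hQ : ¬ (p j.1).length < Q := fun hlt => h.1 (by simp [kind, hlt])
          have hs : (p₀ j.1).length = Q := by simp [p₀]; omega
          have h2 : fit N (e' j.1 (p₀ j.1)) = j.2 := congrArg Subtype.val h.2
          have h3 : ∃ s, s.length = Q ∧ fit N (e' j.1 s) = j.2 := ⟨_, hs, h2⟩
          rw [dif_pos h3, huniq j.1 _ _ h3.choose_spec.1 hs (h3.choose_spec.2.trans h2.symm)]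
          simp [lam, hQ]
        · simp at hj')
      rw [← h1]
      have e1 : (fun i => apply (extendWord M N Q a₀ e' f' l i) (w i)) =
          chainWord M N a₀ (fun i s => apply (f' i) (w i) s) (fun j x => (l j x).getD (α j)) := by
        funext i y
        by_cases hy : y.length < N
        · simp [apply, extendWord, chainWord, hy]
        · by_cases hy2 : ∃ x, y = chainNode M (fit N y) x
          · obtain ⟨x, hx⟩ := hy2
            generalize hu : fit N y = u at hx
            have hul : u.length = N := by rw [← hu]; simp
            subst hx
            rw [chainWord_chain _ _ i hul, apply, extendWord_chain i hul]
            rcases h3 : l (i, ⟨u, hul⟩) x with _ | a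
            · simp only [Option.getD_none, α]
              split_ifs <;> simp
            · simp
          · simp [apply, extendWord, chainWord, hy, hy2]
      have e2 : (fun i => extendEmb M N Q e' pos i (p i)) =
          chainQuery M N (fun i => tr (fun i => e' i (p₀ i)) i) kind (q kind (fun i => e' i (p₀ i))) := by
        funext i
        have htr : ((tr (fun i => e' i (p₀ i)) i : treeLT b (N + 1)) : List (Fin b)) = e' i (p₀ i) := by
          simp only [tr]
          exact List.take_of_length_le (hr.length_le i _ (hp₀ i))
        by_cases hi : (p i).length < Q
        · have hk : kind i = none := by simp [kind, hi]
          simp only [chainQuery, hk, htr, extendEmb, if_pos hi]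
          simp only [p₀]
          rw [List.take_of_length_le hi.le]
        · have hk : kind i = some ((p i).drop Q).head? := by simp [kind, hi]
          simp only [chainQuery, hk, htr, extendEmb, if_neg hi]
          have hq : q kind (fun i => e' i (p₀ i)) (i, fitLeaf N (e' i (p₀ i))) =
              some (pos (i, fitLeaf N (e' i (p₀ i)))) := by
            simp only [q]
            rw [if_pos]
            exact ⟨by simp [hk], rfl⟩
          rw [hq]
          have hd : ((p i).drop Q).head?.toList = (p i).drop Q := by
            have h3 : ((p i).drop Q).length ≤ 1 := by
              have := hp i
              simp; omega
            rcases h4 : (p i).drop Q with _ | ⟨a, _ | ⟨a', v⟩⟩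
            · simp
            · simp
            · rw [h4] at h3; simp at h3
          rw [hd]
          rfl
      rw [e1, e2]
    rw [key w, key w']
    have hlam : lam w = lam w' := by
      funext i
      simp only [lam]
      split_ifs with hi
      · rfl
      · exact hww i _ (List.take_prefix _ _) (by have := hp₀ i; omega)
    rw [hlam]
    have := hc' p₀ hp₀ w w' (fun i s hs hsQ => hww i s (hs.trans (List.take_prefix _ _)) (by omega))
    exact congrFun (congrFun this kind) (lam w')

end Canonical

/-! ### From branches to levels -/

section Blocks
variable {b d K M : ℕ} [NeZero b] {Λ : Type}

theorem block_div {a x M : ℕ} (hx : x < M) : (a * M + x) / M = a := by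
  rw [Nat.add_comm, Nat.add_mul_div_right _ _ (by omega), Nat.div_eq_of_lt hx, Nat.zero_add]

theorem block_mod {a x M : ℕ} (hx : x < M) : (a * M + x) % M = x := by
  rw [Nat.add_comm, Nat.add_mul_mod_self_right, Nat.mod_eq_of_lt hx]

/-- The letters in coordinate `i` of the words `W` on the blocks of length `M`, the block with index
`(m, i')` being number `m * d + i'`. -/
def blockWord (a₀ : Λ) (M : ℕ) (W : Fin K × Fin d → ℕ → Fin d → Λ × Fin b) (i : Fin d) (j : ℕ) :
    Λ × Fin b :=
  if h : j / M / d < K then W (⟨j / M / d, h⟩, ⟨j / M % d, Nat.mod_lt _ i.pos⟩) (j % M) i else (a₀, 0)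

/-- The position `pos` of the block `(m, i)`; the end of all blocks if `m = K`. -/
def blockLevel (M : ℕ) (pos : Fin K × Fin d → ℕ) (m : ℕ) (i : Fin d) : ℕ :=
  if h : m < K then (m * d + i) * M + pos (⟨m, h⟩, i) else K * d * M

/-- The letters that give coordinate `i` of the block `(m, i)` the direction `(s i).get m` and the label of
the corresponding initial segment of `s i`. -/
def pathLetter (a₀ : Λ) (w : Fin d → List (Fin b) → Λ) (s : Fin d → List (Fin b)) (j : Fin K × Fin d)
    (i : Fin d) : Λ × Fin b :=
  if j.2 = i then
    (if (j.1 : ℕ) ≤ (s i).length then w i ((s i).take j.1) else a₀, (s i).getD j.1 0)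
  else (a₀, 0)

/-- The direction at level `j` of the image of `s` in the tree with index `i`. -/
def blockDir (M : ℕ) (l : Fin K × Fin d → ℕ → Option (Fin d → Λ × Fin b)) (i : Fin d)
    (s : List (Fin b)) (j : ℕ) : Fin b :=
  if h : j / M / d < K then
    match l (⟨j / M / d, h⟩, ⟨j / M % d, Nat.mod_lt _ i.pos⟩) (j % M) with
    | some β => (β i).2
    | none => if j / M % d = i then s.getD (j / M / d) 0 else 0
  else 0

/-- The image of `s` in the tree with index `i`. -/
def blockEmb (M : ℕ) (l : Fin K × Fin d → ℕ → Option (Fin d → Λ × Fin b)) (pos : Fin K × Fin d → ℕ)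
    (i : Fin d) (s : List (Fin b)) : List (Fin b) :=
  (List.range (blockLevel M pos s.length i)).map (blockDir M l i s)

open Classical in
/-- The variable word in the tree with index `i` given by the lines `l`. -/
noncomputable def blockVar (a₀ : Λ) (M : ℕ) (l : Fin K × Fin d → ℕ → Option (Fin d → Λ × Fin b))
    (pos : Fin K × Fin d → ℕ) (i : Fin d) (z : List (Fin b)) : Λ ⊕ List (Fin b) :=
  if h : z.length / M / d < K then
    match l (⟨z.length / M / d, h⟩, ⟨z.length / M % d, Nat.mod_lt _ i.pos⟩) (z.length % M) with
    | some β => Sum.inl (β i).1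
    | none => if h : z.length / M % d = i ∧ ∃ s, s.length = z.length / M / d ∧ blockEmb M l pos i s <+: z
      then Sum.inr h.2.choose else Sum.inl a₀
  else Sum.inl a₀

variable {l : Fin K × Fin d → ℕ → Option (Fin d → Λ × Fin b)} {pos : Fin K × Fin d → ℕ} {a₀ : Λ}

theorem length_blockEmb (i : Fin d) (s : List (Fin b)) :
    (blockEmb M l pos i s).length = blockLevel M pos s.length i := by
  simp [blockEmb]

theorem blockDir_eq (w : Fin d → List (Fin b) → Λ) (p : Fin d → List (Fin b)) (i : Fin d) (j : ℕ) :
    blockDir M l i (p i) j =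
      (blockWord a₀ M (fun j x => (l j x).getD (pathLetter a₀ w p j)) i j).2 := by
  unfold blockDir blockWord
  by_cases h : j / M / d < K
  · simp only [dif_pos h]
    rcases hn : l (⟨j / M / d, h⟩, ⟨j / M % d, Nat.mod_lt _ i.pos⟩) (j % M) with _ | β
    · simp only [Option.getD_none, pathLetter, Fin.ext_iff]
      split_ifs <;> rfl
    · simp only [Option.getD_some]
  · simp only [dif_neg h]

theorem blockLevel_lt (hM : ∀ j, pos j < M) {m m' : ℕ} {i j : Fin d} (h : m * d + i < m' * d + j)
    (hm : m < K) (hm' : m' ≤ K) : blockLevel M pos m i < blockLevel M pos m' j := by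
  have h1 := hM (⟨m, hm⟩, i)
  have h3 : ∀ a, m * d + i < a → (m * d + i) * M + M ≤ a * M := fun a ha => by
    have := Nat.mul_le_mul_right M (Nat.succ_le_of_lt ha)
    rwa [Nat.succ_mul] at this
  rcases hm'.lt_or_eq with h2 | h2
  · simp only [blockLevel, hm, h2, dif_pos]
    have := h3 _ h
    omega
  · simp only [blockLevel, hm, dif_pos, h2, lt_irrefl, dif_neg, not_false_eq_true]
    have h4 : m * d + d ≤ K * d := by
      have := Nat.mul_le_mul_right d (Nat.succ_le_of_lt hm)
      rwa [Nat.succ_mul] at this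
    have := h3 (K * d) (by have := i.2; omega)
    omega

theorem blockLevel_lt_of_lt (hM : ∀ j, pos j < M) {m m' : ℕ} (i j : Fin d) (h : m < m') (hm' : m' ≤ K) :
    blockLevel M pos m i < blockLevel M pos m' j := by
  refine blockLevel_lt hM ?_ (by omega) hm'
  have := Nat.mul_le_mul_right d (Nat.succ_le_of_lt h)
  rw [Nat.succ_mul] at this
  have := i.2
  omega

theorem blockLevel_le (hM : ∀ j, pos j < M) {m : ℕ} (i : Fin d) (hm : m ≤ K) :
    blockLevel M pos m i ≤ K * d * M := by
  rcases hm.lt_or_eq with h | h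
  · have := blockLevel_lt_of_lt hM i i h le_rfl
    simp only [blockLevel, lt_irrefl, dif_neg, not_false_eq_true] at this ⊢
    omega
  · simp [blockLevel, h]

theorem blockLevel_lt_top (hM : ∀ j, pos j < M) {m : ℕ} (i : Fin d) (hm : m < K) :
    blockLevel M pos m i < K * d * M := by
  have := blockLevel_lt_of_lt hM i i hm le_rfl
  simpa only [blockLevel, lt_irrefl, dif_neg, not_false_eq_true] using this

/-- `pos` is the least variable position in its block, so variables of the block `(m, i)` occur only
from the level of the nodes of height `m` on. -/
theorem blockLevel_le_of_none {α : Type*} {l : Fin K × Fin d → ℕ → Option α}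
    (hl : ∀ j, IsLeast {x | l j x = none} (pos j)) {i : Fin d} {j : ℕ}
    (h : j / M / d < K) (hi : j / M % d = i)
    (hn : l (⟨j / M / d, h⟩, ⟨j / M % d, Nat.mod_lt _ i.pos⟩) (j % M) = none) :
    blockLevel M pos (j / M / d) i ≤ j := by
  have h1 := (hl _).2 hn
  have h2 : (⟨j / M % d, Nat.mod_lt _ i.pos⟩ : Fin d) = i := Fin.ext hi
  rw [h2] at h1
  simp only [blockLevel, h, dif_pos]
  have h3 : j / M / d * d + i = j / M := by
    rw [← hi]; exact Nat.div_add_mod' _ _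
  rw [h3]
  have := Nat.div_add_mod' j M
  omega

theorem blockLevel_div (hM : ∀ j, pos j < M) {m : ℕ} (i : Fin d) (hm : m < K) :
    blockLevel M pos m i / M / d = m ∧ blockLevel M pos m i / M % d = i ∧
      blockLevel M pos m i % M = pos (⟨m, hm⟩, i) := by
  have h1 := hM (⟨m, hm⟩, i)
  simp only [blockLevel, hm, dif_pos]
  rw [block_div h1, block_mod h1, block_div i.2, block_mod i.2]
  exact ⟨rfl, rfl, rfl⟩

theorem map_range_concat_prefix {α : Type*} {D D' : ℕ → α} {n n' : ℕ} (h : n < n')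
    (hD : ∀ j < n, D j = D' j) : (List.range n).map D ++ [D' n] <+: (List.range n').map D' := by
  have h1 : (List.range n).map D ++ [D' n] = (List.range (n + 1)).map D' := by
    rw [List.range_succ, List.map_append]
    congr 1
    apply List.map_congr_left
    intro j hj
    exact hD j (by simpa using hj)
  rw [h1]
  obtain ⟨k, rfl⟩ := Nat.exists_eq_add_of_le (Nat.succ_le_of_lt h)
  rw [Nat.succ_eq_add_one, List.range_add (n := n + 1), List.map_append]
  exact List.prefix_append _ _

/-- A direction read from `s` at level `j` belongs to an entry whose block begins to vary at or
below `j`. Below the level of the image of `s`, only entries of `s` itself are therefore read, and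
the variable at that level reads the new entry `a`. -/
theorem blockEmb_ext (hl : ∀ j, IsLeast {x | l j x = none} (pos j)) (hM : ∀ j, pos j < M)
    (i : Fin d) (s : List (Fin b)) (a : Fin b) (hs : s.length < K) :
    blockEmb M l pos i s ++ [a] <+: blockEmb M l pos i (s ++ [a]) := by
  have h1 : blockLevel M pos s.length i < blockLevel M pos (s ++ [a]).length i :=
    blockLevel_lt_of_lt hM i i (by simp) (by simpa using hs)
  have h2 : blockDir M l i (s ++ [a]) (blockLevel M pos s.length i) = a := by
    obtain ⟨e1, e2, e3⟩ := blockLevel_div hM i hs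
    have e4 : l (⟨s.length, hs⟩, i) (pos (⟨s.length, hs⟩, i)) = none := (hl _).1
    simp only [blockDir, e1, e2, e3, hs, dif_pos, Fin.eta, e4, if_true]
    simp
  have h3 := map_range_concat_prefix (D := blockDir M l i s) (D' := blockDir M l i (s ++ [a])) h1 (fun j hj => by
    unfold blockDir
    by_cases h : j / M / d < K
    · simp only [dif_pos h]
      rcases h4 : l (⟨j / M / d, h⟩, ⟨j / M % d, Nat.mod_lt _ i.pos⟩) (j % M) with _ | β
      · simp only
        by_cases hi : j / M % d = i
        · rw [if_pos hi, if_pos hi]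
          have h5 := blockLevel_le_of_none hl h hi h4
          have h6 : j / M / d < s.length := by
            by_contra hc
            rcases (not_lt.1 hc).lt_or_eq with h7 | h7
            · have := blockLevel_lt_of_lt hM i i h7 h.le
              omega
            · rw [h7] at hj; omega
          rw [List.getD_append _ _ _ _ h6]
        · rw [if_neg hi, if_neg hi]
      · rfl
    · simp only [dif_neg h])
  rw [h2] at h3
  exact h3

theorem blockEmb_mono (hl : ∀ j, IsLeast {x | l j x = none} (pos j)) (hM : ∀ j, pos j < M)
    (i : Fin d) {s t : List (Fin b)} (hst : s <+: t) (ht : t.length ≤ K) :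
    blockEmb M l pos i s <+: blockEmb M l pos i t := by
  by_cases he : s = t
  · subst he; exact List.prefix_rfl
  · obtain ⟨a, ha⟩ := exists_concat_prefix hst he
    exact prefix_of_concat_prefix (concat_prefix_of_ext (fun s a => blockEmb_ext hl hM i s a) ha ht)

/-- The sequence `s` chosen in the definition of `blockVar` is unique, since two images of sequences
of equal length below the same `z` coincide by `leaf_inj`. -/
theorem blockVar_eq (hl : ∀ j, IsLeast {x | l j x = none} (pos j)) (hM : ∀ j, pos j < M)
    {i : Fin d} {s z : List (Fin b)} (h : z.length / M / d < K)
    (hn : l (⟨z.length / M / d, h⟩, ⟨z.length / M % d, Nat.mod_lt _ i.pos⟩) (z.length % M) = none)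
    (hi : z.length / M % d = i) (hs : s.length = z.length / M / d)
    (hsz : blockEmb M l pos i s <+: z) : blockVar a₀ M l pos i z = Sum.inr s := by
  have h1 : z.length / M % d = i ∧ ∃ s, s.length = z.length / M / d ∧ blockEmb M l pos i s <+: z :=
    ⟨hi, s, hs, hsz⟩
  rw [blockVar, dif_pos h, hn]
  simp only
  rw [dif_pos h1]
  congr 1
  have h2 := h1.2.choose_spec
  exact leaf_inj (fun s a hsa => blockEmb_ext hl hM i s a (by omega)) h2.1 hs h2.2 hsz

theorem blockVar_min {i : Fin d} {s z : List (Fin b)} (h : blockVar a₀ M l pos i z = Sum.inr s) :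
    s.length < K ∧ blockEmb M l pos i s <+: z := by
  unfold blockVar at h
  by_cases h1 : z.length / M / d < K
  swap
  · rw [dif_neg h1] at h; simp at h
  rw [dif_pos h1] at h
  rcases h2 : l (⟨z.length / M / d, h1⟩, ⟨z.length / M % d, Nat.mod_lt _ i.pos⟩) (z.length % M)
    with _ | β
  · simp only [h2] at h
    split_ifs at h with h3
    have h4 := h3.2.choose_spec
    rw [Sum.inr.inj h] at h4
    exact ⟨by omega, h4.2⟩
  · simp only [h2] at h
    simp at h

/-- The nodes of height `m` in tree `i` all go to the level `blockLevel M pos m i`, which increases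
with the block number `m * d + i`; what remains is composition with the given reduction. -/
theorem isReduction_block (hl : ∀ j, IsLeast {x | l j x = none} (pos j)) (hM : ∀ j, pos j < M)
    {N : ℕ} {e : Fin d → List (Fin b) → List (Fin b)} {f : Fin d → List (Fin b) → Λ ⊕ List (Fin b)}
    (h : IsReduction (K * d * M) N e f) :
    IsReduction K N (fun i s => e i (blockEmb M l pos i s))
      (fun i => compWord (f i) (blockVar a₀ M l pos i)) where
  ext i s a hs := concat_prefix_of_ext (h.ext i) (blockEmb_ext hl hM i s a hs)
    (by rw [length_blockEmb]; exact blockLevel_le hM i (by simpa using hs))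
  lex i s s' he hs hss := by
    refine h.lex i _ _ (by rw [length_blockEmb, length_blockEmb, he])
      (by rw [length_blockEmb]; exact blockLevel_lt_top hM i hs) ?_
    rcases hss with hss | ⟨p, x, y, hxy, h1, h2⟩
    · exact Or.inl (blockEmb_mono hl hM i hss (by omega))
    · exact Or.inr ⟨_, x, y, hxy, concat_prefix_of_ext (blockEmb_ext hl hM i) h1 hs.le,
        concat_prefix_of_ext (blockEmb_ext hl hM i) h2 (by omega)⟩
  next i j s s' hs hs' := by
    refine h.next i j _ _ ?_ (by rw [length_blockEmb]; exact blockLevel_lt_top hM j hs')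
    rw [length_blockEmb, length_blockEmb]
    exact blockLevel_lt_of_lt hM i j hs hs'.le
  length_le i s hs := h.length_le i _ (by rw [length_blockEmb]; exact blockLevel_le hM i hs)
  var i s hs := by
    have h1 := h.var i (blockEmb M l pos i s) (by rw [length_blockEmb]; exact blockLevel_lt_top hM i hs)
    unfold compWord
    rw [h1]
    simp only [Sum.elim_inr]
    obtain ⟨e1, e2, e3⟩ := blockLevel_div hM i hs
    have e4 : l (⟨s.length, hs⟩, i) (pos (⟨s.length, hs⟩, i)) = none := (hl _).1
    refine blockVar_eq hl hM ?_ ?_ ?_ ?_ List.prefix_rfl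
    · rw [length_blockEmb, e1]; exact hs
    · simp only [length_blockEmb, e1, e2, e3, Fin.eta, e4]
    · rw [length_blockEmb, e2]
    · rw [length_blockEmb, e1]
  min i x s hx := by
    unfold compWord at hx
    rcases h1 : f i x with a | z
    · rw [h1] at hx; simp at hx
    · rw [h1] at hx
      have h2 := blockVar_min (a₀ := a₀) hx
      have h3 := h.min i x z h1
      exact ⟨h2.1, ((h.isSkewEmb i).mono h2.2 h3.1).trans h3.2⟩

/-- Every coloring of words and positions in finitely many trees has a reduction to `K` levels in which
the color depends only on the levels of the positions and on the letters at the nodes among them. -/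
theorem exists_level_reduction [Finite Λ] (a₀ : Λ) (K : ℕ) (R : Type) [Finite R] :
    ∃ N, ∀ c : (Fin d → List (Fin b) → Λ) → (Fin d → List (Fin b)) → R,
      ∃ (e : Fin d → List (Fin b) → List (Fin b)) (f : Fin d → List (Fin b) → Λ ⊕ List (Fin b)),
        IsReduction K N e f ∧
        (∀ i j, i < j → ∀ s s' : List (Fin b), s.length = s'.length → s.length < K →
          (e i s).length < (e j s').length) ∧
        ∀ p p' : Fin d → List (Fin b), (∀ i, (p i).length ≤ K) → (∀ i, (p i).length = (p' i).length) →
          ∀ w w' : Fin d → List (Fin b) → Λ, (∀ i, (p i).length < K → w i (p i) = w' i (p' i)) →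
            c (fun i => apply (f i) (w i)) (fun i => e i (p i)) =
              c (fun i => apply (f i) (w' i)) (fun i => e i (p' i)) := by
  -- A letter carries a label and a direction for each of the `d` trees. The color is a table over
  -- all possible heights of the positions, with `K` standing for leaves.
  obtain ⟨M, hM⟩ := exists_independent_lines (Fin d → Λ × Fin b) (fun _ => (a₀, 0)) (Fin K × Fin d)
    ((Fin d → Fin (K + 1)) → R)
  obtain ⟨N, hN⟩ := exists_canonical_reduction (b := b) (d := d) a₀ (K * d * M) R
  refine ⟨N, fun c => ?_⟩
  obtain ⟨e, f, hr, hc⟩ := hN c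
  obtain ⟨l, hlM, hC⟩ := hM (fun W q κ => c
    (fun i => apply (f i) (fun z => (blockWord a₀ M W i z.length).1))
    (fun i => e i ((List.range (blockLevel M (fun j => (q j).getD 0) (κ i) i)).map
      (fun j => (blockWord a₀ M W i j).2))))
  classical
  have hex : ∀ j, ∃ x, l j x = none := fun j => ⟨_, (hlM j).choose_spec.2⟩
  let pos : Fin K × Fin d → ℕ := fun j => Nat.find (hex j)
  have hl : ∀ j, IsLeast {x | l j x = none} (pos j) := fun j =>
    ⟨Nat.find_spec (hex j), fun x hx => Nat.find_min' _ hx⟩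
  have hpM : ∀ j, pos j < M := fun j =>
    lt_of_le_of_lt (Nat.find_min' _ (hlM j).choose_spec.2) (hlM j).choose_spec.1
  refine ⟨_, _, isReduction_block (a₀ := a₀) hl hpM hr, ?_, ?_⟩
  · intro i j hij s s' hs hsK
    have h1 : blockLevel M pos s.length i < blockLevel M pos s'.length j := by
      refine blockLevel_lt hpM ?_ hsK (by omega)
      rw [hs]
      exact Nat.add_lt_add_left hij _
    exact hr.next i j _ _ (by rwa [length_blockEmb, length_blockEmb])
      (by rw [length_blockEmb]; exact blockLevel_lt_top hpM j (by omega))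
  -- A position of height `m` in tree `i` reveals the first variable of the block `(m, i)`, because
  -- that is the level at which the branch is cut off.
  · let q : (Fin d → List (Fin b)) → Fin K × Fin d → Option ℕ := fun p j =>
      if (p j.2).length = j.1 then some (pos j) else none
    -- A word on the tree may be replaced by one whose letters depend only on the level, since the
    -- canonical coloring sees only the branch to each position, and there the two words agree.
    have key : ∀ p : Fin d → List (Fin b), ∀ hp : (∀ i, (p i).length ≤ K), ∀ w : Fin d → List (Fin b) → Λ,
        c (fun i => apply (compWord (f i) (blockVar a₀ M l pos i)) (w i))
          (fun i => e i (blockEmb M l pos i (p i))) =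
        c (fun i => apply (f i) (fun z => (blockWord a₀ M
            (fun j x => (l j x).getD (pathLetter a₀ w p j)) i z.length).1))
          (fun i => e i ((List.range (blockLevel M (fun j => (q p j).getD 0) (p i).length i)).map
            (fun j => (blockWord a₀ M (fun j x => (l j x).getD (pathLetter a₀ w p j)) i j).2))) := by
      intro p hp w
      have e1 : ∀ i, (List.range (blockLevel M (fun j => (q p j).getD 0) (p i).length i)).map
            (fun j => (blockWord a₀ M (fun j x => (l j x).getD (pathLetter a₀ w p j)) i j).2) =
          blockEmb M l pos i (p i) := by
        intro i
        have h1 : blockLevel M (fun j => (q p j).getD 0) (p i).length i =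
            blockLevel M pos (p i).length i := by
          unfold blockLevel
          split_ifs with h
          · simp [q]
          · rfl
        rw [h1, blockEmb]
        apply List.map_congr_left
        intro j _
        exact (blockDir_eq w p i j).symm
      simp only [e1, apply_compWord]
      refine hc _ (fun i => by rw [length_blockEmb]; exact blockLevel_le hpM i (hp i)) _ _ ?_
      intro i z hz hzQ
      have hzl := hz.length_le
      rw [length_blockEmb] at hzl
      have hK : z.length / M / d < K := by
        rw [Nat.div_div_eq_div_mul]
        apply Nat.div_lt_of_lt_mul
        calc z.length < K * d * M := hzQ
          _ = M * d * K := by ring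
      unfold apply blockWord
      simp only [dif_pos hK]
      rcases hn : l (⟨z.length / M / d, hK⟩, ⟨z.length / M % d, Nat.mod_lt _ i.pos⟩) (z.length % M)
        with _ | β
      · simp only [Option.getD_none, pathLetter, Fin.ext_iff]
        by_cases hi : z.length / M % d = i
        · rw [if_pos hi]
          have h1 := blockLevel_le_of_none hl hK hi hn
          have h2 : z.length / M / d ≤ (p i).length := by
            by_contra hcon
            have := blockLevel_lt_of_lt hpM i i (not_le.1 hcon) hK.le
            omega
          have h3 : ((p i).take (z.length / M / d)).length = z.length / M / d := by
            simp [h2]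
          have h4 : blockEmb M l pos i ((p i).take (z.length / M / d)) <+: z := by
            refine List.prefix_of_prefix_length_le
              (blockEmb_mono hl hpM i (List.take_prefix _ _) (hp i)) hz ?_
            rw [length_blockEmb, h3]
            exact h1
          rw [blockVar_eq hl hpM hK hn hi h3 h4]
          simp [h2]
        · rw [if_neg hi, blockVar, dif_pos hK, hn]
          simp [hi]
      · simp only [blockVar, dif_pos hK, hn, Option.getD_some, Sum.elim_inl, id]
    intro p p' hp hpp w w' hw
    rw [key p hp w, key p' (fun i => hpp i ▸ hp i) w']
    have hq : q p' = q p := by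
      funext j
      simp only [q, hpp]
    rw [hq]
    -- In a revealed block the substituted letter has only the label at the position itself as data:
    -- its direction lies past the end of the position and takes the default value `0`. So the two
    -- substitutions agree on all revealed blocks.
    have h1 := hC (q p) (fun j x hj => by
        have hj' : (if (p j.2).length = j.1 then some (pos j) else none) = some x := hj
        split_ifs at hj' with h
        · rw [← Option.some.inj hj']; exact hl j) (pathLetter a₀ w p) (pathLetter a₀ w' p')
      (fun j hj => by
        have hj' : (if (p j.2).length = j.1 then some (pos j) else none) ≠ none := hj
        split_ifs at hj' with h
        · funext i
          unfold pathLetter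
          split_ifs with h1 h2 h3 h3
          · subst h1
            have h4 : (p' j.2).length = j.1 := by rw [← hpp]; exact h
            rw [List.getD_eq_default _ _ h.le, List.getD_eq_default _ _ h4.le,
              List.take_of_length_le h.le, List.take_of_length_le h4.le,
              hw j.2 (by rw [h]; exact j.1.2)]
          · subst h1; rw [hpp] at h2; exact absurd h2 h3
          · subst h1; rw [hpp] at h2; exact absurd h3 h2
          · subst h1; omega
          · rfl
        · simp at hj')
    have h2 := congrFun h1 (fun i => ⟨(p i).length, Nat.lt_succ_of_le (hp i)⟩)
    simp only [← hpp]
    exact h2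

end Blocks

/-! ### Adding leaves to a complete subtree -/

section Leaves
variable {b : ℕ}

theorem ncard_leaves (b n : ℕ) : (leaves b n).ncard = b ^ n := by
  rw [← Nat.card_coe_set_eq]
  change Nat.card (List.Vector (Fin b) n) = b ^ n
  rw [Nat.card_eq_fintype_card, card_vector, Fintype.card_fin]

/-- `φ` on the sequences of length less than `K` and `x` on the longer ones. -/
def withLeaves (K : ℕ) (φ x : List (Fin b) → List (Fin b)) (s : List (Fin b)) : List (Fin b) :=
  if s.length < K then φ s else x s

/-- All leaves have length `n` and all nodes are shorter, so the leaves satisfy the conditions for a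
further level of the embedding. -/
theorem IsSkewEmb.withLeaves {K n : ℕ} {φ x : List (Fin b) → List (Fin b)} (h : IsSkewEmb K φ)
    (hφ : ∀ s, s.length < K → (φ s).length < n)
    (hx : ∀ s, s.length = K → (x s).length = n)
    (hext : ∀ s a, s.length + 1 = K → φ s ++ [a] <+: x (s ++ [a])) :
    IsSkewEmb (K + 1) (withLeaves K φ x) where
  ext s a hs := by
    have h1 : s.length < K := by omega
    rcases (Nat.succ_le_of_lt h1).lt_or_eq with h2 | h2
    · have h3 : (s ++ [a]).length < K := by simpa using h2
      simp only [TreeHJ.withLeaves, if_pos h1, if_pos h3]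
      exact h.ext s a h2
    · have h3 : ¬ (s ++ [a]).length < K := by simp; omega
      simp only [TreeHJ.withLeaves, if_pos h1, if_neg h3]
      exact hext s a h2
  lex s s' hl hs hss := by
    by_cases h1 : s.length < K
    · simp only [TreeHJ.withLeaves, if_pos h1, if_pos (hl ▸ h1)]
      exact h.lex s s' hl h1 hss
    · have h2 : ¬ s'.length < K := hl ▸ h1
      simp only [TreeHJ.withLeaves, if_neg h1, if_neg h2]
      rw [hx s (by omega), hx s' (by omega)]
  lt s s' hl hs' := by
    have h1 : s.length < K := by omega
    by_cases h2 : s'.length < K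
    · simp only [TreeHJ.withLeaves, if_pos h1, if_pos h2]
      exact h.lt s s' hl h2
    · simp only [TreeHJ.withLeaves, if_pos h1, if_neg h2]
      rw [hx s' (by omega)]
      exact hφ s h1

theorem withLeaves_image (K : ℕ) (φ x : List (Fin b) → List (Fin b)) :
    withLeaves K φ x '' treeLT b (K + 1) = φ '' treeLT b K ∪ x '' leaves b K := by
  ext t
  constructor
  · rintro ⟨s, hs, rfl⟩
    have hs' : s.length < K + 1 := hs
    by_cases h : s.length < K
    · exact Or.inl ⟨s, h, by simp [withLeaves, h]⟩
    · exact Or.inr ⟨s, show s.length = K by omega, by simp [withLeaves, h]⟩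
  · rintro (⟨s, hs, rfl⟩ | ⟨s, hs, rfl⟩)
    · have hs' : s.length < K := hs
      exact ⟨s, Nat.lt_succ_of_lt hs', by simp [withLeaves, hs']⟩
    · have hs' : s.length = K := hs
      exact ⟨s, show s.length < K + 1 by omega, by simp [withLeaves, hs']⟩

theorem IsSkewEmb.isSkew_union [NeZero b] {K n : ℕ} {φ x : List (Fin b) → List (Fin b)}
    (h : IsSkewEmb K φ) (hφ : ∀ s, s.length < K → (φ s).length < n)
    (hx : ∀ s, s.length = K → (x s).length = n)
    (hext : ∀ s a, s.length + 1 = K → φ s ++ [a] <+: x (s ++ [a])) :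
    IsSkew (φ '' treeLT b K ∪ x '' leaves b K) := by
  rw [← withLeaves_image]
  exact (h.withLeaves hφ hx hext).isSkew (by omega)

theorem IsSkewEmb.ncard_leaves {K n : ℕ} {φ x : List (Fin b) → List (Fin b)}
    (h : IsSkewEmb K φ) (hφ : ∀ s, s.length < K → (φ s).length < n)
    (hx : ∀ s, s.length = K → (x s).length = n)
    (hext : ∀ s a, s.length + 1 = K → φ s ++ [a] <+: x (s ++ [a])) :
    (x '' leaves b K).ncard = b ^ K := by
  rw [← TreeHJ.ncard_leaves b K]
  refine Set.InjOn.ncard_image ?_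
  intro s hs s' hs' he
  have h1 : s.length = K := hs
  have h2 : s'.length = K := hs'
  refine (h.withLeaves hφ hx hext).inj (s := s) (t := s') (by omega) (by omega) ?_
  simpa [TreeHJ.withLeaves, h1, h2] using he

end Leaves

/-! ### Renaming the alphabet -/

section Transport
variable {b n d : ℕ} {Λ : Type*} {Λ' : Type*} {D : TriPartition d}

/-- Renaming of the letters of a variable word. -/
def mapVWord (σ : Λ → Λ') (f : VWord b n Λ) : VWord b n Λ' := fun s => Sum.map σ id (f s)

theorem mapVWord_eq_inr {σ : Λ → Λ'} {f : VWord b n Λ} {s t : treeLT b n} :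
    mapVWord σ f s = Sum.inr t ↔ f s = Sum.inr t := by
  unfold mapVWord
  rcases f s with a | u <;> simp

theorem ws_mapVWord (σ : Λ → Λ') (f : VWord b n Λ) : ws (mapVWord σ f) = ws f := by
  unfold ws
  simp only [mapVWord_eq_inr]

theorem subst_mapVWord (σ : Λ → Λ') (f : VWord b n Λ) (α : treeLT b n → Λ) :
    subst (mapVWord σ f) (fun t => σ (α t)) = fun s => σ (subst f α s) := by
  funext s
  unfold subst mapVWord
  rcases f s with a | u <;> rfl

theorem IsMixedVariableWord.map {k : ℕ} {f : Fin d → VWord b n Λ} {X : D.D₁ → Set (List (Fin b))}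
    (h : IsMixedVariableWord k f X) (σ : Λ → Λ') :
    IsMixedVariableWord k (fun i => mapVWord σ (f i)) X where
  variableWord i := by
    obtain ⟨T, hT, hc, hf⟩ := h.variableWord i
    refine ⟨T, hT, hc, fun s t hst => hf.mem s t (mapVWord_eq_inr.1 hst), fun t ht => ?_⟩
    have := hf.min t ht
    exact ⟨mapVWord_eq_inr.2 this.1, fun s hs => this.2 s (mapVWord_eq_inr.1 hs)⟩
  vector := by simpa only [ws_mapVWord] using h.vector
  leaf_subset := h.leaf_subset
  leaf_card := h.leaf_card
  leaf_skew i := by simpa only [ws_mapVWord] using h.leaf_skew i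

/-- Renaming of the letters of an element of a mixed product. -/
def mapMixedWord (σ : Λ → Λ') (p : MixedWord b n Λ D) : MixedWord b n Λ' D where
  word i s := σ (p.word i s)
  leaf := p.leaf
  node := p.node

theorem MixedWord.ext' {p q : MixedWord b n Λ D}
    (h1 : ∀ i s, p.word i s = q.word i s) (h2 : ∀ i, (p.leaf i : List (Fin b)) = q.leaf i)
    (h3 : ∀ i, (p.node i : List (Fin b)) = q.node i) : p = q := by
  rcases p with ⟨w, x, t⟩
  rcases q with ⟨w', x', t'⟩
  have e1 : w = w' := by funext i s; exact h1 i s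
  have e2 : x = x' := by funext i; exact Subtype.ext (h2 i)
  have e3 : t = t' := by funext i; exact Subtype.ext (h3 i)
  rw [e1, e2, e3]

theorem IsGood.map {r : ℕ} {c : MixedWord b n Λ' D → Fin r} (σ : Λ ≃ Λ') {f : Fin d → VWord b n Λ}
    {X : D.D₁ → Set (List (Fin b))} (h : IsGood (fun p => c (mapMixedWord σ p)) f X) :
    IsGood c (fun i => mapVWord σ (f i)) X := by
  have key : ∀ p ∈ mixedSpan (fun i => mapVWord σ (f i)) X,
      mapMixedWord σ.symm p ∈ mixedSpan f X := by
    rintro p ⟨hw, hl, hn⟩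
    refine ⟨fun i => ?_, hl, fun i => by
      have := hn i
      rwa [ws_mapVWord] at this⟩
    obtain ⟨α, hα⟩ := hw i
    refine ⟨fun t => σ.symm (α t), ?_⟩
    have := subst_mapVWord σ (f i) (fun t => σ.symm (α t))
    simp only [Equiv.apply_symm_apply] at this
    funext s
    have h1 := congrFun (this.symm.trans hα) s
    simp only [mapMixedWord]
    rw [← h1, Equiv.symm_apply_apply]
  have inv : ∀ p : MixedWord b n Λ' D, mapMixedWord σ (mapMixedWord σ.symm p) = p := by
    intro p; cases p; simp [mapMixedWord]
  intro p hp q hq hpq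
  have := h _ (key p hp) _ (key q hq) (fun i => ⟨(hpq i).1, congrArg σ.symm (hpq i).2⟩)
  simpa only [inv] using this

end Transport

/-! ### Good subspaces and the number `MTHJ` -/

section Good
variable {b : ℕ} [NeZero b]

/-- The element of the mixed product that total words and positions define. -/
def toMixedWord {d : ℕ} {Λ : Type*} (D : TriPartition d) {n : ℕ} (hn : 0 < n)
    (w : Fin d → List (Fin b) → Λ) (p : Fin d → List (Fin b)) : MixedWord b n Λ D where
  word i s := w i s
  leaf i := ⟨fit n (p i), length_fit n (p i)⟩
  node i := ⟨(p i).take (n - 1), by simp [treeLT]; omega⟩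

/-- The variable word on `b^{< n}` defined by `f`, with variables indexed by their first occurrences. -/
def toVWord {Λ : Type*} (n : ℕ) (a₀ : Λ) (e : List (Fin b) → List (Fin b))
    (f : List (Fin b) → Λ ⊕ List (Fin b)) : VWord b n Λ := fun x =>
  match f x with
  | Sum.inl a => Sum.inl a
  | Sum.inr s => if h : (e s).length < n then Sum.inr ⟨e s, h⟩ else Sum.inl a₀

/-- In `exists_level_reduction` the positions are the nodes `t_i` for `i ∈ D₂` and leaves for the
other `i`. Leaves all have height `K` and carry no letter, so only the heights of the nodes and the
letters at them influence the color. -/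
theorem exists_good_subspace (Λ : Type) [Finite Λ] [Nonempty Λ] (d K r : ℕ) (hK : 1 ≤ K) :
    ∃ N, 0 < N ∧ ∀ n, N ≤ n → ∀ (D : TriPartition d) (c : MixedWord b n Λ D → Fin r),
      ∃ (f : Fin d → VWord b n Λ) (X : D.D₁ → Set (List (Fin b))),
        IsMixedVariableWord K f X ∧ IsGood c f X := by
  obtain ⟨a₀⟩ := ‹Nonempty Λ›
  obtain ⟨N, hN⟩ := exists_level_reduction (b := b) (d := d) a₀ K (Fin r)
  -- The added `1` only ensures `0 < n`, which `toMixedWord` needs.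
  refine ⟨N + 1, by omega, fun n hn D c => ?_⟩
  have hn0 : 0 < n := by omega
  obtain ⟨e, f, hr, hsame, hc⟩ := hN (fun w p => c (toMixedWord D hn0 w p))
  have hlt : ∀ i s, s.length < K → (e i s).length < n := fun i s hs => by
    have := hr.length_lt i hs; omega
  have hvec : IsVectorEmb K e := ⟨hr.isSkewEmb, fun i j hij s s' hl hs => (hsame i j hij s s' hl hs).le,
    hr.next⟩
  have hfit : ∀ i s a, s.length + 1 = K → e i s ++ [a] <+: fit n (e i (s ++ [a])) := by
    intro i s a hs
    refine (hr.ext i s a (by omega)).trans (prefix_fit ?_)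
    have := hr.length_le i (s ++ [a]) (by simp; omega)
    omega
  have hsub : ∀ i, e i '' treeLT b K ⊆ treeLT b n := by
    rintro i _ ⟨s, hs, rfl⟩; exact hlt i s hs
  have hinr : ∀ i (s t : treeLT b n), toVWord n a₀ (e i) (f i) s = Sum.inr t →
      ∃ u, f i s = Sum.inr u ∧ e i u = t := by
    intro i s t hst
    unfold toVWord at hst
    rcases hf : f i s with a | u
    · rw [hf] at hst; simp at hst
    · rw [hf] at hst
      simp only at hst
      split_ifs at hst with h
      exact ⟨u, rfl, congrArg Subtype.val (Sum.inr.inj hst)⟩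
  have hvar : ∀ i, IsTVariableWord (e i '' treeLT b K) (toVWord n a₀ (e i) (f i)) := by
    intro i
    refine ⟨fun s t hst => ?_, fun t ht => ?_⟩
    · obtain ⟨u, hu, hut⟩ := hinr i s t hst
      exact ⟨u, (hr.min i _ u hu).1, hut⟩
    · obtain ⟨u, hu, hut⟩ := ht
      refine ⟨?_, fun s hs => ?_⟩
      · have h1 := hr.var i u hu
        rw [hut] at h1
        have ht2 : (t : List (Fin b)).length < n := t.2
        unfold toVWord
        rw [h1]
        simp [hut, ht2]
      · obtain ⟨v, hv, hvt⟩ := hinr i s t hs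
        rw [← hvt]
        exact (hr.min i _ v hv).2
  have hws : ∀ i, ws (toVWord n a₀ (e i) (f i)) = e i '' treeLT b K := fun i => (hvar i).ws_eq (hsub i)
  refine ⟨fun i => toVWord n a₀ (e i) (f i), fun i => (fun s => fit n (e i s)) '' leaves b K, ?_, ?_⟩
  · refine ⟨fun i => ⟨_, hsub i, (hr.isSkewEmb i).isCompleteSkew hK, hvar i⟩, ?_, ?_, ?_, ?_⟩
    · simp only [hws]
      exact hvec.isVectorComplete hK
    · rintro i _ ⟨s, -, rfl⟩
      exact length_fit n _
    · intro i
      exact (hr.isSkewEmb i).ncard_leaves (hlt i) (fun s _ => length_fit n _) (hfit i)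
    · intro i
      rw [hws]
      exact (hr.isSkewEmb i).isSkew_union (hlt i) (fun s _ => length_fit n _) (hfit i)
  · have key : ∀ p ∈ mixedSpan (fun i => toVWord n a₀ (e i) (f i))
        (fun i : D.D₁ => (fun s => fit n (e i s)) '' leaves b K),
        ∃ (w : Fin d → List (Fin b) → Λ) (P : Fin d → List (Fin b)), (∀ i, (P i).length ≤ K) ∧
          (∀ i, i ∉ D.D₂ → (P i).length = K) ∧
          (∀ i : D.D₂, (P i).length < K ∧ e i (P i) = p.node i ∧ w i (P i) = p.word i (p.node i)) ∧
          c p = c (toMixedWord D hn0 (fun i => apply (f i) (w i)) (fun i => e i (P i))) := by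
      rintro p ⟨hw, hx, ht⟩
      choose α hα using hw
      choose s hs hsx using hx
      have ht' : ∀ i : D.D₂, ∃ u : List (Fin b), u.length < K ∧ e i u = p.node i := by
        intro i
        have := ht i
        rw [hws] at this
        obtain ⟨u, hu, hui⟩ := this
        exact ⟨u, hu, hui⟩
      choose u hu hut using ht'
      let w : Fin d → List (Fin b) → Λ := fun i s =>
        if h : (e i s).length < n then α i ⟨e i s, h⟩ else a₀
      -- The leaf at a coordinate in `D₀` is a dummy, ignored by `toMixedWord`.
      let P : Fin d → List (Fin b) := fun i =>
        if h : i ∈ D.D₂ then u ⟨i, h⟩ else if h : i ∈ D.D₁ then s ⟨i, h⟩ else List.replicate K 0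
      have hP2 : ∀ i : D.D₂, P i = u i := fun i => by simp [P]
      have hP1 : ∀ i : D.D₁, P i = s i := fun i => by
        have : (i : Fin d) ∉ D.D₂ := Finset.disjoint_left.1 D.disjoint₁₂ i.2
        simp [P, this]
      have hPn : ∀ i, i ∉ D.D₂ → (P i).length = K := fun i hi => by
        by_cases h : i ∈ D.D₁
        · rw [hP1 ⟨i, h⟩]; exact hs ⟨i, h⟩
        · simp [P, hi, h]
      have hword : ∀ i (x : treeLT b n), apply (f i) (w i) x = p.word i x := by
        intro i x
        rw [← hα i]
        unfold apply subst toVWord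
        rcases hf : f i x with a | v
        · simp [hf]
        · have := hlt i v (hr.min i _ v hf).1
          simp [hf, w, this]
      refine ⟨w, P, fun i => ?_, hPn, fun i => ⟨?_, ?_, ?_⟩, ?_⟩
      · by_cases h : i ∈ D.D₂
        · rw [hP2 ⟨i, h⟩]; exact (hu ⟨i, h⟩).le
        · exact (hPn i h).le
      · rw [hP2]; exact hu i
      · rw [hP2]; exact hut i
      · rw [← hword, hP2, ← hut, apply, hr.var i _ (hu i)]
        rfl
      · congr 1
        refine MixedWord.ext' (fun i x => (hword i x).symm) (fun i => ?_) (fun i => ?_)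
        · simp only [toMixedWord, hP1]
          exact (hsx i).symm
        · simp only [toMixedWord, hP2, hut]
          have : (p.node i : List (Fin b)).length < n := (p.node i).2
          rw [List.take_of_length_le (by omega)]
    intro p hp q hq hpq
    obtain ⟨w, P, hP, hPK, hP2, hcp⟩ := key p hp
    obtain ⟨w', P', hP', hPK', hP2', hcq⟩ := key q hq
    have hPP : ∀ i : D.D₂, P i = P' i := fun i =>
      (hr.isSkewEmb i).inj (hP2 i).1 (hP2' i).1
        (by rw [(hP2 i).2.1, (hP2' i).2.1, (hpq i).1])
    rw [hcp, hcq]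
    refine hc P P' hP (fun i => ?_) w w' (fun i hi => ?_)
    · by_cases h : i ∈ D.D₂
      · rw [hPP ⟨i, h⟩]
      · rw [hPK i h, hPK' i h]
    · by_cases h : i ∈ D.D₂
      · have h1 := (hP2 ⟨i, h⟩).2.2
        have h2 := (hP2' ⟨i, h⟩).2.2
        rw [h1, h2, (hpq ⟨i, h⟩).2]
      · rw [hPK i h] at hi; omega

theorem mthjBounds_nonempty {d₀ d₁ d₂ ℓ K r : ℕ} (hℓ : 1 ≤ ℓ) (hK : 1 ≤ K) :
    (mthjBounds d₀ d₁ d₂ b ℓ K r).Nonempty := by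
  have : Nonempty (Fin ℓ) := ⟨⟨0, by omega⟩⟩
  obtain ⟨N, hN0, hN⟩ := exists_good_subspace (b := b) (Fin ℓ) (d₀ + d₁ + d₂) K r hK
  refine ⟨N, hN0, fun Λ _ hΛ n hn D _ _ _ c => ?_⟩
  have σ : Fin ℓ ≃ Λ := (Finite.equivFinOfCardEq hΛ).symm
  obtain ⟨f, X, hf, hc⟩ := hN n hn D (fun p => c (mapMixedWord σ p))
  exact ⟨_, X, hf.map σ, hc.map σ⟩

end Good

/-! ### Ramsey's theorem for increasing sequences -/

section Ramsey

/-- The finite Ramsey theorem for increasing sequences of a given length. -/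
theorem exists_homogeneous (κ : Type*) [Finite κ] (d : ℕ) :
    ∀ m : ℕ, ∃ N : ℕ, ∀ A : Finset ℕ, N ≤ A.card → ∀ χ : List ℕ → κ,
      ∃ B ⊆ A, m ≤ B.card ∧ ∃ v, ∀ l : List ℕ, l.Pairwise (· < ·) → l.length = d →
        (∀ x ∈ l, x ∈ B) → χ l = v := by
  classical
  have := Fintype.ofFinite κ
  induction d with
  | zero =>
    intro m
    refine ⟨m, fun A hA χ => ⟨A, subset_rfl, hA, χ [], fun l _ hl _ => ?_⟩⟩
    rw [List.length_eq_zero_iff.1 hl]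
  | succ d ih =>
    -- Repeatedly split off the minimum `x` and use the induction hypothesis on the rest for the
    -- coloring `l ↦ χ (x :: l)`. In the resulting set the color of a sequence depends only on its
    -- first term.
    have step : ∀ t : ℕ, ∃ N : ℕ, ∀ A : Finset ℕ, N ≤ A.card → ∀ χ : List ℕ → κ,
        ∃ B ⊆ A, t ≤ B.card ∧ ∃ φ : ℕ → κ, ∀ x ∈ B, ∀ l : List ℕ, (x :: l).Pairwise (· < ·) →
          l.length = d → (∀ y ∈ l, y ∈ B) → χ (x :: l) = φ x := by
      intro t
      induction t with
      | zero =>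
        exact ⟨0, fun A _ χ => ⟨∅, by simp, by simp, fun x => χ [x], by simp⟩⟩
      | succ t iht =>
        obtain ⟨N₁, h₁⟩ := iht
        obtain ⟨N₂, h₂⟩ := ih N₁
        refine ⟨N₂ + 1, fun A hA χ => ?_⟩
        have hne : A.Nonempty := Finset.card_pos.1 (by omega)
        obtain ⟨B₂, hB₂, hc₂, v, hv⟩ := h₂ (A.erase (A.min' hne))
          (by rw [Finset.card_erase_of_mem (A.min'_mem hne)]; omega) (fun l => χ (A.min' hne :: l))
        obtain ⟨B, hB, hc, φ, hφ⟩ := h₁ B₂ hc₂ χ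
        have hx : ∀ y ∈ B, A.min' hne < y := fun y hy =>
          A.min'_lt_of_mem_erase_min' hne (hB₂ (hB hy))
        have hnot : A.min' hne ∉ B := fun h => lt_irrefl _ (hx _ h)
        refine ⟨insert (A.min' hne) B, ?_, ?_, Function.update φ (A.min' hne) v, ?_⟩
        · intro y hy
          rcases Finset.mem_insert.1 hy with rfl | hy
          · exact A.min'_mem hne
          · exact Finset.mem_of_mem_erase (hB₂ (hB hy))
        · rw [Finset.card_insert_of_notMem hnot]; omega
        · intro y hy l hl hld hlB
          have hl' := List.pairwise_cons.1 hl
          have hyle : A.min' hne ≤ y := by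
            rcases Finset.mem_insert.1 hy with rfl | hy
            · exact le_rfl
            · exact (hx y hy).le
          have hlB' : ∀ z ∈ l, z ∈ B := fun z hz => by
            rcases Finset.mem_insert.1 (hlB z hz) with h | h
            · have := hl'.1 z hz; omega
            · exact h
          rcases Finset.mem_insert.1 hy with rfl | hy
          · rw [Function.update_self]
            exact hv l hl'.2 hld (fun z hz => hB (hlB' z hz))
          · rw [Function.update_of_ne (by rintro rfl; exact hnot hy)]
            exact hφ y hy l hl hld hlB'
    intro m
    -- The factor `Fintype.card κ` pays for the pigeonhole on the color `φ x` of the first term.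
    obtain ⟨N, hN⟩ := step (Fintype.card κ * m)
    refine ⟨N, fun A hA χ => ?_⟩
    obtain ⟨B, hB, hc, φ, hφ⟩ := hN A hA χ
    have : Nonempty κ := ⟨χ []⟩
    obtain ⟨v, -, hv⟩ := Finset.exists_le_card_fiber_of_mul_le_card_of_maps_to
      (s := B) (t := Finset.univ) (f := φ) (n := m) (fun _ _ => Finset.mem_univ _)
      Finset.univ_nonempty (by simpa using hc)
    refine ⟨B.filter (fun x => φ x = v), (Finset.filter_subset _ _).trans hB, hv, v, ?_⟩
    intro l hl hld hlB
    rcases l with _ | ⟨x, l⟩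
    · simp at hld
    · have hx := Finset.mem_filter.1 (hlB x (by simp))
      rw [hφ x hx.1 l hl (by simpa using hld)
        (fun y hy => (Finset.mem_filter.1 (hlB y (by simp [hy]))).1), hx.2]

end Ramsey

/-! ### Embeddings with prescribed levels -/

section Spread
variable {b : ℕ} [NeZero b]

/-- The embedding that sends the nodes of level `m` to level `lev m`, on reversed sequences. -/
def spreadRev (lev : ℕ → ℕ) : List (Fin b) → List (Fin b)
  | [] => List.replicate (lev 0) 0
  | a :: s => fit (lev (s.length + 1)) (spreadRev lev s ++ [a])

/-- The embedding that sends the nodes of level `m` to level `lev m`. -/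
def spread (lev : ℕ → ℕ) (s : List (Fin b)) : List (Fin b) := spreadRev lev s.reverse

@[simp] theorem length_spread (lev : ℕ → ℕ) (s : List (Fin b)) :
    (spread lev s).length = lev s.length := by
  rcases List.eq_nil_or_concat s with rfl | ⟨s, a, rfl⟩
  · simp [spread, spreadRev]
  · simp [spread, spreadRev]

theorem spread_ext {lev : ℕ → ℕ} {s : List (Fin b)} (a : Fin b) (h : lev s.length < lev (s.length + 1)) :
    spread lev s ++ [a] <+: spread lev (s ++ [a]) := by
  have : spread lev (s ++ [a]) = fit (lev (s.length + 1)) (spread lev s ++ [a]) := by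
    simp [spread, spreadRev]
  rw [this]
  exact prefix_fit (by simp; omega)

theorem isSkewEmb_spread {lev : ℕ → ℕ} {k : ℕ} (h : ∀ m m', m < m' → m' < k → lev m < lev m') :
    IsSkewEmb k (spread (b := b) lev) where
  ext s a hs := spread_ext a (h _ _ (by omega) hs)
  lex s s' hl _ _ := by simp [hl]
  lt s s' hl hs := by simpa using h _ _ hl hs

end Spread

/-! ### Vector `1`-complete subtrees and the number `CT` -/

section Singletons
variable {b : ℕ}

theorem exists_maximal_chain {S C : Set (List (Fin b))} (hS : S.Finite) (hC : C ⊆ S)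
    (hchain : IsChain (· <+: ·) C) :
    ∃ C', C ⊆ C' ∧
      Maximal (fun C' : Set (List (Fin b)) => C' ⊆ S ∧ IsChain (· <+: ·) C') C' := by
  have hfin : {C' : Set (List (Fin b)) | C' ⊆ S ∧ IsChain (· <+: ·) C'}.Finite :=
    hS.finite_subsets.subset fun C' h => h.1
  obtain ⟨C', h1, h2⟩ := hfin.exists_le_maximal (a := C) ⟨hC, hchain⟩
  exact ⟨C', h1, h2⟩

theorem isSkewEmb_const (t : List (Fin b)) : IsSkewEmb 1 (fun _ => t) where
  ext s a hs := by omega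
  lex _ _ _ _ _ := le_rfl
  lt s s' h h' := by omega

theorem image_treeLT_one (φ : List (Fin b) → List (Fin b)) : φ '' treeLT b 1 = {φ []} := by
  have : treeLT b 1 = {[]} := by
    ext s
    simp [treeLT]
  rw [this, Set.image_singleton]

/-- In a proper skew subtree the node `s_S` has an immediate successor, because `i_S + 1 > 0`; the
two lie in a maximal chain with more than one element. -/
theorem IsCompleteSkew.eq_singleton {S : Set (List (Fin b))} (h : IsCompleteSkew 1 S) (hS : S.Finite) :
    ∃ t, S = {t} := by
  rcases h.skew with h1 | h1
  · exact h1
  · exfalso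
    obtain ⟨i, s, hs, -, -, hcard, -⟩ := h1.branching
    have hne : (imSucc S s).Nonempty := by
      rw [Set.nonempty_iff_ne_empty]
      intro he
      rw [he] at hcard
      simp at hcard
    obtain ⟨t, ht, hst, -⟩ := hne
    obtain ⟨C, hC, hmax⟩ := exists_maximal_chain (C := {s, t}) hS
      (by rintro x (rfl | rfl) <;> assumption)
      (by
        rintro x (rfl | rfl) y (rfl | rfl) hxy
        · exact absurd rfl hxy
        · exact Or.inl hst.1
        · exact Or.inr hst.1
        · exact absurd rfl hxy)
    obtain ⟨u, hu⟩ := Set.ncard_eq_one.1 (h.chain C hmax)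
    have e1 : s ∈ C := hC (by simp)
    have e2 : t ∈ C := hC (by simp)
    rw [hu] at e1 e2
    exact hst.2 (e1.trans e2.symm)

theorem height_singleton (t : List (Fin b)) : height {t} t = 0 := by
  unfold height
  have : {u | u ∈ ({t} : Set (List (Fin b))) ∧ StrictPrefix u t} = ∅ := by
    ext u
    simp only [Set.mem_singleton_iff, Set.mem_ofPred_eq, Set.mem_empty_iff_false, iff_false, not_and]
    rintro rfl h
    exact h.2 rfl
  rw [this, Set.ncard_empty]

theorem isVectorComplete_singleton [NeZero b] {d : ℕ} {t : Fin d → List (Fin b)} :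
    IsVectorComplete 1 (fun i => ({t i} : Set (List (Fin b)))) ↔
      ∀ i j, i < j → (t i).length ≤ (t j).length := by
  constructor
  · intro h i j hij
    exact h.same_level i j hij 0 (by omega) _ ⟨rfl, height_singleton _⟩ _ ⟨rfl, height_singleton _⟩
  · intro h
    refine ⟨fun i => ?_, ?_, fun m hm => by omega⟩
    · have := (isSkewEmb_const (t i)).isCompleteSkew le_rfl
      rwa [image_treeLT_one] at this
    · rintro i j hij m - s ⟨rfl, -⟩ s' ⟨rfl, -⟩
      exact h i j hij

theorem treeLT_finite (b n : ℕ) : (treeLT b n).Finite := List.finite_length_lt (Fin b) n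

theorem exists_nodes_of_mem_CTSet_one {d n : ℕ} {S R : Fin d → Set (List (Fin b))}
    (hS : ∀ i, S i ⊆ treeLT b n) (hR : R ∈ CTSet 1 S) :
    ∃ t : Fin d → List (Fin b), (∀ i, t i ∈ S i) ∧ R = fun i => {t i} := by
  have : ∀ i, ∃ t, R i = {t} := fun i => (hR.2.complete i).eq_singleton
    ((treeLT_finite b n).subset ((hR.1 i).trans (hS i)))
  choose t ht using this
  exact ⟨t, fun i => hR.1 i (by rw [ht i]; rfl), funext ht⟩

end Singletons

/-- Over the one-letter alphabet the color of a tuple of nodes depends only on their levels after a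
reduction to `K` levels. Ramsey's theorem gives `k * d` homogeneous levels, which are dealt out
cyclically to the `d` components. -/
theorem ctBounds_nonempty {b : ℕ} [NeZero b] {k d r : ℕ} (hk : 1 ≤ k) (hr : 1 ≤ r) :
    (ctBounds 1 k b d r).Nonempty := by
  classical
  obtain ⟨K, hK⟩ := exists_homogeneous (Fin r) d (k * d)
  obtain ⟨N, hN⟩ := exists_level_reduction (b := b) (d := d) (Λ := Unit) () K (Fin r)
  refine ⟨N + 1, by omega, fun n hn c => ?_⟩
  let col : (Fin d → List (Fin b)) → Fin r := fun p =>
    if h : (fun i => ({p i} : Set (List (Fin b)))) ∈ CTSet 1 (vectorTree b n d) then c ⟨_, h⟩ else ⟨0, hr⟩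
  obtain ⟨e, f, hred, -, hc⟩ := hN (fun _ p => col p)
  obtain ⟨B, hB, hBc, v, hv⟩ := hK (Finset.range K) (by simp)
    (fun l => col (fun i => e i (List.replicate (l.getD i 0) 0)))
  let g := B.orderEmbOfCardLe hBc
  have hgK : ∀ x, g x < K := fun x => by
    have := hB (B.orderEmbOfCardLe_mem hBc x)
    simpa using this
  have hidx : ∀ {m : ℕ} (i : Fin d), m < k → m * d + i < k * d := fun {m} i hm => by
    have h1 := Nat.mul_le_mul_right d (Nat.succ_le_of_lt hm)
    rw [Nat.succ_mul] at h1
    have := i.2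
    omega
  -- Level `m` of component `i` goes to element number `m * d + i` of the homogeneous set, so the
  -- order is by `m` first and by `i` second, as vector completeness requires.
  let lev : Fin d → ℕ → ℕ := fun i m => if h : m < k then g ⟨m * d + i, hidx i h⟩ else 0
  have hlev : ∀ i m (h : m < k), lev i m = g ⟨m * d + i, hidx i h⟩ := fun i m h => by simp [lev, h]
  have hlevlt : ∀ (i j : Fin d) m m', m < k → m' < k → m * d + i < m' * d + j → lev i m < lev j m' := by
    intro i j m m' hm hm' h
    rw [hlev i m hm, hlev j m' hm']
    exact g.strictMono h
  have hlev' : ∀ (i j : Fin d) m m', m < m' → m' < k → lev i m < lev j m' := by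
    intro i j m m' h hm'
    refine hlevlt i j m m' (by omega) hm' ?_
    have h1 := Nat.mul_le_mul_right d (Nat.succ_le_of_lt h)
    rw [Nat.succ_mul] at h1
    have := i.2
    omega
  have hlevK : ∀ i m, m < k → lev i m < K := fun i m h => by rw [hlev i m h]; exact hgK _
  have hskew : ∀ i, IsSkewEmb k (e i ∘ spread (lev i)) := fun i =>
    (hred.isSkewEmb i).comp (isSkewEmb_spread (hlev' i i)) (fun s hs => by simpa using hlevK i _ hs)
  have hvec : IsVectorEmb k (fun i => e i ∘ spread (lev i)) := by
    refine ⟨hskew, fun i j hij s s' hl hs => (hred.next i j _ _ ?_ ?_).le,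
      fun i j s s' hl hs => hred.next i j _ _ ?_ ?_⟩
    · simp only [length_spread]
      exact hlevlt i j _ _ hs (hl ▸ hs) (by rw [hl]; exact Nat.add_lt_add_left hij _)
    · simpa using hlevK j _ (hl ▸ hs)
    · simpa using hlev' i j _ _ hl hs
    · simpa using hlevK j _ hs
  have hsub : ∀ i, (e i ∘ spread (lev i)) '' treeLT b k ⊆ treeLT b n := by
    rintro i _ ⟨s, hs, rfl⟩
    have h1 : s.length < k := hs
    have := hred.length_lt i (s := spread (lev i) s) (by simpa using hlevK i _ h1)
    exact this.trans (by omega)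
  refine ⟨_, ⟨hsub, hvec.isVectorComplete hk⟩, v, ?_⟩
  rintro ⟨R, hRn⟩ hR
  obtain ⟨t, ht, rfl⟩ := exists_nodes_of_mem_CTSet_one hsub hR
  choose s hs hst using ht
  have hs' : ∀ i, (s i).length < k := hs
  have hle := isVectorComplete_singleton.1 hR.2
  -- Vector `1`-completeness only gives weak inequalities of lengths. Different components use
  -- levels with different residues modulo `d`, so equality cannot occur and the levels form a
  -- strictly increasing sequence.
  have hlt : ∀ i j, i < j → lev i (s i).length < lev j (s j).length := by
    intro i j hij
    have h1 := hle i j hij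
    rcases lt_trichotomy (lev i (s i).length) (lev j (s j).length) with h | h | h
    · exact h
    · exfalso
      rw [hlev i _ (hs' i), hlev j _ (hs' j)] at h
      have h2 := congrArg Fin.val (g.injective h)
      simp only at h2
      have h3 : ((s i).length * d + i) % d = ((s j).length * d + j) % d := by rw [h2]
      rw [block_mod i.2, block_mod j.2] at h3
      omega
    · exfalso
      have := hred.next j i (spread (lev j) (s j)) (spread (lev i) (s i)) (by simpa using h)
        (by simpa using hlevK i _ (hs' i))
      rw [← hst i, ← hst j] at h1
      simp only [Function.comp] at h1
      omega
  have hcR : c ⟨fun i => {t i}, hRn⟩ = col t := by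
    simp only [col]
    rw [dif_pos hRn]
  rw [hcR, ← hv (List.ofFn fun i => lev i (s i).length) (by
    rw [List.pairwise_ofFn]
    exact fun i j hij => hlt i j hij) (by simp) (by
    intro x hx
    rw [List.mem_ofFn] at hx
    obtain ⟨i, rfl⟩ := hx
    rw [hlev i _ (hs' i)]
    exact B.orderEmbOfCardLe_mem hBc _)]
  have := hc (fun i => spread (lev i) (s i)) (fun i => List.replicate (lev i (s i).length) 0)
    (fun i => by simpa using (hlevK i _ (hs' i)).le) (fun i => by simp) (fun _ _ => ()) (fun _ _ => ())
    (fun _ _ => rfl)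
  have e1 : t = fun i => e i (spread (lev i) (s i)) := funext fun i => (hst i).symm
  rw [e1, this]
  congr 1
  funext i
  simp

/-! ### Complete skew subtrees are images of embeddings -/

section Converse
variable {b K : ℕ} {T : Set (List (Fin b))}

theorem height_imSucc (hT : T.Finite) {s t : List (Fin b)} (hs : s ∈ T) (ht : t ∈ imSucc T s) :
    height T t = height T s + 1 := by
  have : {u | u ∈ T ∧ StrictPrefix u t} = insert s {u | u ∈ T ∧ StrictPrefix u s} := by
    ext u
    constructor
    · rintro ⟨hu, hut⟩
      by_cases he : u = s
      · exact Or.inl he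
      · right
        rcases List.prefix_or_prefix_of_prefix hut.1 ht.2.1.1 with h | h
        · exact ⟨hu, h, he⟩
        · exact absurd ⟨u, hu, ⟨h, fun h' => he h'.symm⟩, hut⟩ ht.2.2
    · rintro (rfl | ⟨hu, hus⟩)
      · exact ⟨hs, ht.2.1⟩
      · exact ⟨hu, hus.trans_prefix ht.2.1.1⟩
  unfold height
  rw [this, Set.ncard_insert_of_notMem (fun h => h.2.2 rfl) (hT.subset fun u h => h.1)]

theorem IsCompleteSkew.height_lt (h : IsCompleteSkew K T) (hT : T.Finite) {t : List (Fin b)} (ht : t ∈ T) :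
    height T t + 1 ≤ K ∧ ((¬ ∃ u ∈ T, StrictPrefix t u) → height T t + 1 = K) := by
  have hCt : {u | u ∈ T ∧ u <+: t}.ncard = height T t + 1 := by
    have : {u | u ∈ T ∧ u <+: t} = insert t {u | u ∈ T ∧ StrictPrefix u t} := by
      ext u
      constructor
      · rintro ⟨hu, hut⟩
        by_cases he : u = t
        · exact Or.inl he
        · exact Or.inr ⟨hu, hut, he⟩
      · rintro (rfl | ⟨hu, hus⟩)
        · exact ⟨ht, List.prefix_rfl⟩
        · exact ⟨hu, hus.1⟩
    rw [this, Set.ncard_insert_of_notMem (fun h => h.2.2 rfl) (hT.subset fun u h => h.1)]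
    rfl
  obtain ⟨C, hC, hmax⟩ := exists_maximal_chain (C := {u | u ∈ T ∧ u <+: t}) hT (fun u h => h.1)
    (fun u hu v hv _ => List.prefix_or_prefix_of_prefix hu.2 hv.2)
  have hK := h.chain C hmax
  constructor
  · rw [← hCt, ← hK]
    exact Set.ncard_le_ncard hC (hT.subset hmax.prop.1)
  · intro hm
    rw [← hCt, ← hK]
    congr 1
    refine hC.antisymm fun u hu => ⟨hmax.prop.1 hu, ?_⟩
    by_cases he : u = t
    · rw [he]
    rcases hmax.prop.2 hu (hC ⟨ht, List.prefix_rfl⟩) he with h1 | h1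
    · exact h1
    · exact absurd ⟨u, hmax.prop.1 hu, h1, fun h' => he h'.symm⟩ hm

/-- Having `b` successors rules out the nodes after `s₀`, and at `s₀` it forces `i₀ = b - 1`, so no
direction is missing. -/
theorem IsCompleteSkew.existsUnique_imSucc [NeZero b] (h : IsCompleteSkew K T) {s : List (Fin b)}
    (hs : s ∈ T) (hne : ∃ t ∈ T, StrictPrefix s t) (i : Fin b) :
    ∃! t, t ∈ imSucc T s ∧ s ++ [i] <+: t := by
  have hb : b ≠ 0 := NeZero.ne b
  have hcard := h.succ s hs hne
  rcases h.skew with ⟨u, rfl⟩ | hp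
  · obtain ⟨t, ht, hst⟩ := hne
    exact absurd (hs.trans ht.symm) hst.2
  · obtain ⟨i₀, s₀, hs₀, h1, h2, h3, h4⟩ := hp.branching
    by_cases he : s = s₀
    · subst he
      refine h4 i ?_
      rw [Fin.le_def]
      have := i.2
      omega
    · rcases shortLE_total s s₀ with h5 | h5
      · exact h1 s hs h5 he i
      · rw [h2 s hs h5 he, Set.ncard_empty] at hcard
        omega

theorem IsSkew.exists_root {S : Set (List (Fin b))} (h : IsSkew S) : ∃ ρ ∈ S, ∀ s ∈ S, ρ <+: s := by
  rcases h with ⟨s, rfl⟩ | h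
  · exact ⟨s, rfl, by rintro _ rfl; exact List.prefix_rfl⟩
  · exact h.root

/-- The node with address `s` (read backwards), given the root and the successor function. -/
def nodeRev (ρ : List (Fin b)) (σ : List (Fin b) → Fin b → List (Fin b)) : List (Fin b) → List (Fin b)
  | [] => ρ
  | a :: s => σ (nodeRev ρ σ s) a

theorem exists_longest_prefix {S : Set (List (Fin b))} {ρ t : List (Fin b)} (hρ : ρ ∈ S)
    (hρt : StrictPrefix ρ t) : ∃ s ∈ S, StrictPrefix s t ∧
      ∀ u ∈ S, StrictPrefix u t → u.length ≤ s.length := by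
  classical
  let P : ℕ → Prop := fun m => ∃ s ∈ S, StrictPrefix s t ∧ s.length = m
  have h0 : P ρ.length := ⟨ρ, hρ, hρt, rfl⟩
  obtain ⟨s, hs, hst, hl⟩ := Nat.findGreatest_spec (P := P) (n := t.length) hρt.length_lt.le h0
  refine ⟨s, hs, hst, fun u hu hut => ?_⟩
  rw [hl]
  exact Nat.le_findGreatest hut.length_lt.le ⟨u, hu, hut, rfl⟩

/-- A complete skew subtree is the image of an embedding. -/
theorem IsCompleteSkew.exists_emb [NeZero b] (h : IsCompleteSkew K T) (hT : T.Finite) :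
    ∃ φ, IsSkewEmb K φ ∧ φ '' treeLT b K = T := by
  obtain ⟨ρ, hρ, hroot⟩ := h.skew.exists_root
  have hex : ∀ (s : List (Fin b)) (i : Fin b), ∃ t, s ∈ T → (∃ t ∈ T, StrictPrefix s t) →
      t ∈ imSucc T s ∧ s ++ [i] <+: t := by
    intro s i
    by_cases hs : s ∈ T ∧ ∃ t ∈ T, StrictPrefix s t
    · obtain ⟨t, ht, -⟩ := h.existsUnique_imSucc hs.1 hs.2 i
      exact ⟨t, fun _ _ => ht⟩
    · exact ⟨[], fun h1 h2 => absurd ⟨h1, h2⟩ hs⟩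
  choose σ hσ using hex
  let φ : List (Fin b) → List (Fin b) := fun s => nodeRev ρ σ s.reverse
  have hφ0 : φ [] = ρ := rfl
  have hφs : ∀ s a, φ (s ++ [a]) = σ (φ s) a := fun s a => by simp [φ, nodeRev]
  have hρ0 : height T ρ = 0 := by
    unfold height
    have : {t | t ∈ T ∧ StrictPrefix t ρ} = ∅ := by
      ext u
      simp only [Set.mem_ofPred_eq, Set.mem_empty_iff_false, iff_false, not_and]
      intro hu hur
      have := (hroot u hu).length_le
      have := hur.length_lt
      omega
    rw [this, Set.ncard_empty]
  have hnm : ∀ s ∈ T, height T s + 1 < K → ∃ t ∈ T, StrictPrefix s t := by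
    intro s hs hsK
    by_contra hc
    have := (h.height_lt hT hs).2 hc
    omega
  have hmem : ∀ s, s.length < K → φ s ∈ T ∧ height T (φ s) = s.length := by
    intro s
    induction s using List.reverseRecOn with
    | nil => exact fun _ => ⟨hρ, hρ0⟩
    | append_singleton s a ih =>
      intro hs
      simp only [List.length_append, List.length_cons, List.length_nil] at hs
      obtain ⟨h1, h2⟩ := ih (by omega)
      have h3 := hσ (φ s) a h1 (hnm _ h1 (by omega))
      rw [hφs]
      refine ⟨h3.1.1, ?_⟩
      rw [height_imSucc hT h1 h3.1, h2]
      simp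
  have hext : ∀ s a, s.length + 1 < K → φ s ++ [a] <+: φ (s ++ [a]) := by
    intro s a hs
    obtain ⟨h1, h2⟩ := hmem s (by omega)
    rw [hφs]
    exact (hσ (φ s) a h1 (hnm _ h1 (by omega))).2
  have hlex : ∀ s s', s.length < K → s'.length < K → LexLE s s' → LexLE (φ s) (φ s') := by
    have hcp : ∀ {p s : List (Fin b)} {x : Fin b}, p ++ [x] <+: s → s.length < K →
        φ p ++ [x] <+: φ s := fun {p s x} hps hs =>
      concat_prefix_of_ext (K := K - 1) (fun s a hs => hext s a (by omega)) hps (by omega)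
    intro s s' hs hs' hss
    rcases hss with hss | ⟨p, x, y, hxy, h1, h2⟩
    · by_cases he : s = s'
      · subst he; exact Or.inl List.prefix_rfl
      · obtain ⟨a, ha⟩ := exists_concat_prefix hss he
        exact Or.inl (prefix_of_concat_prefix (hcp ha hs'))
    · exact Or.inr ⟨φ p, x, y, hxy, hcp h1 hs, hcp h2 hs'⟩
  refine ⟨φ, ⟨hext, ?_, ?_⟩, ?_⟩
  · intro s s' hl hs hss
    obtain ⟨h1, h2⟩ := hmem s hs
    obtain ⟨h3, h4⟩ := hmem s' (hl ▸ hs)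
    rcases h.skew with ⟨u, rfl⟩ | hp
    · rw [h1, h3]
    · exact hp.same_height _ h1 _ h3 (by omega) (hlex s s' hs (hl ▸ hs) hss)
  · intro s s' hl hs
    obtain ⟨h1, h2⟩ := hmem s (by omega)
    obtain ⟨h3, h4⟩ := hmem s' hs
    rcases h.skew with ⟨u, rfl⟩ | hp
    · rw [h1] at h2; rw [h3] at h4; omega
    · exact hp.lt_height _ h1 _ h3 (by omega)
  · apply Set.Subset.antisymm
    · rintro _ ⟨s, hs, rfl⟩
      exact (hmem s hs).1
    -- Induction on length: the longest proper predecessor of `t` in `T` is some `φ s`, and `t` is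
    -- its unique immediate successor in one direction `a`, hence `φ (s ++ [a])`.
    · have key : ∀ m, ∀ t ∈ T, t.length = m → ∃ s, s.length < K ∧ φ s = t := by
        intro m
        induction m using Nat.strong_induction_on with
        | _ m ih =>
          intro t ht htm
          by_cases he : ρ = t
          · exact ⟨[], by have := (h.height_lt hT hρ).1; simp; omega, he⟩
          · obtain ⟨s', hs', hst, hmax⟩ := exists_longest_prefix hρ ⟨hroot t ht, he⟩
            have hst' := hst.length_lt
            obtain ⟨s, hs, rfl⟩ := ih s'.length (by omega) s' hs' rfl
            obtain ⟨a, ha⟩ := exists_concat_prefix hst.1 hst.2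
            have him : t ∈ imSucc T (φ s) := by
              refine ⟨ht, hst, ?_⟩
              rintro ⟨u, hu, h1, h2⟩
              have := hmax u hu h2
              have := h1.length_lt
              omega
            have hh := height_imSucc hT hs' him
            have hlt := (h.height_lt hT ht).1
            have hhs := (hmem s hs).2
            refine ⟨s ++ [a], by simp; omega, ?_⟩
            rw [hφs]
            exact (h.existsUnique_imSucc hs' ⟨t, ht, hst⟩ a).unique
              (hσ (φ s) a hs' ⟨t, ht, hst⟩) ⟨him, ha⟩
      intro t ht
      obtain ⟨s, hs, rfl⟩ := key t.length t ht rfl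
      exact ⟨s, hs, rfl⟩

/-- The leaves of a skew subtree that extends a complete one can be indexed by `b^K`. -/
theorem IsSkewEmb.exists_leaves [NeZero b] {n : ℕ} {φ : List (Fin b) → List (Fin b)} {X : Set (List (Fin b))}
    (h : IsSkewEmb K φ) (hK : 1 ≤ K) (hφ : ∀ s, s.length < K → (φ s).length < n) (hX : X ⊆ leaves b n)
    (hcard : X.ncard = b ^ K) (hskew : IsSkew (φ '' treeLT b K ∪ X)) :
    ∃ x : List (Fin b) → List (Fin b), (∀ s, s.length = K → x s ∈ X) ∧
      ∀ s a, s.length + 1 = K → φ s ++ [a] <+: x (s ++ [a]) := by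
  classical
  have hb : 0 < b := Nat.pos_of_ne_zero (NeZero.ne b)
  have hXl : ∀ x ∈ X, x.length = n := fun x hx => hX hx
  have hXne : X.Nonempty := by
    rw [Set.nonempty_iff_ne_empty]
    rintro rfl
    rw [Set.ncard_empty] at hcard
    exact (pow_pos hb K).ne hcard
  generalize hS : φ '' treeLT b K ∪ X = S at hskew
  have hTS : ∀ s, s.length < K → φ s ∈ S := fun s hs => hS ▸ Or.inl ⟨s, hs, rfl⟩
  have hXS : ∀ x ∈ X, x ∈ S := fun x hx => hS ▸ Or.inr hx
  have hnil : φ [] ∈ S := hTS [] (by simp; omega)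
  have hproper : IsProperSkew S := by
    rcases hskew with ⟨u, hu⟩ | hp
    · obtain ⟨x, hx⟩ := hXne
      have h1 := hXS x hx
      rw [hu] at hnil h1
      have h2 := hφ [] (by simp; omega)
      rw [hnil.trans h1.symm, hXl x hx] at h2
      omega
    · exact hp
  obtain ⟨ρ, hρ, hroot⟩ := hproper.root
  have hSm : ∀ u ∈ S, u.length < n → ∃ s, s.length < K ∧ φ s = u := by
    intro u hu hul
    rw [← hS] at hu
    rcases hu with ⟨s, hs, rfl⟩ | hu
    · exact ⟨s, hs, rfl⟩
    · rw [hXl u hu] at hul; omega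
  obtain ⟨i₀, s₀, -, hbef, haft, hc₀, hun₀⟩ := hproper.branching
  have hfin : (imSucc S s₀).Finite := Set.finite_of_ncard_ne_zero (by omega)
  have hsucc : ∀ s a, s.length + 1 < K → φ (s ++ [a]) ∈ imSucc S (φ s) := by
    intro s a hs
    have hal : (s ++ [a]).length < K := by simpa using hs
    have h0 := h.ext s a hs
    refine ⟨hTS _ hal, strictPrefix_of_concat h0, ?_⟩
    rintro ⟨u, hu, h1, h2⟩
    have h3 := h2.length_lt
    have h4 := hφ _ hal
    obtain ⟨v, hv, rfl⟩ := hSm u hu (by omega)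
    have h5 := ((h.strictPrefix_iff (by omega) hv).1 h1).length_lt
    have h6 := ((h.strictPrefix_iff hv hal).1 h2).length_lt
    simp at h6
    omega
  -- The longest proper predecessor of `x` is some `φ s`, and it has to be a top node: any lower one
  -- already has its `b` successors in the image of `φ`, leaving no room for `x`.
  have hcode : ∀ x ∈ X, ∃ s a, s.length + 1 = K ∧ φ s ++ [a] <+: x ∧ x ∈ imSucc S (φ s) := by
    intro x hx
    have hρx : StrictPrefix ρ x := by
      refine ⟨hroot x (hXS x hx), ?_⟩
      rintro rfl
      have h1 := (hroot _ hnil).length_le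
      have h2 := hφ [] (by simp; omega)
      rw [hXl _ hx] at h1
      omega
    obtain ⟨t, ht, htx, hmax⟩ := exists_longest_prefix hρ hρx
    have htl := htx.length_lt
    rw [hXl x hx] at htl
    obtain ⟨s, hs, rfl⟩ := hSm t ht htl
    obtain ⟨a, ha⟩ := exists_concat_prefix htx.1 htx.2
    have him : x ∈ imSucc S (φ s) := by
      refine ⟨hXS x hx, htx, ?_⟩
      rintro ⟨u, hu, h1, h2⟩
      have := hmax u hu h2
      have := h1.length_lt
      omega
    refine ⟨s, a, ?_, ha, him⟩
    by_contra hne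
    have hs1 : s.length + 1 < K := by omega
    have hneq : ∀ c, φ (s ++ [c]) ≠ x := by
      rintro c rfl
      have h1 := hφ (s ++ [c]) (by simpa using hs1)
      rw [hXl _ hx] at h1
      omega
    by_cases he : φ s = s₀
    · have hsub : insert x (Set.range fun c => φ (s ++ [c])) ⊆ imSucc S s₀ := by
        rw [← he]
        rintro u (rfl | ⟨c, rfl⟩)
        · exact him
        · exact hsucc s c hs1
      have h1 := Set.ncard_le_ncard hsub hfin
      rw [Set.ncard_insert_of_notMem (by rintro ⟨c, hc⟩; exact hneq c hc) (Set.finite_range _),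
        ← Set.image_univ, Set.ncard_image_of_injective, Set.ncard_univ, Nat.card_fin, hc₀] at h1
      · have := i₀.2; omega
      · intro c c' hcc
        have := h.inj (by simpa using hs1) (by simpa using hs1) hcc
        simpa using this
    · rcases shortLE_total (φ s) s₀ with h5 | h5
      · exact hneq a ((hbef _ ht h5 he a).unique ⟨hsucc s a hs1, h.ext s a hs1⟩ ⟨him, ha⟩)
      · rw [haft _ ht h5 he] at him
        exact him
  have huniq : ∀ s a, s.length < K → ∀ x ∈ imSucc S (φ s), ∀ y ∈ imSucc S (φ s),
      φ s ++ [a] <+: x → φ s ++ [a] <+: y → x = y := by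
    intro s a hs x hx y hy hax hay
    by_cases he : φ s = s₀
    · rw [he] at hx hy hax hay
      by_cases ha : a ≤ i₀
      · exact (hun₀ a ha).unique ⟨hx, hax⟩ ⟨hy, hay⟩
      -- The `i₀ + 1` successors of `s₀` in the directions up to `i₀` are all its successors, so
      -- none lies in direction `a`.
      · exfalso
        choose! τ hτ using fun i hi => (hun₀ i hi).exists
        have hsub : insert x (τ '' Set.Iic i₀) ⊆ imSucc S s₀ := by
          rintro u (rfl | ⟨i, hi, rfl⟩)
          · exact hx
          · exact (hτ i hi).1
        have h1 := Set.ncard_le_ncard hsub hfin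
        rw [Set.ncard_insert_of_notMem _ ((Set.toFinite _).image _), Set.InjOn.ncard_image, hc₀] at h1
        · have h2 : (Set.Iic i₀).ncard = (i₀ : ℕ) + 1 := by
            rw [Set.ncard_eq_toFinset_card', Set.toFinset_Iic, Fin.card_Iic]
          omega
        · intro i hi j hj hij
          have h3 := (hτ i hi).2
          rw [hij] at h3
          exact eq_of_concat_prefix h3 (hτ j hj).2
        · rintro ⟨i, hi, rfl⟩
          rw [eq_of_concat_prefix hax (hτ i hi).2] at ha
          exact ha hi
    · rcases shortLE_total (φ s) s₀ with h5 | h5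
      · exact (hbef _ (hTS s hs) h5 he a).unique ⟨hx, hax⟩ ⟨hy, hay⟩
      · rw [haft _ (hTS s hs) h5 he] at hx
        exact absurd hx (Set.notMem_empty _)
  choose! cs ca hlen hpre him using hcode
  let code : List (Fin b) → List (Fin b) := fun x => cs x ++ [ca x]
  have hinj : Set.InjOn code X := by
    intro x hx y hy hxy
    have h1 : cs x = cs y ∧ ca x = ca y := by
      have := List.append_inj hxy (by have := hlen x hx; have := hlen y hy; omega)
      exact ⟨this.1, by simpa using this.2⟩
    refine huniq (cs x) (ca x) (by have := hlen x hx; omega) x (him x hx) y ?_ (hpre x hx) ?_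
    · rw [h1.1]; exact him y hy
    · rw [h1.1, h1.2]; exact hpre y hy
  -- The addresses are pairwise different and there are `b ^ K` of them, so each sequence of length
  -- `K` is the address of a leaf.
  have hsurj : code '' X = leaves b K := by
    refine Set.eq_of_subset_of_ncard_le ?_ ?_ (List.finite_length_eq (Fin b) K)
    · rintro _ ⟨x, hx, rfl⟩
      simpa [code, leaves] using hlen x hx
    · rw [hinj.ncard_image, hcard, TreeHJ.ncard_leaves]
  have hex : ∀ s : List (Fin b), s.length = K → ∃ x ∈ X, code x = s := by
    intro s hs
    have : s ∈ code '' X := by rw [hsurj]; exact hs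
    exact this
  choose! x hx hxs using hex
  refine ⟨x, hx, fun s a hs => ?_⟩
  have hsl : (s ++ [a]).length = K := by simpa using hs
  have h1 := hxs _ hsl
  have h2 := hx _ hsl
  have h3 := List.append_inj h1 (by have := hlen _ h2; omega)
  have h4 := hpre _ h2
  rw [h3.1] at h4
  have h5 : ca (x (s ++ [a])) = a := by simpa using h3.2
  rw [h5] at h4
  exact h4

end Converse

/-! ### Interleaved families of embeddings -/

section Vector
variable {b d K : ℕ}

theorem IsVectorComplete.exists_vectorEmb [NeZero b] {S : Fin d → Set (List (Fin b))} (h : IsVectorComplete K S)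
    (hS : ∀ i, (S i).Finite) : ∃ φ, IsVectorEmb K φ ∧ ∀ i, φ i '' treeLT b K = S i := by
  have := fun i => (h.complete i).exists_emb (hS i)
  choose φ hφ hS' using this
  have hmem : ∀ i s, s.length < K → φ i s ∈ level (S i) s.length := by
    intro i s hs
    rw [← hS' i]
    exact ⟨⟨s, hs, rfl⟩, (hφ i).height_eq hs⟩
  refine ⟨φ, ⟨hφ, ?_, ?_⟩, hS'⟩
  · intro i j hij s s' hl hs
    exact h.same_level i j hij s.length hs _ (hmem i s hs) _ (hl ▸ hmem j s' (hl ▸ hs))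
  · intro i j s s' hl hs
    -- Vector completeness compares consecutive levels only, so `s'` is first cut to length
    -- `s.length + 1`.
    have h1 : (s'.take (s.length + 1)).length = s.length + 1 := by simp; omega
    have h2 := hmem j (s'.take (s.length + 1)) (by omega)
    rw [h1] at h2
    have h3 := h.next_level s.length (by omega) i j _ (hmem i s (by omega)) _ h2
    have h4 := ((hφ j).mono (List.take_prefix (s.length + 1) s') hs).length_le
    omega

theorem IsVectorEmb.comp {k : ℕ} {φ ψ : Fin d → List (Fin b) → List (Fin b)} (h : IsVectorEmb K φ)
    (h' : IsVectorEmb k ψ) (hψ : ∀ i s, s.length < k → (ψ i s).length < K) :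
    IsVectorEmb k (fun i => φ i ∘ ψ i) where
  emb i := (h.emb i).comp (h'.emb i) (hψ i)
  same i j hij s s' hl hs := by
    rcases (h'.same i j hij s s' hl hs).lt_or_eq with h1 | h1
    · exact (h.next i j _ _ h1 (hψ j _ (hl ▸ hs))).le
    · exact h.same i j hij _ _ h1 (hψ i _ hs)
  next i j s s' hl hs := h.next i j _ _ (h'.next i j s s' hl hs) (hψ j _ hs)

/-- An interleaved family on a set of indices extends to all indices. -/
theorem IsVectorEmb.extend [NeZero b] {k e : ℕ} {I : Finset (Fin d)} (ι : Fin e ≃o I)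
    {ψ : Fin e → List (Fin b) → List (Fin b)} (h : IsVectorEmb k ψ)
    (hψ : ∀ j s, s.length < k → (ψ j s).length < K) (hk : k ≤ K) :
    ∃ ψ' : Fin d → List (Fin b) → List (Fin b), IsVectorEmb k ψ' ∧
      (∀ i s, s.length < k → (ψ' i s).length < K) ∧ ∀ j, ψ' (ι j) = ψ j := by
  classical
  have hb : b ≠ 0 := NeZero.ne b
  let z : Fin b := ⟨b - 1, by omega⟩
  have hz : ∀ x : Fin b, x ≤ z := fun x => by rw [Fin.le_def]; simp [z]; omega
  -- `A m` is the shortest length on level `m` of the given family, reached at the leftmost node of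
  -- its first component. `B i m` is the longest one among components before `i`, reached at
  -- rightmost nodes. A missing component `i` has level `m` placed at the maximum of the two,
  -- between its neighbours.
  let A : ℕ → ℕ := fun m => if h : 0 < e then (ψ ⟨0, h⟩ (List.replicate m 0)).length else m
  let B : Fin d → ℕ → ℕ := fun i m => (Finset.univ.filter fun j => (ι j : Fin d) < i).sup
    fun j => (ψ j (List.replicate m z)).length
  let lev : Fin d → ℕ → ℕ := fun i m => max (A m) (B i m)
  have hA : ∀ j s, s.length < k → A s.length ≤ (ψ j s).length := by
    intro j s hs
    have he : 0 < e := j.pos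
    simp only [A, dif_pos he]
    rcases Nat.eq_zero_or_pos j with h0 | h0
    · have : j = ⟨0, he⟩ := Fin.ext h0
      rw [this]
      exact (h.emb _).lex _ _ (by simp) (by simpa using hs)
        (lexLE_replicate_first fun x => Fin.zero_le x)
    · exact h.same _ _ (Fin.lt_def.2 h0) _ _ (by simp) (by simpa using hs)
  have hup : ∀ j s, s.length < k → (ψ j s).length ≤ (ψ j (List.replicate s.length z)).length :=
    fun j s hs => (h.emb j).lex _ _ (by simp) hs (lexLE_replicate_last hz)
  have hBle : ∀ i j s, s.length < k → (ι j : Fin d) < i → (ψ j s).length ≤ lev i s.length := by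
    intro i j s hs hij
    refine (hup j s hs).trans (le_trans ?_ (le_max_right _ _))
    exact Finset.le_sup (f := fun j => (ψ j (List.replicate s.length z)).length)
      (Finset.mem_filter.2 ⟨Finset.mem_univ _, hij⟩)
  have hlevle : ∀ i j s, s.length < k → i < (ι j : Fin d) → lev i s.length ≤ (ψ j s).length := by
    intro i j s hs hij
    refine max_le (hA j s hs) (Finset.sup_le fun j' hj' => ?_)
    have h1 : (ι j' : Fin d) < ι j := (Finset.mem_filter.1 hj').2.trans hij
    have h2 : j' < j := by
      have : ι j' < ι j := h1
      simpa using this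
    exact h.same j' j h2 _ _ (by simp) (by simpa using hs)
  have hlevmono : ∀ i i' m, i < i' → lev i m ≤ lev i' m := by
    intro i i' m hii
    refine max_le_max le_rfl (Finset.sup_mono fun j hj => ?_)
    rw [Finset.mem_filter] at hj ⊢
    exact ⟨hj.1, hj.2.trans hii⟩
  have hψA : ∀ j s m', s.length < m' → m' < k → (ψ j s).length < A m' := by
    intro j s m' hs hm'
    simp only [A, dif_pos j.pos]
    exact h.next _ _ _ _ (by simpa using hs) (by simpa using hm')
  have hAA : ∀ m m', m < m' → m' < k → A m < A m' := by
    intro m m' hm hm'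
    by_cases he : 0 < e
    · have := hψA ⟨0, he⟩ (List.replicate m 0) m' (by simpa using hm) hm'
      simpa only [A, dif_pos he] using this
    · simpa only [A, dif_neg he] using hm
  have hlevA : ∀ i m m', m < m' → m' < k → lev i m < A m' := by
    intro i m m' hm hm'
    have h0 := hAA m m' hm hm'
    refine max_lt h0 ((Finset.sup_lt_iff (by rw [Nat.bot_eq_zero]; omega)).2 fun j _ => ?_)
    exact hψA j _ m' (by simpa using hm) hm'
  have hlevK : ∀ i m, m < k → lev i m < K := by
    intro i m hm
    have h0 : A m < K := by
      by_cases he : 0 < e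
      · simp only [A, dif_pos he]
        exact hψ _ _ (by simpa using hm)
      · simp only [A, dif_neg he]; omega
    refine max_lt h0 ((Finset.sup_lt_iff (by rw [Nat.bot_eq_zero]; omega)).2 fun j _ => ?_)
    exact hψ _ _ (by simpa using hm)
  let ψ' : Fin d → List (Fin b) → List (Fin b) := fun i =>
    if hi : i ∈ I then ψ (ι.symm ⟨i, hi⟩) else spread (lev i)
  have hin : ∀ j, ψ' (ι j) = ψ j := fun j => by simp [ψ']
  have hcases : ∀ i, (∃ j, (ι j : Fin d) = i) ∨ ψ' i = spread (lev i) := by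
    intro i
    by_cases hi : i ∈ I
    · exact Or.inl ⟨ι.symm ⟨i, hi⟩, by simp⟩
    · exact Or.inr (by simp [ψ', hi])
  have hAψ : ∀ i s, s.length < k → A s.length ≤ (ψ' i s).length := by
    intro i s hs
    rcases hcases i with ⟨j, rfl⟩ | hi
    · rw [hin]; exact hA j s hs
    · rw [hi, length_spread]; exact le_max_left _ _
  have hψA' : ∀ i s m', s.length < m' → m' < k → (ψ' i s).length < A m' := by
    intro i s m' hs hm'
    rcases hcases i with ⟨j, rfl⟩ | hi
    · rw [hin]; exact hψA j s m' hs hm'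
    · rw [hi, length_spread]; exact hlevA i _ m' hs hm'
  refine ⟨ψ', ⟨fun i => ?_, ?_, fun i j s s' hs hs' => ?_⟩, fun i s hs => ?_, hin⟩
  · rcases hcases i with ⟨j, rfl⟩ | hi
    · rw [hin]; exact h.emb j
    · rw [hi]
      exact isSkewEmb_spread fun m m' hm hm' => (hlevA i m m' hm hm').trans_le (le_max_left _ _)
  · intro i i' hii s s' hl hs
    rcases hcases i with ⟨j, rfl⟩ | hi <;> rcases hcases i' with ⟨j', rfl⟩ | hi'
    · rw [hin, hin]
      have h2 : j < j' := by
        have : ι j < ι j' := hii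
        simpa using this
      exact h.same j j' h2 s s' hl hs
    · rw [hin, hi', length_spread, ← hl]
      exact hBle i' j s hs hii
    · rw [hin, hi, length_spread, hl]
      exact hlevle i j' s' (hl ▸ hs) hii
    · rw [hi, hi', length_spread, length_spread, hl]
      exact hlevmono i i' _ hii
  · exact (hψA' i s _ hs hs').trans_le (hAψ j s' hs')
  · rcases hcases i with ⟨j, rfl⟩ | hi
    · rw [hin]; exact hψ j s hs
    · rw [hi, length_spread]; exact hlevK i _ hs

end Vector

/-! ### Smooth colorings on good subspaces -/

section Smooth
variable {b n d K r : ℕ} {Λ : Type*} {D : TriPartition d} {c : MixedWord b n Λ D → Fin r}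
  {f : Fin d → VWord b n Λ} {X : D.D₁ → Set (List (Fin b))}

theorem IsMixedVariableWord.ws_subset (h : IsMixedVariableWord K f X) (i : Fin d) :
    ws (f i) ⊆ treeLT b n := by
  obtain ⟨T, hT, -, hf⟩ := h.variableWord i
  rwa [hf.ws_eq hT]

theorem IsMixedVariableWord.isTVariableWord (h : IsMixedVariableWord K f X) (i : Fin d) :
    IsTVariableWord (ws (f i)) (f i) := by
  obtain ⟨T, hT, -, hf⟩ := h.variableWord i
  rwa [hf.ws_eq hT]

/-- For a smooth coloring, the color in a good subspace with enough nodes depends only on the nodes. -/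
theorem IsGood.eq_of_node_eq (hg : IsGood c f X) (h : IsMixedVariableWord K f X) (hs : IsSmooth c)
    (h2 : ∀ (i : D.D₂) (t : List (Fin b)), ∃ t' ∈ ws (f i), t' ≠ t) {p q : MixedWord b n Λ D}
    (hp : p ∈ mixedSpan f X) (hq : q ∈ mixedSpan f X) (hpq : ∀ i, p.node i = q.node i) : c p = c q := by
  classical
  obtain ⟨Γ₁, Γ₂, hdis, hcov, hsm⟩ := hs
  obtain ⟨hw, hl, hn⟩ := hp
  choose α hα using hw
  have hvar := fun i => (h.isTVariableWord i).min
  -- The substitution of `p`, except that the variable at the node of each `i ∈ D₂` gets the letter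
  -- that `q` has there.
  let γ : Fin d → treeLT b n → Λ := fun i t =>
    if ∃ hi : i ∈ D.D₂, p.node ⟨i, hi⟩ = t then q.word i t else α i t
  have hγ : ∀ i : D.D₂, subst (f i) (γ i) (p.node i) = q.word i (p.node i) := by
    intro i
    rw [subst, (hvar i (p.node i) (hn i)).1, Sum.elim_inr]
    exact if_pos ⟨i.2, rfl⟩
  have hγ' : ∀ (i : D.D₂) (t : treeLT b n), t ≠ p.node i → (t : List (Fin b)) ∈ ws (f i) →
      subst (f i) (γ i) t = p.word i t := by
    intro i t ht htw
    rw [← hα i, subst, subst, (hvar i t htw).1, Sum.elim_inr, Sum.elim_inr]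
    exact if_neg (by rintro ⟨_, he⟩; exact ht he.symm)
  have hγ'' : ∀ (i : D.D₂) (s : treeLT b n), ¬ (p.node i : List (Fin b)) <+: (s : List (Fin b)) →
      subst (f i) (γ i) s = p.word i s := by
    intro i s hsi
    rw [← hα i, subst, subst]
    rcases hfs : f i s with a | u
    · rfl
    · rw [Sum.elim_inr, Sum.elim_inr]
      refine if_neg ?_
      rintro ⟨_, hu⟩
      refine hsi ((hvar i (p.node i) (hn i)).2 s ?_)
      rw [hfs, ← hu]
  choose τ hτ hτne using h2
  -- In `Γ₁` the coloring ignores the nodes, so they may be moved to other nodes of `ws (f i)`.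
  let t' : D.D₂ → treeLT b n := fun i =>
    if i ∈ Γ₁ then ⟨τ i (p.node i), h.ws_subset i (hτ i _)⟩ else p.node i
  have ht'ws : ∀ i : D.D₂, (t' i : List (Fin b)) ∈ ws (f i) := by
    intro i
    simp only [t']
    split_ifs
    · exact hτ i _
    · exact hn i
  have ht'₂ : ∀ i ∈ Γ₂, t' i = p.node i := fun i hi =>
    if_neg fun h1 => Set.disjoint_left.1 hdis h1 hi
  have ht'₁ : ∀ i ∈ Γ₁, t' i ≠ p.node i := by
    intro i hi he
    simp only [t', if_pos hi] at he
    exact hτne i (p.node i) (congrArg Subtype.val he)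
  let m : MixedWord b n Λ D := ⟨fun i => subst (f i) (γ i), p.leaf, p.node⟩
  let m₂ : MixedWord b n Λ D := ⟨fun i => subst (f i) (γ i), p.leaf, t'⟩
  let p₂ : MixedWord b n Λ D := ⟨fun i => if ∃ hi : i ∈ D.D₂, (⟨i, hi⟩ : D.D₂) ∈ Γ₂ then
    subst (f i) (γ i) else p.word i, p.leaf, t'⟩
  have e1 : c p = c p₂ := by
    refine hsm p p₂ ?_ ?_ ?_ (fun i => rfl) ?_
    · intro i hi
      have : i ∉ D.D₂ := Finset.disjoint_left.1 D.disjoint₀₂ hi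
      simp [p₂, this]
    · intro i hi
      have : i ∉ D.D₂ := Finset.disjoint_left.1 D.disjoint₁₂ hi
      simp [p₂, this]
    · intro i hi
      have : i ∉ Γ₂ := Set.disjoint_left.1 hdis hi
      simp [p₂, this]
    · intro i hi
      refine ⟨(ht'₂ i hi).symm, fun s hsi => ?_⟩
      have : p₂.word i = subst (f i) (γ i) := if_pos ⟨i.2, hi⟩
      rw [this]
      exact (hγ'' i s hsi).symm
  have e2 : c p₂ = c m₂ := by
    refine hg p₂ ⟨fun i => ?_, hl, ht'ws⟩ m₂ ⟨fun i => ⟨_, rfl⟩, hl, ht'ws⟩ fun i => ⟨rfl, ?_⟩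
    · simp only [p₂]
      split_ifs
      · exact ⟨_, rfl⟩
      · exact ⟨α i, hα i⟩
    · rcases (hcov ▸ Set.mem_univ i : i ∈ Γ₁ ∪ Γ₂) with hi | hi
      · have h1 : p₂.word i = p.word i := if_neg (by
          rintro ⟨_, h1⟩; exact Set.disjoint_left.1 hdis hi h1)
        rw [h1]
        exact (hγ' i _ (ht'₁ i hi) (ht'ws i)).symm
      · have h1 : p₂.word i = subst (f i) (γ i) := if_pos ⟨i.2, hi⟩
        rw [h1]
  have e3 : c m₂ = c m :=
    hsm m₂ m (fun _ _ => rfl) (fun _ _ => rfl) (fun _ _ => rfl) (fun _ => rfl)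
      fun i hi => ⟨ht'₂ i hi, fun _ _ => rfl⟩
  have e4 : c m = c q := by
    refine hg m ⟨fun i => ⟨_, rfl⟩, hl, hn⟩ q hq fun i => ⟨hpq i, ?_⟩
    rw [← hpq i]
    exact hγ i
  rw [e1, e2, e3, e4]

end Smooth

section Restrict
variable {b n d K r : ℕ} {Λ : Type*} {D : TriPartition d} {c : MixedWord b n Λ D → Fin r}
  {f : Fin d → VWord b n Λ} {X : D.D₁ → Set (List (Fin b))}

open Classical in
/-- The variable word in which the variables outside `T` are replaced by `a₀`. -/
noncomputable def restrictVWord (a₀ : Λ) (T : Set (List (Fin b))) (f : VWord b n Λ) : VWord b n Λ := fun s =>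
  Sum.elim Sum.inl (fun t : treeLT b n => if (t : List (Fin b)) ∈ T then Sum.inr t else Sum.inl a₀) (f s)

theorem restrictVWord_eq_inr {a₀ : Λ} {T : Set (List (Fin b))} {f : VWord b n Λ} {s t : treeLT b n} :
    restrictVWord a₀ T f s = Sum.inr t ↔ f s = Sum.inr t ∧ (t : List (Fin b)) ∈ T := by
  unfold restrictVWord
  rcases f s with a | u
  · simp
  · simp only [Sum.elim_inr, Sum.inr.injEq]
    split_ifs with h
    · constructor
      · rintro h1
        obtain rfl := Sum.inr.inj h1
        exact ⟨rfl, h⟩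
      · rintro ⟨rfl, -⟩; rfl
    · constructor
      · intro h1; simp at h1
      · rintro ⟨rfl, h1⟩; exact absurd h1 h

theorem isTVariableWord_restrict {a₀ : Λ} {T T' : Set (List (Fin b))} {f : VWord b n Λ}
    (h : IsTVariableWord T f) (hT : T' ⊆ T) : IsTVariableWord T' (restrictVWord a₀ T' f) where
  mem _ _ hst := (restrictVWord_eq_inr.1 hst).2
  min t ht := ⟨restrictVWord_eq_inr.2 ⟨(h.min t (hT ht)).1, ht⟩,
    fun s hs => (h.min t (hT ht)).2 s (restrictVWord_eq_inr.1 hs).1⟩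

theorem span_restrictVWord_subset {a₀ : Λ} {T : Set (List (Fin b))} {f : VWord b n Λ} :
    span (restrictVWord a₀ T f) ⊆ span f := by
  classical
  rintro _ ⟨α, rfl⟩
  refine ⟨fun t : treeLT b n => if (t : List (Fin b)) ∈ T then α t else a₀, ?_⟩
  funext s
  unfold subst restrictVWord
  rcases f s with a | u
  · rfl
  · simp only [Sum.elim_inr]
    split_ifs <;> rfl

theorem exists_monochromatic_subspace [NeZero b] [Nonempty Λ] {k : ℕ} (hk : 1 ≤ k) (hkK : k ≤ K)
    (h : IsMixedVariableWord K f X)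
    (hc : ∀ p ∈ mixedSpan f X, ∀ q ∈ mixedSpan f X, (∀ i, p.node i = q.node i) → c p = c q)
    (hCT : ∀ c' : CTSet 1 (vectorTree b K D.D₂.card) → Fin r,
      ∃ S ∈ CTSet k (vectorTree b K D.D₂.card), ∃ a : Fin r,
        ∀ R : CTSet 1 (vectorTree b K D.D₂.card), R.1 ∈ CTSet 1 S → c' R = a) :
    ∃ (f' : Fin d → VWord b n Λ) (X' : D.D₁ → Set (List (Fin b))), IsMixedVariableWord k f' X' ∧
      ∃ a : Fin r, ∀ p ∈ mixedSpan f' X' ∩ starSet b n Λ D, c p = a := by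
  classical
  obtain ⟨a₀⟩ := ‹Nonempty Λ›
  obtain ⟨φ, hφ, hφws⟩ := h.vector.exists_vectorEmb
    (fun i => (treeLT_finite b n).subset (h.ws_subset i))
  have hφn : ∀ i s, s.length < K → (φ i s).length < n := fun i s hs =>
    h.ws_subset i (hφws i ▸ ⟨s, hs, rfl⟩)
  have hleaf := fun i : D.D₁ => (hφ.emb i).exists_leaves (hk.trans hkK) (hφn i) (h.leaf_subset i)
    (h.leaf_card i) (by rw [hφws i]; exact h.leaf_skew i)
  choose x hxX hxext using hleaf
  let ι := D.D₂.orderIsoOfFin rfl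
  have hnodes := fun R : CTSet 1 (vectorTree b K D.D₂.card) =>
    exists_nodes_of_mem_CTSet_one (n := K) (fun _ => subset_rfl) R.2
  choose u hu hRu using hnodes
  have hxn : ∀ i s, s.length = K → (x i s).length = n := fun i s hs =>
    h.leaf_subset i (hxX i s hs)
  let base : CTSet 1 (vectorTree b K D.D₂.card) → MixedWord b n Λ D := fun R =>
    ⟨fun i => subst (f i) (fun _ => a₀),
      fun i => ⟨x i (List.replicate K 0), hxn i _ (by simp)⟩,
      fun i => ⟨φ i (u R (ι.symm i)), hφn i _ (hu R (ι.symm i))⟩⟩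
  have hbase : ∀ R, base R ∈ mixedSpan f X := fun R =>
    ⟨fun i => ⟨_, rfl⟩, fun i => hxX i _ (by simp), fun i => by
      rw [← hφws i]
      exact ⟨_, hu R (ι.symm i), rfl⟩⟩
  obtain ⟨S, hS, a, ha⟩ := hCT fun R => c (base R)
  obtain ⟨ψ₀, hψ₀, hψ₀S⟩ := hS.2.exists_vectorEmb fun j => (treeLT_finite b K).subset (hS.1 j)
  have hψ₀K : ∀ j s, s.length < k → (ψ₀ j s).length < K := fun j s hs =>
    hS.1 j (hψ₀S j ▸ ⟨s, hs, rfl⟩)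
  obtain ⟨ψ, hψ, hψK, hψι⟩ := hψ₀.extend ι hψ₀K hkK
  have hΦ := hφ.comp hψ hψK
  let T : Fin d → Set (List (Fin b)) := fun i => (φ i ∘ ψ i) '' treeLT b k
  have hT : ∀ i, T i ⊆ ws (f i) := by
    rintro i _ ⟨s, hs, rfl⟩
    rw [← hφws i]
    exact ⟨ψ i s, hψK i s hs, rfl⟩
  have hTn : ∀ i, T i ⊆ treeLT b n := fun i => (hT i).trans (h.ws_subset i)
  have hfT : ∀ i, IsTVariableWord (T i) (restrictVWord a₀ (T i) (f i)) := fun i =>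
    isTVariableWord_restrict (h.isTVariableWord i) (hT i)
  have hws : ∀ i, ws (restrictVWord a₀ (T i) (f i)) = T i := fun i => (hfT i).ws_eq (hTn i)
  let y : D.D₁ → List (Fin b) → List (Fin b) := fun i s =>
    x i (fit K (ψ i s.dropLast ++ s.drop (k - 1)))
  have hΦn : ∀ i s, s.length < k → ((φ i ∘ ψ i) s).length < n := fun i s hs =>
    hφn i _ (hψK i s hs)
  have hyX : ∀ i s, y i s ∈ X i := fun i s => hxX i _ (length_fit _ _)
  have hyn : ∀ (i : D.D₁) s, s.length = k → (y i s).length = n := fun i s _ =>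
    h.leaf_subset i (hyX i s)
  have hyext : ∀ (i : D.D₁) s (e : Fin b), s.length + 1 = k →
      (φ i ∘ ψ i) s ++ [e] <+: y i (s ++ [e]) := by
    intro i s e hs
    have h1 : (s ++ [e]).drop (k - 1) = [e] := by
      rw [show k - 1 = s.length by omega, List.drop_left]
    have h2 : (ψ i s).length < K := hψK i s (by omega)
    have h3 : ψ i s ++ [e] <+: fit K (ψ i s ++ [e]) := prefix_fit (by simpa using h2)
    have h4 := ((hφ.emb i).withLeaves (hφn i) (hxn i) (hxext i)).concat_prefix h3
      (by rw [length_fit]; omega)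
    simp only [withLeaves, if_pos h2, length_fit, lt_irrefl, if_false] at h4
    simpa only [y, h1, List.dropLast_concat, Function.comp] using h4
  refine ⟨fun i => restrictVWord a₀ (T i) (f i), fun i => y i '' leaves b k,
    ⟨fun i => ⟨T i, hTn i, (hΦ.emb i).isCompleteSkew hk, hfT i⟩, ?_, ?_, ?_, ?_⟩, a, ?_⟩
  · simp only [hws]
    exact hΦ.isVectorComplete hk
  · rintro i _ ⟨s, hs, rfl⟩
    exact hyn i s hs
  · intro i
    exact (hΦ.emb i).ncard_leaves (hΦn i) (hyn i) (hyext i)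
  · intro i
    rw [hws]
    exact (hΦ.emb i).isSkew_union (hΦn i) (hyn i) (hyext i)
  · rintro p ⟨⟨hw, hl, hn⟩, hstar⟩
    have hp : p ∈ mixedSpan f X := by
      refine ⟨fun i => span_restrictVWord_subset (hw i), fun i => ?_, fun i => hT i (hws i ▸ hn i)⟩
      obtain ⟨s, -, hs⟩ := hl i
      exact hs ▸ hyX i s
    have hnode : ∀ j, ∃ s, s.length < k ∧ φ (ι j) (ψ₀ j s) = (p.node (ι j) : List (Fin b)) := by
      intro j
      obtain ⟨s, hs, hs'⟩ := hws _ ▸ hn (ι j)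
      exact ⟨s, hs, by rw [← hs', Function.comp, hψι]⟩
    choose s hs hsn using hnode
    have hvec : IsVectorComplete 1 fun j => ({ψ₀ j (s j)} : Set (List (Fin b))) := by
      rw [isVectorComplete_singleton]
      intro j j' hjj
      have h1 := isVectorComplete_singleton.1 hstar.2 j j' hjj
      by_contra! h2
      have h3 := hφ.next (ι j') (ι j) _ _ h2 (hψ₀K j _ (hs j))
      rw [hsn, hsn] at h3
      exact absurd h1 (not_le.2 h3)
    let R : CTSet 1 (vectorTree b K D.D₂.card) := ⟨fun j => {ψ₀ j (s j)},
      fun j => Set.singleton_subset_iff.2 (hψ₀K j _ (hs j)), hvec⟩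
    rw [← ha R ⟨fun j => Set.singleton_subset_iff.2 (hψ₀S j ▸ ⟨s j, hs j, rfl⟩), hvec⟩]
    refine hc p hp _ (hbase R) fun i => Subtype.ext ?_
    obtain ⟨j, rfl⟩ := ι.surjective i
    have h1 : u R j = ψ₀ j (s j) := (Set.singleton_injective (congrFun (hRu R) j)).symm
    rw [← hsn j]
    change _ = φ (ι j) (u R (ι.symm (ι j)))
    rw [OrderIso.symm_apply_apply, h1]

end Restrict

/-- A bound for `𝒞𝒯` is at least the height of the trees it produces. -/
theorem le_of_mem_ctBounds {b d k r K : ℕ} [NeZero b] (hd : 1 ≤ d) (hr : 1 ≤ r)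
    (hK : K ∈ ctBounds 1 k b d r) : k ≤ K := by
  rcases Nat.eq_zero_or_pos k with rfl | hk
  · exact Nat.zero_le _
  obtain ⟨S, hS, -⟩ := hK.2 K le_rfl fun _ => ⟨0, hr⟩
  obtain ⟨ψ, hψ, hψS⟩ := hS.2.exists_vectorEmb fun j => (treeLT_finite b K).subset (hS.1 j)
  have hlen : ∀ m, m < k → m ≤ (ψ ⟨0, hd⟩ (List.replicate m 0)).length := by
    intro m
    induction m with
    | zero => intro _; exact Nat.zero_le _
    | succ m ih =>
      intro hm
      have := hψ.next ⟨0, hd⟩ ⟨0, hd⟩ (List.replicate m 0) (List.replicate (m + 1) 0)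
        (by simp) (by simpa using hm)
      have := ih (by omega)
      omega
  have h1 : (ψ ⟨0, hd⟩ (List.replicate (k - 1) 0)).length < K :=
    hS.1 ⟨0, hd⟩ (hψS ⟨0, hd⟩ ▸ Set.mem_image_of_mem _ (show _ < k by simp; omega))
  have := hlen (k - 1) (by omega)
  omega

theorem exists_homogeneous_of_dim_zero {b k r : ℕ}
    (c' : CTSet 1 (vectorTree b k 0) → Fin r) :
    ∃ S ∈ CTSet k (vectorTree b k 0), ∃ a : Fin r,
      ∀ R : CTSet 1 (vectorTree b k 0), R.1 ∈ CTSet 1 S → c' R = a := by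
  have hv : ∀ m, ∀ S : Fin 0 → Set (List (Fin b)), IsVectorComplete m S := fun m S =>
    ⟨fun i => i.elim0, fun i => i.elim0, fun _ _ i => i.elim0⟩
  exact ⟨fun _ => ∅, ⟨fun i => i.elim0, hv _ _⟩, c' ⟨fun _ => ∅, fun i => i.elim0, hv _ _⟩,
    fun R _ => congrArg c' (Subtype.ext (Subsingleton.elim _ _))⟩

theorem exists_homogeneous_of_height_one {b d r : ℕ} [NeZero b]
    (c' : CTSet 1 (vectorTree b 2 d) → Fin r) :
    ∃ S ∈ CTSet 1 (vectorTree b 2 d), ∃ a : Fin r,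
      ∀ R : CTSet 1 (vectorTree b 2 d), R.1 ∈ CTSet 1 S → c' R = a := by
  have hS : (fun _ => {[]}) ∈ CTSet 1 (vectorTree b 2 d) :=
    ⟨fun i => Set.singleton_subset_iff.2 (show _ < 2 by simp),
      isVectorComplete_singleton.2 fun _ _ _ => le_rfl⟩
  refine ⟨_, hS, c' ⟨_, hS⟩, fun R hR => congrArg c' (Subtype.ext ?_)⟩
  obtain ⟨t, ht, hRt⟩ := exists_nodes_of_mem_CTSet_one (n := 2)
    (fun _ => Set.singleton_subset_iff.2 (show _ < 2 by simp)) hR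
  rw [hRt]
  funext i
  rw [Set.mem_singleton_iff.1 (ht i)]

end TreeHJ

open TreeHJ

theorem mainTheorem5 (d₀ d₁ d₂ b ℓ k r K : ℕ) (hd : 1 ≤ d₀ + d₁ + d₂) (hb : 1 ≤ b) (hℓ : 1 ≤ ℓ)
    (hk : 1 ≤ k) (hr : 1 ≤ r)
    (hK : K = if k = 1 ∧ 1 ≤ d₂ then 2 else CT 1 k b d₂ r) :
    (1 ≤ d₂ → (ctBounds 1 k b d₂ r).Nonempty) ∧
    (mthjBounds d₀ d₁ d₂ b ℓ K r).Nonempty ∧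
    ∀ (Λ : Type*) [Finite Λ], Nat.card Λ = ℓ →
    ∀ n, MTHJ d₀ d₁ d₂ b ℓ K r ≤ n →
    ∀ D : TriPartition (d₀ + d₁ + d₂), D.D₀.card = d₀ → D.D₁.card = d₁ → D.D₂.card = d₂ →
    ∀ c : MixedWord b n Λ D → Fin r, IsSmooth c →
      ∃ (f : Fin (d₀ + d₁ + d₂) → VWord b n Λ) (X : D.D₁ → Set (List (Fin b))),
        IsMixedVariableWord k f X ∧
        ∃ a : Fin r, ∀ p ∈ mixedSpan f X ∩ starSet b n Λ D, c p = a := by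
  have : NeZero b := ⟨by omega⟩
  have hctne : (ctBounds 1 k b d₂ r).Nonempty := ctBounds_nonempty hk hr
  have hKprop : k ≤ K ∧ (1 ≤ d₂ → 2 ≤ K) ∧ ∀ c' : CTSet 1 (vectorTree b K d₂) → Fin r,
      ∃ S ∈ CTSet k (vectorTree b K d₂), ∃ a : Fin r,
        ∀ R : CTSet 1 (vectorTree b K d₂), R.1 ∈ CTSet 1 S → c' R = a := by
    rcases Nat.eq_zero_or_pos d₂ with rfl | hd₂
    · obtain rfl : K = k := by simpa [CT] using hK
      exact ⟨le_rfl, fun h => by omega, exists_homogeneous_of_dim_zero⟩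
    by_cases hk1 : k = 1
    · subst hk1
      obtain rfl : K = 2 := by rw [hK, if_pos ⟨rfl, hd₂⟩]
      exact ⟨by omega, fun _ => le_rfl, exists_homogeneous_of_height_one⟩
    · have hKm : K ∈ ctBounds 1 k b d₂ r := by
        rw [hK, if_neg (fun h => hk1 h.1), CT, if_neg (by omega)]
        exact Nat.sInf_mem hctne
      have := le_of_mem_ctBounds hd₂ hr hKm
      exact ⟨this, fun _ => by omega, hKm.2 K le_rfl⟩
  obtain ⟨hkK, hK2, hhom⟩ := hKprop
  have hne : (mthjBounds d₀ d₁ d₂ b ℓ K r).Nonempty := mthjBounds_nonempty hℓ (hk.trans hkK)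
  refine ⟨fun _ => hctne, hne, ?_⟩
  intro Λ _ hΛ n hn D hD₀ hD₁ hD₂ c hc
  have : Nonempty Λ := (Nat.card_pos_iff.1 (by omega)).1
  let σ : Fin ℓ ≃ Λ := (Finite.equivFinOfCardEq hΛ).symm
  obtain ⟨f, X, hf, hg⟩ := (Nat.sInf_mem hne).2 (Fin ℓ) (by simp) n hn D hD₀ hD₁ hD₂
    fun p => c (mapMixedWord σ p)
  have hf' := hf.map σ
  have hg' := hg.map σ
  refine exists_monochromatic_subspace hk hkK hf' (fun p hp q hq hpq =>
    hg'.eq_of_node_eq hf' hc (fun i t => ?_) hp hq hpq) (by rw [hD₂]; exact hhom)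
  have h2 : 2 ≤ K := hK2 (by rw [← hD₂]; exact Finset.card_pos.2 ⟨_, i.2⟩)
  obtain ⟨φ, hφ, hφws⟩ := (hf'.vector.complete i).exists_emb
    ((treeLT_finite b n).subset (hf'.ws_subset i))
  by_contra! hcon
  have h3 : ∀ s : List (Fin b), s.length < K → φ s = t := fun s hs =>
    hcon _ (hφws ▸ ⟨s, hs, rfl⟩)
  have := hφ.inj (s := []) (t := [0]) (by simp; omega) (by simp; omega)
    ((h3 _ (by simp; omega)).trans (h3 _ (by simp; omega)).symm)
  simp at this
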